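/- Let $\mathbb T^3=\mathbb R^3/(L\mathbb Z)^3$ with any period $L>0$, and let $\gamma\ge0$. For $x\in\mathbb T^3$, $v\in\mathbb R^3$ write $\langle v\rangle=(1+|v|^2)^{1/2}$, $\mu(v)=(2\pi)^{-3/2}e^{-|v|^2/2}$, $$a_{jk}(v)=(\delta_{jk}|v|^2-v_jv_k)|v|^{\gamma},\qquad \bar a_{jk}=a_{jk}*\mu,\qquad A_{+,1}=\tfrac12v_1-\partial_{v_1},$$ $$Q(G,F)(v)=\sum_{j,k=1}^3\partial_{v_j}\int_{\mathbb R^3}a_{jk}(v-v_*)\big[G(v_*)\partial_kF(v)-\partial_kG(v_*)F(v)\big]dv_*,$$ $$\Gamma(f,g)=\mu^{-1/2}Q(\sqrt\mu f,\sqrt\mu g),\qquad \mathcal L_1f=-\Gamma(\sqrt\mu,f),$$ and, for $t\ge0$ and $\delta>0$, $H_\delta=\frac{1}{\delta+1}t^{\delta+1}\partial_{x_1}-t^{\delta}A_{+,1}$. Put $$(f,g)_{H^2_xL^2_v}=\sum_{|\alpha|\le2}\int_{\mathbb T^3}\int_{\mathbb R^3}\partial_x^\alpha f\,\partial_x^\alpha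 g\,dv\,dx,\qquad \|f\|_{H^2_xL^2_v}^2=(f,f)_{H^2_xL^2_v},$$ $$|||g|||_\sigma^2=\sum_{j,k=1}^3\int_{\mathbb R^3}\Big(\bar a_{jk}\,\partial_jg\,\partial_kg+\tfrac14\bar a_{jk}v_jv_kg^2\Big)dv,\qquad |||f|||_{H^2_x,\sigma}^2=\sum_{|\alpha|\le2}\int_{\mathbb T^3}|||\partial_x^\alpha f(x,\cdot)|||_\sigma^2\,dx.$$ Let $[\gamma]$ be the integer part of $\gamma$ and $C_m^l=\binom ml$. **Proposition 3.4.** Let $\gamma\ge0$. There is a constant $C_4>0$, depending only on $\gamma$, such that for all $L>0$, all integers $m,n\ge1$, all real-valued $f\in H^\infty(\mathbb T^3_x;\mathcal S(\mathbb R^3_v))$, all $\delta_1,\delta_2>\frac32$ and all $t\ge0$, $$\begin{aligned} &\big(H^{m}_{\delta_{1}}H^{n}_{\delta_{2}}\mathcal L_{1}f,\ H^{m}_{\delta_{1}}H^{n}_{\delta_{2}}f\big)_{H^{2}_{x}L^{2}_{v}}\ge\tfrac34|||H^{m}_{\delta_{1}}H^{n}_{\delta_{2}}f|||_{H^{2}_{x},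 \sigma}^{2}-C_{4}\|\langle v\rangle^{\frac\gamma2}H^{m}_{\delta_{1}}H^{n}_{\delta_{2}}f\|^{2}_{H^{2}_{x}L^{2}_{v}}\\ &-C_{4}\sum_{l=1}^{m}C^{l}_{m}\,l^{\frac{[\gamma]}{2}+2}\sqrt{l!}\,t^{\delta_{1} l}\,|||H^{m-l}_{\delta_{1}}H^{n}_{\delta_{2}}f|||_{H^{2}_{x}, \sigma}|||H^{m}_{\delta_{1}}H^{n}_{\delta_{2}}f|||_{H^{2}_{x}, \sigma}\\ &-C_{4}\sum_{l=0}^{m}C_{m}^{l}\,l^{\frac{[\gamma]}{2}+1}\sqrt{l!}\,n\,t^{\delta_{1}l}t^{\delta_{2}}\,|||H^{m-l}_{\delta_{1}}H^{n-1}_{\delta_{2}}f|||_{H^{2}_{x}, \sigma}|||H^{m}_{\delta_{1}}H^{n}_{\delta_{2}}f|||_{H^{2}_{x}, \sigma}\\ &-C_{4}\sum_{p=1}^{n}C^{p}_{n}\,p^{\frac{[\gamma]}{2}+2}\sqrt{p!}\,t^{\delta_{2} p}\,|||H^{m}_{\delta_{1}}H^{n-p}_{\delta_{2}}f|||_{H^{2}_{x},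 \sigma}|||H^{m}_{\delta_{1}}H^{n}_{\delta_{2}}f|||_{H^{2}_{x}, \sigma}\\ &-C_{4}\sum_{p=0}^{n}C_{n}^{p}\,p^{\frac{[\gamma]}{2}+1}\sqrt{p!}\,m\,t^{\delta_{1}}t^{\delta_{2}p}\,|||H^{m-1}_{\delta_{1}}H^{n-p}_{\delta_{2}}f|||_{H^{2}_{x}, \sigma}|||H^{m}_{\delta_{1}}H^{n}_{\delta_{2}}f|||_{H^{2}_{x}, \sigma}\\ &-C_{4}\sum_{l=1}^{m}\sum_{p=1}^{n}C_{n}^{p}C_{m}^{l}\,(p+l)^{\frac{[\gamma]}{2}+2}\sqrt{(p+l)!}\,t^{\delta_{1} l}t^{\delta_{2} p}\,|||H^{m-l}_{\delta_{1}}H^{n-p}_{\delta_{2}}f|||_{H^{2}_{x}, \sigma}|||H^{m}_{\delta_{1}}H^{n}_{\delta_{2}}f|||_{H^{2}_{x}, \sigma}. \end{aligned}$$ -/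

import Mathlib

noncomputable section

namespace LandauHard

/-- The Euclidean space `ℝ³`; used for the velocity variable and, through periodic functions,
for the space variable. -/
abbrev E3 := EuclideanSpace ℝ (Fin 3)

/-- The partial derivative `∂_j g` of a function on `ℝ³`. -/
def pd (j : Fin 3) (g : E3 → ℝ) : E3 → ℝ :=
  fun v => lineDeriv ℝ g v (EuclideanSpace.single j 1)

/-- The Maxwellian `μ(v) = (2π)^{-3/2} exp(-|v|²/2)`. -/
def mu (v : E3) : ℝ := (2 * Real.pi) ^ (-(3 / 2) : ℝ) * Real.exp (-(‖v‖ ^ 2 / 2))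

/-- `√μ`. -/
def sqrtMu (v : E3) : ℝ := Real.sqrt (mu v)

/-- The collision matrix `a_{jk}(v) = (δ_{jk}|v|² - v_j v_k) |v|^γ`. -/
def a (γ : ℝ) (j k : Fin 3) (v : E3) : ℝ :=
  ((if j = k then 1 else 0) * ‖v‖ ^ 2 - v j * v k) * ‖v‖ ^ γ

/-- `ā_{jk} = a_{jk} * μ`. -/
def abar (γ : ℝ) (j k : Fin 3) (v : E3) : ℝ := ∫ w : E3, a γ j k (v - w) * mu w

/-- The Landau collision operator `Q(G, F)`. -/
def Q (γ : ℝ) (G F : E3 → ℝ) : E3 → ℝ := fun v =>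
  ∑ j : Fin 3, ∑ k : Fin 3,
    pd j (fun u => ∫ w : E3, a γ j k (u - w) * (G w * pd k F u - pd k G w * F u)) v

/-- `Γ(f, g) = μ^{-1/2} Q(√μ f, √μ g)`. -/
def Gam (γ : ℝ) (f g : E3 → ℝ) : E3 → ℝ := fun v =>
  (sqrtMu v)⁻¹ * Q γ (fun u => sqrtMu u * f u) (fun u => sqrtMu u * g u) v

/-- `𝓛₁ f = -Γ(√μ, f)` for a function of the velocity. -/
def L1v (γ : ℝ) (f : E3 → ℝ) : E3 → ℝ := fun v => -Gam γ sqrtMu f v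

/-- `𝓛₁` on functions `f(x, v)`; it acts in the velocity only. -/
def L1 (γ : ℝ) (f : E3 → E3 → ℝ) : E3 → E3 → ℝ := fun x => L1v γ (f x)

/-- The creation operator `A_{+,k} = v_k / 2 - ∂_{v_k}`. -/
def Aplus (k : Fin 3) (g : E3 → ℝ) : E3 → ℝ := fun v => v k / 2 * g v - pd k g v

/-- The partial derivative `∂_{x_j}` of a function `f(x, v)`. -/
def dx (j : Fin 3) (f : E3 → E3 → ℝ) : E3 → E3 → ℝ := fun x v => pd j (fun y => f y v) x

/-- `∂_x^α = ∂_{x_1}^{α_1} ∂_{x_2}^{α_2} ∂_{x_3}^{α_3}`. -/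
def dxα (α : Fin 3 → ℕ) (f : E3 → E3 → ℝ) : E3 → E3 → ℝ :=
  (dx 0)^[α 0] ((dx 1)^[α 1] ((dx 2)^[α 2] f))

/-- The vector field `H_δ = t^{δ+1} / (δ+1) ∂_{x_1} - t^δ A_{+,1}` at time `t`
(the first coordinate has index `0`). -/
def H (t δ : ℝ) (f : E3 → E3 → ℝ) : E3 → E3 → ℝ := fun x v =>
  1 / (δ + 1) * t ^ (δ + 1) * dx 0 f x v - t ^ δ * Aplus 0 (f x) v

/-- `H_{δ₁}^m H_{δ₂}^n f`. -/
def HH (t δ₁ δ₂ : ℝ) (m n : ℕ) (f : E3 → E3 → ℝ) : E3 → E3 → ℝ :=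
  (H t δ₁)^[m] ((H t δ₂)^[n] f)

/-- A fundamental cell `[0, L)³` of the torus `𝕋³ = ℝ³ / (L ℤ)³`. -/
def cell (L : ℝ) : Set E3 := {x | ∀ i, x i ∈ Set.Ico 0 L}

/-- `∑_{|α| ≤ 2} F α` over multi-indices `α ∈ ℕ³`. -/
def sumLeTwo (F : (Fin 3 → ℕ) → ℝ) : ℝ :=
  ∑ d ∈ Finset.range 3, ∑ α ∈ Finset.piAntidiag (Finset.univ : Finset (Fin 3)) d, F α

/-- The scalar product `(f, g)_{H²_x L²_v}` for the torus of period `L`. -/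
def innerH2 (L : ℝ) (f g : E3 → E3 → ℝ) : ℝ :=
  sumLeTwo fun α => ∫ x in cell L, ∫ v : E3, dxα α f x v * dxα α g x v

/-- The norm `‖f‖_{H²_x L²_v}`. -/
def normH2 (L : ℝ) (f : E3 → E3 → ℝ) : ℝ := Real.sqrt (innerH2 L f f)

/-- `|||g|||²_σ` for a function of the velocity. -/
def sigmaSq (γ : ℝ) (g : E3 → ℝ) : ℝ :=
  ∑ j : Fin 3, ∑ k : Fin 3, ∫ v : E3,
    (abar γ j k v * pd j g v * pd k g v + 1 / 4 * (abar γ j k v * v j * v k * g v ^ 2))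

/-- The norm `|||f|||_{H²_x, σ}`. -/
def normSigma (L γ : ℝ) (f : E3 → E3 → ℝ) : ℝ :=
  Real.sqrt (sumLeTwo fun α => ∫ x in cell L, sigmaSq γ (dxα α f x))

/-- The weight `⟨v⟩ = (1 + |v|²)^{1/2}`. -/
def jap (v : E3) : ℝ := Real.sqrt (1 + ‖v‖ ^ 2)

/-- The space `H^∞(𝕋³_x; 𝒮(ℝ³_v))` for the torus of period `L`: real functions `f(x, v)` that are
smooth, `L`-periodic in each coordinate of `x`, and all of whose derivatives in `(x, v)` decay
in `v` faster than every power, uniformly in `x`. -/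
structure MemHInftySchwartz (L : ℝ) (f : E3 → E3 → ℝ) : Prop where
  smooth : ContDiff ℝ (⊤ : ℕ∞) (fun z : E3 × E3 => f z.1 z.2)
  periodic : ∀ (i : Fin 3) (x v : E3), f (x + EuclideanSpace.single i L) v = f x v
  decay : ∀ k d : ℕ, ∃ C : ℝ, ∀ x v : E3,
    ‖v‖ ^ k * ‖iteratedFDeriv ℝ d (fun z : E3 × E3 => f z.1 z.2) (x, v)‖ ≤ C

end LandauHard

end

open LandauHard

/-! Write A_{±,j} = v_j/2 ∓ ∂_{v_j}. Conjugation by √μ puts the operator in the factored form 𝓛₁ = Σ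
A_{+,j} ā_{jk} A_{-,k} (`Sch.L1_eq`). This rests on A_{-,j}√μ = 0 and on a(z)z = 0; the latter
allows w to be replaced by v in ∫ a(v-w) w μ(w) dw.

The fields H_δ are adapted to this form. With s = t^δ they commute with ∂_x and with every A_{+,j};
[H_δ, A_{-,k}] is the scalar s for k = 1 and zero otherwise; and [H_δ, b] = s ∂_1 b for a multiplier
b(v). Hence H_{δ₁}^m H_{δ₂}^n 𝓛₁ expands by two Leibniz formulas. Moving the outer A_{+,j} to the
other factor leaves the pairings Σ ∫ (∂_1^q ā_{jk}) (A_{-,k}G)(A_{-,j}F), q = l + p, together with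
pairings in which the scalar commutator has replaced A_{-,1} (`Sch.int_HP_Lop`).

The factor √(q!) comes from ∂_1^q μ = (-1)^q √μ A_{+,1}^q √μ: by the ladder relations the squared
norm of A_{+,1}^q √μ is q! times the mass of μ. Young's inequality then bounds the form of ∂_1^q ā
by √(q!) times ⟨v⟩^γ (|ξ|² + |v × ξ|²) (`Sch.abs_bil_abarD_le`), and ā itself dominates a multiple
of that form (`Sch.En_le_bil_abarD`). So every pairing is at most C √(q!) |||G||| |||F|||; where an
annihilation operator is lost, the bound of ⟨v⟩^{γ/2+1} G by the σ norm (`Sch.coercive`) replaces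
it.

For l = p = 0 the pairing equals the squared σ norm plus a drift term ∫ b·∇(u²)/2. Integration by
parts puts the derivative on b, whose derivatives grow only like ⟨v⟩^{γ+1}. This lies between the
weights ⟨v⟩^{γ+2}, controlled by the σ norm, and ⟨v⟩^γ, so a quarter of the σ norm absorbs it
(`Sch.main_term`).

Finally (n-p) C(n,p) = (p+1) C(n,p+1) turns each pairing with a lost annihilation operator into a
term of the same shape as the others, with weight q √((q-1)!) at most q^{[γ]/2+2} √(q!)
(`binomial_sum_lower_bound`). The two sums containing H^{m-1} or H^{n-1} are therefore extra room in
the estimate. -/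

noncomputable section

namespace LandauHard

open scoped ContDiff
open Function (uncurry)
open MeasureTheory

/-! ### Rapidly decaying functions and temperate multipliers -/

/-- Smooth functions on `ℝ³ × ℝ³` whose derivatives decay rapidly in the second variable,
uniformly in the first. -/
structure IsSch (f : E3 → E3 → ℝ) : Prop where
  smooth : ContDiff ℝ ∞ (uncurry f)
  decay : ∀ k d : ℕ, ∃ C : ℝ, ∀ x v : E3,
    (1 + ‖v‖) ^ k * ‖iteratedFDeriv ℝ d (uncurry f) (x, v)‖ ≤ C

/-- Smooth functions on `ℝ³ × ℝ³` whose derivatives grow polynomially in the second variable,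
uniformly in the first. -/
structure IsTemp (g : E3 → E3 → ℝ) : Prop where
  smooth : ContDiff ℝ ∞ (uncurry g)
  growth : ∀ d : ℕ, ∃ (k : ℕ) (C : ℝ), ∀ x v : E3,
    ‖iteratedFDeriv ℝ d (uncurry g) (x, v)‖ ≤ C * (1 + ‖v‖) ^ k

theorem MemHInftySchwartz.isSch {L : ℝ} {f : E3 → E3 → ℝ} (hf : MemHInftySchwartz L f) :
    IsSch f := by
  refine ⟨hf.smooth, fun k d => ?_⟩
  obtain ⟨C₀, h₀⟩ := hf.decay 0 d
  obtain ⟨C₁, h₁⟩ := hf.decay k d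
  refine ⟨2 ^ (k - 1) * (C₀ + C₁), fun x v => ?_⟩
  have h := add_pow_le zero_le_one (norm_nonneg v) k
  have h₀' := h₀ x v
  have h₁' := h₁ x v
  rw [one_pow] at h
  calc _ ≤ (2 ^ (k - 1) * (1 + ‖v‖ ^ k)) * ‖iteratedFDeriv ℝ d (uncurry f) (x, v)‖ := by gcongr
    _ = 2 ^ (k - 1) * (‖v‖ ^ 0 * ‖iteratedFDeriv ℝ d (uncurry f) (x, v)‖ +
          ‖v‖ ^ k * ‖iteratedFDeriv ℝ d (uncurry f) (x, v)‖) := by ring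
    _ ≤ _ := by gcongr <;> assumption

theorem IsSch.isTemp {f : E3 → E3 → ℝ} (hf : IsSch f) : IsTemp f := by
  refine ⟨hf.smooth, fun d => ?_⟩
  obtain ⟨C, h⟩ := hf.decay 0 d
  exact ⟨0, C, fun x v => by simpa using h x v⟩

theorem IsTemp.uniform {g : E3 → E3 → ℝ} (hg : IsTemp g) (d : ℕ) : ∃ (k : ℕ) (C : ℝ), 0 ≤ C ∧
    ∀ i ≤ d, ∀ x v : E3, ‖iteratedFDeriv ℝ i (uncurry g) (x, v)‖ ≤ C * (1 + ‖v‖) ^ k := by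
  choose k C h using hg.growth
  refine ⟨∑ i ∈ Finset.range (d + 1), k i, ∑ i ∈ Finset.range (d + 1), |C i|,
    Finset.sum_nonneg fun _ _ => abs_nonneg _, fun i hi x v => (h i x v).trans ?_⟩
  have hi' : i ∈ Finset.range (d + 1) := Finset.mem_range.2 (by omega)
  have h1 : |C i| ≤ ∑ i ∈ Finset.range (d + 1), |C i| :=
    Finset.single_le_sum (f := fun i => |C i|) (fun _ _ => abs_nonneg _) hi'
  have h2 : k i ≤ ∑ i ∈ Finset.range (d + 1), k i :=
    Finset.single_le_sum (f := k) (fun _ _ => Nat.zero_le _) hi'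
  have h3 : (1 : ℝ) ≤ 1 + ‖v‖ := by linarith [norm_nonneg v]
  calc C i * (1 + ‖v‖) ^ k i ≤ |C i| * (1 + ‖v‖) ^ k i := by gcongr; exact le_abs_self _
    _ ≤ _ := mul_le_mul h1 (pow_le_pow_right₀ h3 h2) (by positivity)
      (Finset.sum_nonneg fun _ _ => abs_nonneg _)

theorem IsTemp.mul_isSch {g f : E3 → E3 → ℝ} (hg : IsTemp g) (hf : IsSch f) :
    IsSch (fun x v => g x v * f x v) := by
  refine ⟨hg.smooth.mul hf.smooth, fun k d => ?_⟩
  obtain ⟨l, C, hC, h⟩ := hg.uniform d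
  choose B hB using fun i => hf.decay (k + l) i
  refine ⟨∑ i ∈ Finset.range (d + 1), (d.choose i : ℝ) * (C * B (d - i)), fun x v => ?_⟩
  have hm := norm_iteratedFDeriv_mul_le hg.smooth hf.smooth (x, v) (n := d) (by exact_mod_cast le_top)
  calc (1 + ‖v‖) ^ k * ‖iteratedFDeriv ℝ d (uncurry fun x v => g x v * f x v) (x, v)‖
      ≤ (1 + ‖v‖) ^ k * _ := by gcongr; exact hm
    _ = ∑ i ∈ Finset.range (d + 1), (1 + ‖v‖) ^ k *
          ((d.choose i : ℝ) * ‖iteratedFDeriv ℝ i (uncurry g) (x, v)‖ *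
            ‖iteratedFDeriv ℝ (d - i) (uncurry f) (x, v)‖) := Finset.mul_sum _ _ _
    _ ≤ _ := by
      refine Finset.sum_le_sum fun i hi => ?_
      have hi' : i ≤ d := by have := Finset.mem_range.1 hi; omega
      calc _ ≤ (1 + ‖v‖) ^ k * ((d.choose i : ℝ) * (C * (1 + ‖v‖) ^ l) *
            ‖iteratedFDeriv ℝ (d - i) (uncurry f) (x, v)‖) := by gcongr; exact h i hi' x v
        _ = (d.choose i : ℝ) * (C * ((1 + ‖v‖) ^ (k + l) *
            ‖iteratedFDeriv ℝ (d - i) (uncurry f) (x, v)‖)) := by ring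
        _ ≤ _ := by gcongr; exact hB _ x v

theorem isTemp_of_hasTemperateGrowth {b : E3 → ℝ} (hb : b.HasTemperateGrowth) :
    IsTemp (fun _ v => b v) := by
  refine ⟨hb.1.comp contDiff_snd, fun d => ?_⟩
  obtain ⟨k, C, h⟩ := hb.2 d
  refine ⟨k, C, fun x v => (le_trans ?_ (h v))⟩
  have : uncurry (fun _ v => b v) = b ∘ (ContinuousLinearMap.snd ℝ E3 E3) := rfl
  rw [this, ContinuousLinearMap.iteratedFDeriv_comp_right _ hb.1 _ (by exact_mod_cast le_top)]
  refine (ContinuousMultilinearMap.norm_compContinuousLinearMap_le _ _).trans ?_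
  refine mul_le_of_le_one_right (norm_nonneg _) (Finset.prod_le_one (fun _ _ => norm_nonneg _)
    fun _ _ => ContinuousLinearMap.norm_snd_le _ _ _)

theorem IsSch.fderiv_apply {f : E3 → E3 → ℝ} (hf : IsSch f) (w : E3 × E3) :
    IsSch (fun x v => fderiv ℝ (uncurry f) (x, v) w) := by
  have hs : ContDiff ℝ ∞ (fderiv ℝ (uncurry f)) := hf.smooth.fderiv_right (by norm_cast)
  refine ⟨hs.clm_apply contDiff_const, fun k d => ?_⟩
  obtain ⟨C, h⟩ := hf.decay k (d + 1)
  refine ⟨‖w‖ * C, fun x v => ?_⟩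
  have h1 : ‖iteratedFDeriv ℝ d (fun z => fderiv ℝ (uncurry f) z w) (x, v)‖ ≤
      ‖w‖ * ‖iteratedFDeriv ℝ d (fderiv ℝ (uncurry f)) (x, v)‖ :=
    norm_iteratedFDeriv_clm_apply_const hs.contDiffAt (N := ∞) (by exact_mod_cast le_top)
  rw [norm_iteratedFDeriv_fderiv] at h1
  calc (1 + ‖v‖) ^ k * ‖iteratedFDeriv ℝ d (fun z => fderiv ℝ (uncurry f) z w) (x, v)‖
      ≤ (1 + ‖v‖) ^ k * (‖w‖ * ‖iteratedFDeriv ℝ (d + 1) (uncurry f) (x, v)‖) := by gcongr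
    _ = ‖w‖ * ((1 + ‖v‖) ^ k * ‖iteratedFDeriv ℝ (d + 1) (uncurry f) (x, v)‖) := by ring
    _ ≤ _ := by gcongr; exact h x v

/-! ### The space on which the operators act as endomorphisms -/

/-- The functions satisfying `IsSch`, as a submodule. -/
def schSubmodule : Submodule ℝ (E3 → E3 → ℝ) where
  carrier := {f | IsSch f}
  zero_mem' := by
    refine ⟨contDiff_const, fun k d => ⟨0, fun x v => ?_⟩⟩
    have : uncurry (0 : E3 → E3 → ℝ) = 0 := rfl
    rw [this]
    simp
  add_mem' := by
    intro f g hf hg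
    refine ⟨hf.smooth.add hg.smooth, fun k d => ?_⟩
    obtain ⟨C, h⟩ := hf.decay k d
    obtain ⟨B, h'⟩ := hg.decay k d
    refine ⟨C + B, fun x v => ?_⟩
    have : uncurry (f + g) = uncurry f + uncurry g := rfl
    rw [this, iteratedFDeriv_add_apply (hf.smooth.of_le (by exact_mod_cast le_top)).contDiffAt
      (hg.smooth.of_le (by exact_mod_cast le_top)).contDiffAt]
    calc _ ≤ (1 + ‖v‖) ^ k * (‖iteratedFDeriv ℝ d (uncurry f) (x, v)‖ +
        ‖iteratedFDeriv ℝ d (uncurry g) (x, v)‖) := by gcongr; exact norm_add_le _ _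
      _ ≤ _ := by rw [mul_add]; exact add_le_add (h x v) (h' x v)
  smul_mem' := by
    intro c f hf
    have h : IsTemp (fun _ _ => c) :=
      isTemp_of_hasTemperateGrowth (b := fun _ => c) (Function.HasTemperateGrowth.const c)
    exact h.mul_isSch hf

/-- The vector space of functions satisfying `IsSch`. -/
def Sch : Type := schSubmodule

instance : AddCommGroup Sch := inferInstanceAs (AddCommGroup schSubmodule)
instance : Module ℝ Sch := inferInstanceAs (Module ℝ schSubmodule)

/-- The function underlying an element of `Sch`. -/
def Sch.fn (u : Sch) : E3 → E3 → ℝ := Subtype.val (p := fun f => f ∈ schSubmodule) u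

instance : CoeFun Sch (fun _ => E3 → E3 → ℝ) := ⟨Sch.fn⟩

/-- A function satisfying `IsSch` as an element of `Sch`. -/
def Sch.of (f : E3 → E3 → ℝ) (hf : IsSch f) : Sch := Subtype.mk (p := fun f => f ∈ schSubmodule) f hf

theorem Sch.of_fn (f : E3 → E3 → ℝ) (hf : IsSch f) : (Sch.of f hf).fn = f := rfl

theorem Sch.isSch (u : Sch) : IsSch u.fn := Subtype.property (p := fun f => f ∈ schSubmodule) u

@[ext] theorem Sch.ext {u w : Sch} (h : ∀ x v, u x v = w x v) : u = w :=
  Subtype.ext (funext fun x => funext fun v => h x v)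

@[simp] theorem Sch.add_app (u w : Sch) (x v : E3) : (u + w) x v = u x v + w x v := rfl
@[simp] theorem Sch.sub_app (u w : Sch) (x v : E3) : (u - w) x v = u x v - w x v := rfl
@[simp] theorem Sch.neg_app (u : Sch) (x v : E3) : (-u) x v = -u x v := rfl
@[simp] theorem Sch.smul_app (c : ℝ) (u : Sch) (x v : E3) : (c • u) x v = c * u x v := rfl
@[simp] theorem Sch.zero_app (x v : E3) : (0 : Sch) x v = 0 := rfl
@[simp] theorem Sch.sum_app {ι : Type*} (s : Finset ι) (u : ι → Sch) (x v : E3) :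
    (∑ i ∈ s, u i) x v = ∑ i ∈ s, u i x v := by
  induction s using Finset.cons_induction with
  | empty => rfl
  | cons a s ha ih => rw [Finset.sum_cons, Finset.sum_cons, Sch.add_app, ih]

theorem Sch.differentiable (u : Sch) : Differentiable ℝ (uncurry u.fn) :=
  u.isSch.smooth.differentiable (by simp)

/-- Directional derivative. -/
def Sch.dir (w : E3 × E3) : Sch →ₗ[ℝ] Sch where
  toFun u := Sch.of _ (u.isSch.fderiv_apply w)
  map_add' u u' := by
    ext x v
    have : uncurry (u + u' : Sch).fn = uncurry u.fn + uncurry u'.fn := rfl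
    simp only [this, Sch.of_fn, Sch.add_app]
    rw [fderiv_add u.differentiable.differentiableAt u'.differentiable.differentiableAt]
    rfl
  map_smul' c u := by
    ext x v
    have : uncurry (c • u : Sch).fn = c • uncurry u.fn := rfl
    simp only [RingHom.id_apply, this, Sch.of_fn, Sch.smul_app]
    rw [fderiv_const_smul u.differentiable.differentiableAt]
    rfl

theorem Sch.dir_app (w : E3 × E3) (u : Sch) (x v : E3) :
    Sch.dir w u x v = fderiv ℝ (uncurry u.fn) (x, v) w := rfl

theorem Sch.dir_comm (w w' : E3 × E3) : Commute (Sch.dir w : Module.End ℝ Sch) (Sch.dir w') := by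
  refine LinearMap.ext fun u => ?_
  ext x v
  have key : ∀ a b : E3 × E3, fderiv ℝ (fun z => fderiv ℝ (uncurry u.fn) z a) (x, v) b =
      fderiv ℝ (fderiv ℝ (uncurry u.fn)) (x, v) b a := by
    intro a b
    have hs : ContDiff ℝ ∞ (fderiv ℝ (uncurry u.fn)) := u.isSch.smooth.fderiv_right (by norm_cast)
    rw [fderiv_clm_apply (hs.differentiable (by simp)).differentiableAt
      (differentiableAt_const _)]
    simp
  change fderiv ℝ (fun z => fderiv ℝ (uncurry u.fn) z w') (x, v) w =
    fderiv ℝ (fun z => fderiv ℝ (uncurry u.fn) z w) (x, v) w'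
  rw [key, key]
  exact (u.isSch.smooth.contDiffAt (x := (x, v))).isSymmSndFDerivAt (by simpa using ENat.LEInfty.out) w w'

/-- Pointwise product. -/
def Sch.mul : Sch →ₗ[ℝ] Sch →ₗ[ℝ] Sch :=
  LinearMap.mk₂ ℝ (fun u w => Sch.of _ (u.isSch.isTemp.mul_isSch w.isSch))
    (fun u u' w => by ext x v; exact add_mul _ _ _)
    (fun c u w => by ext x v; exact mul_assoc _ _ _)
    (fun u w w' => by ext x v; exact mul_add _ _ _)
    (fun c u w => by ext x v; exact mul_left_comm _ _ _)

@[simp] theorem Sch.mul_app (u w : Sch) (x v : E3) : Sch.mul u w x v = u x v * w x v := rfl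

theorem Sch.dir_mul (z : E3 × E3) (u w : Sch) :
    Sch.dir z (Sch.mul u w) = Sch.mul (Sch.dir z u) w + Sch.mul u (Sch.dir z w) := by
  ext x v
  have : uncurry (Sch.mul u w).fn = uncurry u.fn * uncurry w.fn := rfl
  simp only [Sch.dir_app, this, Sch.add_app, Sch.mul_app]
  rw [fderiv_mul u.differentiable.differentiableAt w.differentiable.differentiableAt]
  simp [uncurry]
  ring

/-- Multiplication by a function of temperate growth of the velocity. -/
def Sch.wt (b : E3 → ℝ) (hb : b.HasTemperateGrowth) : Sch →ₗ[ℝ] Sch where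
  toFun u := Sch.of _ ((isTemp_of_hasTemperateGrowth hb).mul_isSch u.isSch)
  map_add' u u' := by ext x v; exact mul_add _ _ _
  map_smul' c u := by ext x v; exact mul_left_comm _ _ _

@[simp] theorem Sch.wt_app (b : E3 → ℝ) (hb : b.HasTemperateGrowth) (u : Sch) (x v : E3) :
    Sch.wt b hb u x v = b v * u x v := rfl

theorem Sch.wt_mul (b : E3 → ℝ) (hb : b.HasTemperateGrowth) (u w : Sch) :
    Sch.mul (Sch.wt b hb u) w = Sch.wt b hb (Sch.mul u w) := by
  ext x v; simp [mul_assoc]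

theorem Sch.mul_wt (b : E3 → ℝ) (hb : b.HasTemperateGrowth) (u w : Sch) :
    Sch.mul u (Sch.wt b hb w) = Sch.wt b hb (Sch.mul u w) := by
  ext x v; simp [mul_left_comm]

theorem Sch.dir_wt (z : E3 × E3) (b b' : E3 → ℝ) (hb : b.HasTemperateGrowth)
    (hb' : b'.HasTemperateGrowth) (h : ∀ v, fderiv ℝ b v z.2 = b' v) (u : Sch) :
    Sch.dir z (Sch.wt b hb u) = Sch.wt b hb (Sch.dir z u) + Sch.wt b' hb' u := by
  ext x v
  have : uncurry (Sch.wt b hb u).fn = (b ∘ Prod.snd) * uncurry u.fn := rfl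
  have hbd : DifferentiableAt ℝ b v := (hb.1.differentiable (by simp)).differentiableAt
  have h1 : HasFDerivAt (b ∘ Prod.snd) ((fderiv ℝ b v).comp (ContinuousLinearMap.snd ℝ E3 E3))
      (x, v) := HasFDerivAt.comp (x, v) (f := Prod.snd) hbd.hasFDerivAt hasFDerivAt_snd
  simp only [Sch.dir_app, this, Sch.add_app, Sch.wt_app]
  rw [fderiv_mul h1.differentiableAt u.differentiable.differentiableAt, h1.fderiv]
  simp [uncurry, h]
  ring

/-- The derivative `∂_{x_j}`. -/
def Sch.X (j : Fin 3) : Module.End ℝ Sch := Sch.dir (EuclideanSpace.single j 1, 0)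

/-- The derivative `∂_{v_j}`. -/
def Sch.D (j : Fin 3) : Module.End ℝ Sch := Sch.dir (0, EuclideanSpace.single j 1)

theorem pd_eq_fderiv {g : E3 → ℝ} {v : E3} (hg : DifferentiableAt ℝ g v) (j : Fin 3) :
    pd j g v = fderiv ℝ g v (EuclideanSpace.single j 1) := hg.lineDeriv_eq_fderiv

theorem Sch.hasFDerivAt_left (u : Sch) (x v : E3) : HasFDerivAt (fun y => u y v)
    ((fderiv ℝ (uncurry u.fn) (x, v)).comp (ContinuousLinearMap.inl ℝ E3 E3)) x :=
  (u.differentiable (x, v)).hasFDerivAt.comp x (f := fun y => (y, v)) (hasFDerivAt_prodMk_left x v)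

theorem Sch.hasFDerivAt_right (u : Sch) (x v : E3) : HasFDerivAt (u x)
    ((fderiv ℝ (uncurry u.fn) (x, v)).comp (ContinuousLinearMap.inr ℝ E3 E3)) v :=
  (u.differentiable (x, v)).hasFDerivAt.comp v (f := fun y => (x, y)) (hasFDerivAt_prodMk_right x v)

theorem Sch.dx_eq (j : Fin 3) (u : Sch) : dx j u = Sch.X j u := by
  funext x v
  rw [dx, pd_eq_fderiv (u.hasFDerivAt_left x v).differentiableAt, (u.hasFDerivAt_left x v).fderiv]
  rfl

theorem Sch.pd_eq (j : Fin 3) (u : Sch) (x v : E3) : pd j (u x) v = Sch.D j u x v := by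
  rw [pd_eq_fderiv (u.hasFDerivAt_right x v).differentiableAt, (u.hasFDerivAt_right x v).fderiv]
  rfl

theorem Sch.X_comm (j k : Fin 3) : Commute (Sch.X j) (Sch.X k) := Sch.dir_comm _ _
theorem Sch.X_D_comm (j k : Fin 3) : Commute (Sch.X j) (Sch.D k) := Sch.dir_comm _ _
theorem Sch.D_comm (j k : Fin 3) : Commute (Sch.D j) (Sch.D k) := Sch.dir_comm _ _

theorem Sch.X_wt_comm (j : Fin 3) (b : E3 → ℝ) (hb : b.HasTemperateGrowth) :
    Commute (Sch.X j) (Sch.wt b hb) := by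
  refine LinearMap.ext fun u => ?_
  have := Sch.dir_wt (EuclideanSpace.single j 1, 0) b (fun _ => 0) hb
    (Function.HasTemperateGrowth.const 0) (by simp) u
  change Sch.dir _ (Sch.wt b hb u) = Sch.wt b hb (Sch.dir _ u)
  rw [this]
  ext x v
  simp

/-! ### Integration in the velocity and over a cell -/

theorem Sch.integrable_v (u : Sch) (x : E3) : Integrable (u x) := by
  -- Any decay exponent above the dimension 3 makes the majorant integrable.
  obtain ⟨C, h⟩ := u.isSch.decay 4 0
  have hi : Integrable (fun v : E3 => (1 + ‖v‖) ^ (-(4 : ℝ))) :=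
    integrable_one_add_norm (by simp; norm_num)
  refine (hi.const_mul C).mono' ?_ (Filter.Eventually.of_forall fun v => ?_)
  · exact (u.isSch.smooth.continuous.comp (Continuous.prodMk_right x)).aestronglyMeasurable
  · have := h x v
    rw [norm_iteratedFDeriv_zero] at this
    rw [Real.rpow_neg (by positivity), ← div_eq_mul_inv, le_div_iff₀ (by positivity), mul_comm]
    exact_mod_cast this

theorem Sch.continuous_integral (u : Sch) : Continuous fun x => ∫ v, u x v := by
  obtain ⟨C, h⟩ := u.isSch.decay 4 0
  have hi : Integrable (fun v : E3 => (1 + ‖v‖) ^ (-(4 : ℝ))) :=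
    integrable_one_add_norm (by simp; norm_num)
  refine continuous_of_dominated (bound := fun v : E3 => C * (1 + ‖v‖) ^ (-(4 : ℝ)))
    (fun x => (u.integrable_v x).aestronglyMeasurable)
    (fun x => Filter.Eventually.of_forall fun v => ?_) (hi.const_mul C)
    (Filter.Eventually.of_forall fun v => u.isSch.smooth.continuous.comp (Continuous.prodMk_left v))
  have := h x v
  rw [norm_iteratedFDeriv_zero] at this
  rw [Real.rpow_neg (by positivity), ← div_eq_mul_inv, le_div_iff₀ (by positivity), mul_comm]
  exact_mod_cast this

theorem cell_subset (L : ℝ) : cell L ⊆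
    (EuclideanSpace.equiv (Fin 3) ℝ) ⁻¹' (Set.Icc (fun _ => 0) (fun _ => L)) := by
  intro x hx
  exact ⟨fun i => (hx i).1, fun i => (hx i).2.le⟩

theorem Sch.integrableOn (u : Sch) (L : ℝ) : IntegrableOn (fun x => ∫ v, u x v) (cell L) := by
  refine IntegrableOn.mono_set ?_ (cell_subset L)
  refine u.continuous_integral.continuousOn.integrableOn_compact ?_
  have := (EuclideanSpace.equiv (Fin 3) ℝ).toHomeomorph.isCompact_preimage
    (s := Set.Icc (fun _ => 0) (fun _ => L))
  exact this.2 isCompact_Icc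

/-- Integration in both variables over a cell. -/
def Sch.int (L : ℝ) : Sch →ₗ[ℝ] ℝ where
  toFun u := ∫ x in cell L, ∫ v, u x v
  map_add' u w := by
    rw [← integral_add (u.integrableOn L) (w.integrableOn L)]
    congr 1
    funext x
    exact integral_add (u.integrable_v x) (w.integrable_v x)
  map_smul' c u := by
    simp only [Sch.smul_app, integral_const_mul, RingHom.id_apply, smul_eq_mul]

theorem Sch.int_mono (L : ℝ) {u w : Sch} (h : ∀ x v, u x v ≤ w x v) :
    Sch.int L u ≤ Sch.int L w :=
  setIntegral_mono (u.integrableOn L) (w.integrableOn L)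
    fun x => integral_mono (u.integrable_v x) (w.integrable_v x) (h x)

theorem Sch.int_v_D (j : Fin 3) (u : Sch) (x : E3) : ∫ v, Sch.D j u x v = 0 := by
  have h := integral_bilinear_hasFDerivAt_right_eq_neg_left_of_integrable (μ := volume)
    (f := fun _ : E3 => (1 : ℝ)) (f' := fun _ => 0) (g := u x)
    (g' := fun v => (fderiv ℝ (uncurry u.fn) (x, v)).comp (ContinuousLinearMap.inr ℝ E3 E3))
    (v := EuclideanSpace.single j 1) (B := ContinuousLinearMap.mul ℝ ℝ)
    (by simp) (by simpa using! (Sch.integrable_v (Sch.D j u)) x) (by simpa using u.integrable_v x)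
    (fun v _ => hasFDerivAt_const _ _) (fun v _ => u.hasFDerivAt_right x v)
  simpa using! h

theorem Sch.int_D (L : ℝ) (j : Fin 3) (u : Sch) : Sch.int L (Sch.D j u) = 0 := by
  change ∫ x in cell L, ∫ v, Sch.D j u x v = 0
  simp [Sch.int_v_D]

/-! ### Leibniz formulas in a noncommutative algebra -/

section Ring
variable {R : Type*} [Ring R] [Algebra ℝ R]

/-- `W q` stands for multiplication by a q-th derivative. Passing one `H` either leaves `W q` alone
or raises its index, so Pascal's rule governs the induction, which must keep `q` free. -/
theorem pow_mul_leibniz {H : R} {W : ℕ → R} {s : ℝ}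
    (h : ∀ q, H * W q = W q * H + s • W (q + 1)) (m q : ℕ) :
    H ^ m * W q = ∑ l ∈ Finset.range (m + 1),
      ((m.choose l : ℝ) * s ^ l) • (W (q + l) * H ^ (m - l)) := by
  suffices hs : ∀ q, H ^ m * W q = ∑ ij ∈ Finset.HasAntidiagonal.antidiagonal m,
      m.choose ij.1 • (s ^ ij.1 • (W (q + ij.1) * H ^ ij.2)) by
    rw [hs, Finset.Nat.sum_antidiagonal_eq_sum_range_succ_mk]
    refine Finset.sum_congr rfl fun l _ => ?_
    rw [mul_smul, Nat.cast_smul_eq_nsmul]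
  induction m with
  | zero => intro q; simp
  | succ m ih =>
    intro q
    rw [Finset.sum_antidiagonal_choose_succ_nsmul (fun i j => s ^ i • (W (q + i) * H ^ j)),
      pow_succ, mul_assoc, h, mul_add, ← mul_assoc, ih, mul_smul_comm, ih, Finset.sum_mul,
      Finset.smul_sum]
    congr 1
    · refine Finset.sum_congr rfl fun ij _ => ?_
      rw [smul_mul_assoc, smul_mul_assoc, mul_assoc, ← pow_succ]
    · refine Finset.sum_congr rfl fun ij hij => ?_
      rw [Nat.choose_symm_of_eq_add (Finset.HasAntidiagonal.mem_antidiagonal.1 hij).symm, smul_comm s, smul_smul s,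
        ← pow_succ', add_right_comm, add_assoc]

/-- A scalar commutator stops the Leibniz expansion after one step. For `n = 0` the truncated
exponent is harmless, its coefficient being zero. -/
theorem pow_mul_of_commutator_smul_one {H A : R} {s : ℝ} (h : H * A = A * H + s • 1) (n : ℕ) :
    H ^ n * A = A * H ^ n + ((n : ℝ) * s) • H ^ (n - 1) := by
  induction n with
  | zero => simp
  | succ n ih =>
    rw [pow_succ, mul_assoc, h, mul_add, ← mul_assoc, ih, add_mul, mul_assoc, smul_mul_assoc,
      mul_smul_comm, mul_one, add_assoc]
    congr 1
    rcases n with _ | n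
    · simp
    · rw [Nat.add_sub_cancel, Nat.add_sub_cancel, ← pow_succ, ← add_smul]
      congr 1
      push_cast
      ring

end Ring

/-! ### Creation and annihilation operators, the fields H, and their commutators -/

theorem hasTemperateGrowth_coord (j : Fin 3) :
    Function.HasTemperateGrowth (fun v : E3 => v j / 2) := by
  have h := ContinuousLinearMap.hasTemperateGrowth
    ((1 / 2 : ℝ) • (EuclideanSpace.proj j : E3 →L[ℝ] ℝ))
  refine (congrArg _ ?_).mp h
  funext v
  simp
  ring

namespace Sch

/-- Multiplication by `v_j / 2`. -/
def V (j : Fin 3) : Module.End ℝ Sch := wt _ (hasTemperateGrowth_coord j)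

/-- The creation operator `v_j / 2 - ∂_{v_j}`. -/
def Ap (j : Fin 3) : Module.End ℝ Sch := V j - D j

/-- The annihilation operator `v_j / 2 + ∂_{v_j}`. -/
def Am (j : Fin 3) : Module.End ℝ Sch := V j + D j

/-- The field `c ∂_{x_1} - s A_{+,1}`. -/
def Hf (c s : ℝ) : Module.End ℝ Sch := c • X 0 - s • Ap 0

theorem fderiv_coord (j k : Fin 3) (v : E3) :
    fderiv ℝ (fun v : E3 => v j / 2) v (EuclideanSpace.single k 1) = if j = k then 1 / 2 else 0 := by
  have h : HasFDerivAt (fun v : E3 => v j / 2)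
      ((1 / 2 : ℝ) • (EuclideanSpace.proj j : E3 →L[ℝ] ℝ)) v := by
    have := ((1 / 2 : ℝ) • (EuclideanSpace.proj j : E3 →L[ℝ] ℝ)).hasFDerivAt (x := v)
    refine this.congr_of_eventuallyEq (Filter.Eventually.of_forall fun w => ?_)
    simp
    ring
  rw [h.fderiv]
  by_cases hjk : j = k <;> simp [hjk]

theorem D_wt (j : Fin 3) {b b' : E3 → ℝ} (hb : b.HasTemperateGrowth)
    (hb' : b'.HasTemperateGrowth) (h : ∀ v, fderiv ℝ b v (EuclideanSpace.single j 1) = b' v) :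
    D j * wt b hb = wt b hb * D j + wt b' hb' :=
  LinearMap.ext fun u => dir_wt (0, EuclideanSpace.single j 1) b b' hb hb' h u

theorem D_V (j k : Fin 3) : D j * V k = V k * D j + if k = j then (1 / 2 : ℝ) • 1 else 0 := by
  rw [V, D_wt j _ (Function.HasTemperateGrowth.const (if k = j then 1 / 2 else 0))
    (fun v => fderiv_coord k j v)]
  congr 1
  refine LinearMap.ext fun u => ?_
  ext x v
  by_cases h : k = j <;> simp [h]

theorem wt_comm (b b' : E3 → ℝ) (hb : b.HasTemperateGrowth) (hb' : b'.HasTemperateGrowth) :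
    Commute (wt b hb : Module.End ℝ Sch) (wt b' hb') := by
  refine LinearMap.ext fun u => ?_
  ext x v
  simp [mul_left_comm]

theorem Ap_comm (j k : Fin 3) : Ap j * Ap k = Ap k * Ap j := by
  have h1 := D_V j k
  have h2 := D_V k j
  have h3 : V j * V k = V k * V j := wt_comm _ _ _ _
  have h4 : D j * D k = D k * D j := D_comm j k
  have h5 : (if k = j then (1 / 2 : ℝ) • (1 : Module.End ℝ Sch) else 0) =
    if j = k then (1 / 2 : ℝ) • 1 else 0 := by simp [eq_comm]
  rw [h5] at h1
  simp only [Ap, mul_sub, sub_mul, h1, h2, h3, h4]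
  abel

/-- The canonical commutation relation: `D j * V k` and `V j * D k` each contribute one half of the
identity when `j = k`. -/
theorem Am_Ap (j k : Fin 3) : Am j * Ap k = Ap k * Am j + if j = k then 1 else 0 := by
  have h1 := D_V j k
  have h2 := D_V k j
  have h3 : V j * V k = V k * V j := wt_comm _ _ _ _
  have h4 : D j * D k = D k * D j := D_comm j k
  simp only [Ap, Am, mul_sub, sub_mul, mul_add, add_mul, h1, h2, h3, h4]
  by_cases h : j = k
  · subst h
    have : (1 : Module.End ℝ Sch) = (1 / 2 : ℝ) • 1 + (1 / 2 : ℝ) • 1 := by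
      rw [← add_smul]; norm_num
    simp only [if_true]
    generalize (1 / 2 : ℝ) • (1 : Module.End ℝ Sch) = y at this ⊢
    rw [this]
    abel
  · simp only [h, Ne.symm h, if_false]
    abel

theorem X_Ap_comm (j k : Fin 3) : Commute (X j) (Ap k) :=
  (X_wt_comm j _ _).sub_right (X_D_comm j k)

theorem X_Am_comm (j k : Fin 3) : Commute (X j) (Am k) :=
  (X_wt_comm j _ _).add_right (X_D_comm j k)

theorem X_Hf_comm (j : Fin 3) (c s : ℝ) : Commute (X j) (Hf c s) :=
  ((X_comm j 0).smul_right c).sub_right ((X_Ap_comm j 0).smul_right s)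

theorem Hf_Ap_comm (c s : ℝ) (k : Fin 3) : Commute (Hf c s) (Ap k) :=
  ((X_Ap_comm 0 k).smul_left c).sub_left ((show Commute (Ap 0) (Ap k) from Ap_comm 0 k).smul_left s)

/-- Only the part `+ s ∂_{v_1}` of the field fails to commute with a multiplier in `v`. -/
theorem Hf_wt (c s : ℝ) {b b' : E3 → ℝ} (hb : b.HasTemperateGrowth) (hb' : b'.HasTemperateGrowth)
    (h : ∀ v, fderiv ℝ b v (EuclideanSpace.single 0 1) = b' v) :
    Hf c s * wt b hb = wt b hb * Hf c s + s • (wt b' hb' : Module.End ℝ Sch) := by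
  have h1 : X 0 * wt b hb = wt b hb * X 0 := X_wt_comm 0 b hb
  have h2 := D_wt 0 hb hb' h
  have h3 : V 0 * wt b hb = wt b hb * V 0 := wt_comm _ _ _ _
  simp only [Hf, Ap, sub_mul, mul_sub, smul_mul_assoc, mul_smul_comm, h1, h2, h3, smul_add,
    smul_sub]
  abel

theorem Hf_Am (c s : ℝ) (k : Fin 3) :
    Hf c s * Am k = Am k * Hf c s + if k = 0 then s • 1 else 0 := by
  have h1 : X 0 * Am k = Am k * X 0 := X_Am_comm 0 k
  have h2 := Am_Ap k 0
  simp only [Hf, sub_mul, mul_sub, smul_mul_assoc, mul_smul_comm, h1, h2, smul_add]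
  by_cases h : k = 0
  · simp [h]
    abel
  · simp [h]

theorem Ap_app (k : Fin 3) (u : Sch) (x : E3) : Ap k u x = Aplus k (u x) := by
  funext v
  simp only [Ap, Aplus, pd_eq, LinearMap.sub_apply, sub_app, V, wt_app]

theorem H_eq (t δ : ℝ) (u : Sch) :
    H t δ u = Hf (1 / (δ + 1) * t ^ (δ + 1)) (t ^ δ) u := by
  funext x v
  simp only [H, Hf, LinearMap.sub_apply, LinearMap.smul_apply, sub_app, smul_app, Ap_app, dx_eq]

theorem iterate_eq {T : (E3 → E3 → ℝ) → E3 → E3 → ℝ} {S : Module.End ℝ Sch}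
    (h : ∀ u : Sch, T u = S u) (n : ℕ) (u : Sch) : T^[n] u = (S ^ n) u := by
  induction n generalizing u with
  | zero => rfl
  | succ n ih => rw [Function.iterate_succ_apply, h, ih, pow_succ]; rfl

/-- The operator `H_{δ₁}^m H_{δ₂}^n`. -/
def HP (c₁ s₁ c₂ s₂ : ℝ) (m n : ℕ) : Module.End ℝ Sch := Hf c₁ s₁ ^ m * Hf c₂ s₂ ^ n

theorem HH_eq (t δ₁ δ₂ : ℝ) (m n : ℕ) (u : Sch) : HH t δ₁ δ₂ m n u =
    HP (1 / (δ₁ + 1) * t ^ (δ₁ + 1)) (t ^ δ₁) (1 / (δ₂ + 1) * t ^ (δ₂ + 1)) (t ^ δ₂) m n u := by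
  rw [HH, iterate_eq (H_eq t δ₂), iterate_eq (H_eq t δ₁)]
  rfl

/-- The operator `∂_x^α`. -/
def Xα (α : Fin 3 → ℕ) : Module.End ℝ Sch := X 0 ^ α 0 * X 1 ^ α 1 * X 2 ^ α 2

theorem dxα_eq (α : Fin 3 → ℕ) (u : Sch) : dxα α u = Xα α u := by
  rw [dxα, iterate_eq (dx_eq 2), iterate_eq (dx_eq 1), iterate_eq (dx_eq 0)]
  rfl

theorem Xα_comm {S : Module.End ℝ Sch} (h : ∀ j, Commute (X j) S) (α : Fin 3 → ℕ) :
    Commute (Xα α) S :=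
  (((h 0).pow_left _).mul_left ((h 1).pow_left _)).mul_left ((h 2).pow_left _)

theorem Xα_comm_app {S : Module.End ℝ Sch} (h : ∀ j, Commute (X j) S) (α : Fin 3 → ℕ) (u : Sch) :
    Xα α (S u) = S (Xα α u) :=
  LinearMap.congr_fun (Xα_comm h α).eq u

variable (c₁ s₁ c₂ s₂ : ℝ)

theorem X_HP_comm (j : Fin 3) (m n : ℕ) : Commute (X j) (HP c₁ s₁ c₂ s₂ m n) :=
  ((X_Hf_comm j c₁ s₁).pow_right m).mul_right ((X_Hf_comm j c₂ s₂).pow_right n)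

theorem HP_Ap (m n : ℕ) (k : Fin 3) : HP c₁ s₁ c₂ s₂ m n * Ap k = Ap k * HP c₁ s₁ c₂ s₂ m n :=
  ((Hf_Ap_comm c₁ s₁ k).pow_left m).mul_left ((Hf_Ap_comm c₂ s₂ k).pow_left n)

/-- The commutator with each field is a scalar, so the annihilation operator costs at most one copy
of one field, and only in direction 1. -/
theorem HP_Am (m n : ℕ) (k : Fin 3) : HP c₁ s₁ c₂ s₂ m n * Am k =
    Am k * HP c₁ s₁ c₂ s₂ m n + if k = 0 then ((n : ℝ) * s₂) • HP c₁ s₁ c₂ s₂ m (n - 1) +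
      ((m : ℝ) * s₁) • HP c₁ s₁ c₂ s₂ (m - 1) n else 0 := by
  have h1 := Hf_Am c₁ s₁ k
  have h2 := Hf_Am c₂ s₂ k
  by_cases h : k = 0
  · simp only [h, if_true] at h1 h2 ⊢
    rw [HP, mul_assoc, pow_mul_of_commutator_smul_one h2, mul_add, ← mul_assoc,
      pow_mul_of_commutator_smul_one h1, add_mul, smul_mul_assoc, mul_smul_comm, mul_assoc]
    simp only [HP]
    abel
  · simp only [h, if_false, add_zero] at h1 h2 ⊢
    have c1 : Commute (Hf c₁ s₁) (Am k) := h1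
    have c2 : Commute (Hf c₂ s₂) (Am k) := h2
    exact (c1.pow_left m).mul_left (c2.pow_left n)

/-- Both fields differentiate the multiplier in the same direction `v_1`, so its order of
differentiation depends on `l + p` alone. -/
theorem HP_wt {b : ℕ → E3 → ℝ} (hb : ∀ q, (b q).HasTemperateGrowth)
    (h : ∀ q v, fderiv ℝ (b q) v (EuclideanSpace.single 0 1) = b (q + 1) v) (m n : ℕ) :
    HP c₁ s₁ c₂ s₂ m n * wt (b 0) (hb 0) =
      ∑ l ∈ Finset.range (m + 1), ∑ p ∈ Finset.range (n + 1),
        ((m.choose l : ℝ) * s₁ ^ l * ((n.choose p : ℝ) * s₂ ^ p)) •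
          (wt (b (l + p)) (hb (l + p)) * HP c₁ s₁ c₂ s₂ (m - l) (n - p)) := by
  set W : ℕ → Module.End ℝ Sch := fun q => wt (b q) (hb q) with hW
  have h1 : ∀ q, Hf c₁ s₁ * W q = W q * Hf c₁ s₁ + s₁ • W (q + 1) :=
    fun q => Hf_wt c₁ s₁ (hb q) (hb (q + 1)) (h q)
  have h2 : ∀ q, Hf c₂ s₂ * W q = W q * Hf c₂ s₂ + s₂ • W (q + 1) :=
    fun q => Hf_wt c₂ s₂ (hb q) (hb (q + 1)) (h q)
  change HP c₁ s₁ c₂ s₂ m n * W 0 = _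
  rw [HP, mul_assoc, pow_mul_leibniz h2, Finset.mul_sum, Finset.sum_comm]
  refine Finset.sum_congr rfl fun p _ => ?_
  rw [mul_smul_comm, ← mul_assoc, pow_mul_leibniz h1, Finset.sum_mul, Finset.smul_sum]
  refine Finset.sum_congr rfl fun l _ => ?_
  rw [smul_mul_assoc, smul_smul, mul_comm, zero_add, add_comm p l, HP, mul_assoc (W _)]

end Sch

/-! ### Convolution of a growing kernel with a rapidly decaying function -/

/-- Continuous functions of at most polynomial growth. -/
structure PolyGrowth (K : E3 → ℝ) : Prop where
  continuous : Continuous K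
  bound : ∃ (C : ℝ) (N : ℕ), ∀ z, |K z| ≤ C * (1 + ‖z‖) ^ N

/-- Smooth functions on `ℝ³` whose derivatives decay rapidly. -/
structure IsRapid {F : Type} [NormedAddCommGroup F] [NormedSpace ℝ F] (φ : E3 → F) : Prop where
  smooth : ContDiff ℝ ∞ φ
  decay : ∀ k d : ℕ, ∃ C : ℝ, ∀ v, (1 + ‖v‖) ^ k * ‖iteratedFDeriv ℝ d φ v‖ ≤ C

section

variable {F : Type} [NormedAddCommGroup F] [NormedSpace ℝ F]

theorem IsRapid.fderiv {φ : E3 → F} (h : IsRapid φ) : IsRapid (fderiv ℝ φ) := by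
  refine ⟨h.smooth.fderiv_right (by norm_cast), fun k d => ?_⟩
  obtain ⟨C, hC⟩ := h.decay k (d + 1)
  exact ⟨C, fun v => by rw [norm_iteratedFDeriv_fderiv]; exact hC v⟩

theorem integrable_inv_one_add_norm_pow :
    Integrable (fun v : E3 => ((1 + ‖v‖) ^ 4)⁻¹) := by
  have hi : Integrable (fun v : E3 => (1 + ‖v‖) ^ (-(4 : ℝ))) :=
    integrable_one_add_norm (by simp; norm_num)
  refine hi.congr (Filter.Eventually.of_forall fun v => ?_)
  have : (0 : ℝ) ≤ 1 + ‖v‖ := by positivity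
  simp only
  rw [Real.rpow_neg this]
  norm_cast

theorem one_add_norm_le_mul (v w : E3) : 1 + ‖w‖ ≤ (1 + ‖v‖) * (1 + ‖v - w‖) := by
  have h := norm_sub_le v (v - w)
  rw [sub_sub_cancel] at h
  nlinarith [norm_nonneg v, norm_nonneg (v - w)]

/-- By 1 + |w| ≤ (1 + |v|)(1 + |v - w|), decay of φ in v - w is exchanged for decay in w at the
price of growth in v; four spare powers give integrability in dimension 3. -/
theorem conv_bound {K : E3 → ℝ} (hK : PolyGrowth K) {φ : E3 → F} (h : IsRapid φ) :
    ∃ (C : ℝ) (N : ℕ), 0 ≤ C ∧ ∀ v w, ‖K w • φ (v - w)‖ ≤ C * (1 + ‖v‖) ^ N * ((1 + ‖w‖) ^ 4)⁻¹ := by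
  obtain ⟨A, N, hA⟩ := hK.bound
  obtain ⟨B, hB⟩ := h.decay (N + 4) 0
  have hA0 : 0 ≤ A := by
    have := (abs_nonneg _).trans (hA 0)
    simpa using this
  have hB0 : 0 ≤ B := le_trans (by positivity) (hB 0)
  refine ⟨A * B, N + 4, by positivity, fun v w => ?_⟩
  have hB' := hB (v - w)
  rw [norm_iteratedFDeriv_zero] at hB'
  have hw := one_add_norm_le_mul v w
  rw [norm_smul, Real.norm_eq_abs, ← div_eq_mul_inv, le_div_iff₀ (by positivity)]
  calc |K w| * ‖φ (v - w)‖ * (1 + ‖w‖) ^ 4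
      ≤ A * (1 + ‖w‖) ^ N * ‖φ (v - w)‖ * (1 + ‖w‖) ^ 4 := by gcongr; exact hA w
    _ = A * (1 + ‖w‖) ^ (N + 4) * ‖φ (v - w)‖ := by ring
    _ ≤ A * ((1 + ‖v‖) * (1 + ‖v - w‖)) ^ (N + 4) * ‖φ (v - w)‖ := by gcongr
    _ = A * (1 + ‖v‖) ^ (N + 4) * ((1 + ‖v - w‖) ^ (N + 4) * ‖φ (v - w)‖) := by
      rw [mul_pow]; ring
    _ ≤ A * (1 + ‖v‖) ^ (N + 4) * B := by gcongr
    _ = _ := by ring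

theorem conv_aestronglyMeasurable {K : E3 → ℝ} (hK : PolyGrowth K) {φ : E3 → F} (h : IsRapid φ)
    (v : E3) : AEStronglyMeasurable (fun w => K w • φ (v - w)) :=
  (hK.continuous.smul (h.smooth.continuous.comp
    (continuous_const.sub continuous_id))).aestronglyMeasurable

theorem conv_integrable {K : E3 → ℝ} (hK : PolyGrowth K) {φ : E3 → F} (h : IsRapid φ) (v : E3) :
    Integrable (fun w => K w • φ (v - w)) := by
  obtain ⟨C, N, _, hC⟩ := conv_bound hK h
  exact (integrable_inv_one_add_norm_pow.const_mul _).mono' (conv_aestronglyMeasurable hK h v)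
    (Filter.Eventually.of_forall fun w => hC v w)

theorem conv_growth {K : E3 → ℝ} (hK : PolyGrowth K) {φ : E3 → F} (h : IsRapid φ) :
    ∃ (k : ℕ) (C : ℝ), ∀ v, ‖∫ w, K w • φ (v - w)‖ ≤ C * (1 + ‖v‖) ^ k := by
  obtain ⟨C, N, _, hC⟩ := conv_bound hK h
  refine ⟨N, C * ∫ w : E3, ((1 + ‖w‖) ^ 4)⁻¹, fun v => ?_⟩
  have := norm_integral_le_of_norm_le (integrable_inv_one_add_norm_pow.const_mul _)
    (Filter.Eventually.of_forall fun w => hC v w)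
  rw [integral_const_mul] at this
  exact this.trans (le_of_eq (by ring))

/-- The derivative falls on φ only: the kernel |z|^γ need not be smooth at the origin. -/
theorem conv_hasFDerivAt {K : E3 → ℝ} (hK : PolyGrowth K) {φ : E3 → F} (h : IsRapid φ) (v : E3) :
    HasFDerivAt (fun v => ∫ w, K w • φ (v - w)) (∫ w, K w • fderiv ℝ φ (v - w)) v := by
  obtain ⟨C, N, hC0, hC⟩ := conv_bound hK h.fderiv
  refine hasFDerivAt_integral_of_dominated_of_fderiv_le (μ := volume)
    (bound := fun w => C * (1 + (‖v‖ + 1)) ^ N * ((1 + ‖w‖) ^ 4)⁻¹)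
    (F := fun v w => K w • φ (v - w)) (F' := fun v w => K w • fderiv ℝ φ (v - w))
    (Metric.ball_mem_nhds v one_pos)
    (Filter.Eventually.of_forall fun v => conv_aestronglyMeasurable hK h v)
    (conv_integrable hK h v) (conv_aestronglyMeasurable hK h.fderiv v)
    (Filter.Eventually.of_forall fun w u hu => (hC u w).trans ?_)
    (integrable_inv_one_add_norm_pow.const_mul _)
    (Filter.Eventually.of_forall fun w u _ => ?_)
  · have hu' : ‖u‖ ≤ ‖v‖ + 1 := by
      have h1 : ‖u - v‖ < 1 := by rwa [← dist_eq_norm]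
      have h2 := norm_add_le v (u - v)
      rw [add_sub_cancel] at h2
      linarith
    gcongr
  · have hd := (h.smooth.differentiable (by simp) (u - w)).hasFDerivAt
    exact (hd.comp u ((hasFDerivAt_id u).sub_const w)).const_smul (K w)

end

/-- The target space varies in the induction because φ is replaced by its derivative, which takes
values in linear maps. -/
theorem conv_contDiff {K : E3 → ℝ} (hK : PolyGrowth K) (n : ℕ) :
    ∀ {F : Type} [NormedAddCommGroup F] [NormedSpace ℝ F] {φ : E3 → F}, IsRapid φ →
      ContDiff ℝ n (fun v => ∫ w, K w • φ (v - w)) ∧ ∃ (k : ℕ) (C : ℝ), ∀ v,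
        ‖iteratedFDeriv ℝ n (fun v => ∫ w, K w • φ (v - w)) v‖ ≤ C * (1 + ‖v‖) ^ k := by
  induction n with
  | zero =>
    intro F _ _ φ h
    refine ⟨contDiff_zero.2 (continuous_iff_continuousAt.2 fun v =>
      (conv_hasFDerivAt hK h v).continuousAt), ?_⟩
    simpa using conv_growth hK h
  | succ n ih =>
    intro F _ _ φ h
    have hd : fderiv ℝ (fun v => ∫ w, K w • φ (v - w)) = fun v => ∫ w, K w • fderiv ℝ φ (v - w) :=
      funext fun v => (conv_hasFDerivAt hK h v).fderiv
    obtain ⟨h1, k, C, h2⟩ := ih h.fderiv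
    refine ⟨?_, k, C, fun v => ?_⟩
    · push_cast
      rw [contDiff_succ_iff_fderiv, hd]
      exact ⟨fun v => (conv_hasFDerivAt hK h v).differentiableAt, by simp, h1⟩
    · rw [← norm_iteratedFDeriv_fderiv, hd]
      exact h2 v

theorem conv_hasTemperateGrowth {K : E3 → ℝ} (hK : PolyGrowth K)
    {F : Type} [NormedAddCommGroup F] [NormedSpace ℝ F] {φ : E3 → F} (h : IsRapid φ) :
    Function.HasTemperateGrowth (fun v => ∫ w, K w • φ (v - w)) :=
  ⟨contDiff_infty.2 fun n => (conv_contDiff hK n h).1, fun n => (conv_contDiff hK n h).2⟩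

theorem isSch_of_isRapid {φ : E3 → ℝ} (h : IsRapid φ) : IsSch (fun _ v => φ v) := by
  refine ⟨h.smooth.comp contDiff_snd, fun k d => ?_⟩
  obtain ⟨C, hC⟩ := h.decay k d
  refine ⟨C, fun x v => (le_trans ?_ (hC v))⟩
  have : uncurry (fun (_ : E3) v => φ v) = φ ∘ (ContinuousLinearMap.snd ℝ E3 E3) := rfl
  rw [this, ContinuousLinearMap.iteratedFDeriv_comp_right _ h.smooth _ (by exact_mod_cast le_top)]
  gcongr
  refine (ContinuousMultilinearMap.norm_compContinuousLinearMap_le _ _).trans ?_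
  refine mul_le_of_le_one_right (norm_nonneg _) (Finset.prod_le_one (fun _ _ => norm_nonneg _)
    fun _ _ => ContinuousLinearMap.norm_snd_le _ _ _)

theorem IsSch.isRapid {f : E3 → E3 → ℝ} (hf : IsSch f) (x : E3) : IsRapid (f x) := by
  have he : f x = (fun z => uncurry f ((x, 0) + z)) ∘ (ContinuousLinearMap.inr ℝ E3 E3) := by
    funext v
    simp [uncurry]
  have hs : ContDiff ℝ ∞ (fun z => uncurry f ((x, 0) + z)) :=
    hf.smooth.comp (contDiff_const.add contDiff_id)
  refine ⟨he ▸ hs.comp (ContinuousLinearMap.contDiff _), fun k d => ?_⟩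
  obtain ⟨C, hC⟩ := hf.decay k d
  refine ⟨C, fun v => (le_trans ?_ (hC x v))⟩
  rw [he, ContinuousLinearMap.iteratedFDeriv_comp_right _ hs _ (by exact_mod_cast le_top),
    iteratedFDeriv_comp_add_left]
  gcongr
  refine (ContinuousMultilinearMap.norm_compContinuousLinearMap_le _ _).trans ?_
  simp only [ContinuousLinearMap.inr_apply, Prod.mk_add_mk, add_zero, zero_add]
  exact mul_le_of_le_one_right (norm_nonneg _) (Finset.prod_le_one (fun _ _ => norm_nonneg _)
    fun _ _ => ContinuousLinearMap.norm_inr_le_one _ _ _)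

theorem hasTemperateGrowth_fderiv {F : Type} [NormedAddCommGroup F] [NormedSpace ℝ F] {p : E3 → F}
    (h : p.HasTemperateGrowth) : (fderiv ℝ p).HasTemperateGrowth := by
  refine ⟨h.1.fderiv_right (by norm_cast), fun n => ?_⟩
  obtain ⟨k, C, hC⟩ := h.2 (n + 1)
  exact ⟨k, C, fun v => by rw [norm_iteratedFDeriv_fderiv]; exact hC v⟩

/-! ### The Gaussian and its derivatives -/

theorem pow_mul_exp_le (M : ℕ) {r : ℝ} (hr : 0 ≤ r) :
    (1 + r) ^ M * Real.exp (-(r ^ 2 / 4)) ≤ M.factorial * Real.exp 2 := by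
  have h := Real.pow_div_factorial_le_exp (1 + r) (by linarith) M
  rw [div_le_iff₀ (by positivity)] at h
  calc (1 + r) ^ M * Real.exp (-(r ^ 2 / 4))
      ≤ Real.exp (1 + r) * M.factorial * Real.exp (-(r ^ 2 / 4)) := by gcongr
    _ = M.factorial * Real.exp (1 + r + -(r ^ 2 / 4)) := by
      rw [Real.exp_add (1 + r)]; ring
    _ ≤ _ := by
      gcongr
      nlinarith [sq_nonneg (r - 2)]

theorem gauss_hasFDerivAt (v : E3) : HasFDerivAt (fun v : E3 => Real.exp (-(‖v‖ ^ 2 / 4)))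
    (-(Real.exp (-(‖v‖ ^ 2 / 4)) / 2) • innerSL ℝ v) v := by
  have h1 := ((hasStrictFDerivAt_norm_sq v).hasFDerivAt.const_mul (-(1 / 4 : ℝ))).exp
  have he : (fun v : E3 => Real.exp (-(‖v‖ ^ 2 / 4))) =
      fun v : E3 => Real.exp (-(1 / 4 : ℝ) * ‖v‖ ^ 2) := by
    funext u; congr 1; ring
  rw [he]
  refine h1.congr_fderiv ?_
  rw [show -(‖v‖ ^ 2 / 4) = -(1 / 4 : ℝ) * ‖v‖ ^ 2 by ring]
  ext u
  simp
  ring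

/-- Gaussian times temperate function is a class stable under differentiation, so only the
undifferentiated case needs an estimate. -/
theorem gauss_decay (d : ℕ) : ∀ {F : Type} [NormedAddCommGroup F] [NormedSpace ℝ F] {p : E3 → F},
    p.HasTemperateGrowth → ∀ k : ℕ, ∃ C : ℝ, ∀ v, (1 + ‖v‖) ^ k *
      ‖iteratedFDeriv ℝ d (fun v => Real.exp (-(‖v‖ ^ 2 / 4)) • p v) v‖ ≤ C := by
  induction d with
  | zero =>
    intro F _ _ p hp k
    obtain ⟨N, C, hC⟩ := hp.2 0
    have hC0 : 0 ≤ C := by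
      have := (norm_nonneg _).trans (hC 0)
      simpa using this
    refine ⟨C * ((k + N).factorial * Real.exp 2), fun v => ?_⟩
    have h1 := hC v
    rw [norm_iteratedFDeriv_zero] at h1 ⊢
    rw [norm_smul, Real.norm_eq_abs, abs_of_pos (Real.exp_pos _)]
    calc _ ≤ (1 + ‖v‖) ^ k * (Real.exp (-(‖v‖ ^ 2 / 4)) * (C * (1 + ‖v‖) ^ N)) := by gcongr
      _ = C * ((1 + ‖v‖) ^ (k + N) * Real.exp (-(‖v‖ ^ 2 / 4))) := by ring
      _ ≤ _ := mul_le_mul_of_nonneg_left (pow_mul_exp_le _ (norm_nonneg v)) hC0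
  | succ d ih =>
    intro F _ _ p hp k
    -- The temperate factor left after differentiating and factoring out the Gaussian: p' - ⟨v, ·⟩ p
    -- / 2.
    have hq : Function.HasTemperateGrowth (fun v : E3 => fderiv ℝ p v -
        (1 / 2 : ℝ) • ((innerSL ℝ : E3 →L[ℝ] E3 →L[ℝ] ℝ) v).smulRight (p v)) := by
      have h1 := (ContinuousLinearMap.smulRightL ℝ E3 F).bilinear_hasTemperateGrowth
        ((innerSL ℝ : E3 →L[ℝ] E3 →L[ℝ] ℝ).hasTemperateGrowth) hp
      exact (hasTemperateGrowth_fderiv hp).sub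
        ((Function.HasTemperateGrowth.const (1 / 2 : ℝ)).smul h1)
    obtain ⟨C, hC⟩ := ih hq k
    refine ⟨C, fun v => ?_⟩
    rw [← norm_iteratedFDeriv_fderiv]
    refine le_trans (le_of_eq ?_) (hC v)
    congr 3
    funext v
    rw [((gauss_hasFDerivAt v).fun_smul (hp.1.differentiable (by simp) v).hasFDerivAt).fderiv]
    ext u
    simp [smul_smul, sub_eq_add_neg]
    congr 2

theorem sqrtMu_eq (v : E3) : sqrtMu v =
    Real.sqrt ((2 * Real.pi) ^ (-(3 / 2) : ℝ)) * Real.exp (-(‖v‖ ^ 2 / 4)) := by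
  rw [sqrtMu, mu, Real.sqrt_mul (by positivity)]
  congr 1
  rw [← Real.exp_half]
  congr 1
  ring

theorem sqrtMu_pos (v : E3) : 0 < sqrtMu v := by
  rw [sqrtMu_eq]
  positivity

theorem sqrtMu_mul_self (v : E3) : sqrtMu v * sqrtMu v = mu v := by
  rw [sqrtMu, Real.mul_self_sqrt]
  rw [mu]
  positivity

theorem isRapid_sqrtMu : IsRapid sqrtMu := by
  have hp : Function.HasTemperateGrowth
      (fun _ : E3 => Real.sqrt ((2 * Real.pi) ^ (-(3 / 2) : ℝ))) :=
    Function.HasTemperateGrowth.const _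
  have he : sqrtMu = fun v : E3 =>
      Real.exp (-(‖v‖ ^ 2 / 4)) • Real.sqrt ((2 * Real.pi) ^ (-(3 / 2) : ℝ)) := by
    funext v
    rw [sqrtMu_eq, smul_eq_mul, mul_comm]
  rw [he]
  refine ⟨?_, fun k d => gauss_decay d hp k⟩
  exact (Real.contDiff_exp.comp ((contDiff_norm_sq ℝ).div_const 4).neg).smul contDiff_const

/-! ### Coefficients as convolutions and the factored form of the linearised operator -/

namespace Sch

/-- `√μ` as a function independent of `x`. -/
def gs : Sch := Sch.of _ (isSch_of_isRapid isRapid_sqrtMu)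

@[simp] theorem gs_app (x v : E3) : gs x v = sqrtMu v := rfl

theorem Am_gs (j : Fin 3) : Am j gs = 0 := by
  ext x v
  have h := ((gauss_hasFDerivAt v).const_mul (Real.sqrt ((2 * Real.pi) ^ (-(3 / 2) : ℝ))))
  have he : gs x = fun v : E3 => Real.sqrt ((2 * Real.pi) ^ (-(3 / 2) : ℝ)) *
      Real.exp (-(‖v‖ ^ 2 / 4)) := funext fun v => sqrtMu_eq v
  simp only [Am, LinearMap.add_apply, add_app, V, wt_app, zero_app]
  rw [← pd_eq, he, pd_eq_fderiv h.differentiableAt, h.fderiv]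
  simp [EuclideanSpace.inner_single_right]
  ring

theorem D_mul (j : Fin 3) (u w : Sch) : D j (mul u w) = mul (D j u) w + mul u (D j w) :=
  dir_mul _ u w

theorem D_gs (j : Fin 3) : D j gs = -V j gs :=
  eq_neg_of_add_eq_zero_right (Am_gs j)

/-- Conjugation by √μ turns the derivative into minus the creation operator. This gives both the
factorisation of 𝓛₁ and the Hermite form of the derivatives of μ. -/
theorem D_gs_mul (j : Fin 3) (u : Sch) : D j (mul gs u) = -mul gs (Ap j u) := by
  rw [D_mul, D_gs]
  ext x v
  simp [Ap, V]
  ring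

/-- `∂_1^q μ` as a function independent of `x`. -/
def muD (q : ℕ) : Sch := (-1 : ℝ) ^ q • mul gs ((Ap 0 ^ q) gs)

theorem D_muD (q : ℕ) : D 0 (muD q) = muD (q + 1) := by
  rw [muD, map_smul, D_gs_mul, muD, pow_succ', pow_succ' (Ap 0)]
  simp

/-- The convolution of `K` with a function of the velocity. -/
def conv (K : E3 → ℝ) (u : Sch) : E3 → ℝ := fun v => ∫ w, K w * u 0 (v - w)

theorem conv_eq (K : E3 → ℝ) (u : Sch) (v : E3) : conv K u v = ∫ w, K (v - w) * u 0 w := by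
  rw [conv, ← integral_sub_left_eq_self _ _ v]
  simp

theorem conv_temp {K : E3 → ℝ} (hK : PolyGrowth K) (u : Sch) :
    (conv K u).HasTemperateGrowth := conv_hasTemperateGrowth hK (u.isSch.isRapid 0)

theorem integrable_conv {K : E3 → ℝ} (hK : PolyGrowth K) (u : Sch) (v : E3) :
    Integrable (fun w => K (v - w) * u 0 w) := by
  have := (conv_integrable hK (u.isSch.isRapid 0) v).comp_sub_left v
  simpa using this

theorem fderiv_conv {K : E3 → ℝ} (hK : PolyGrowth K) (u : Sch) (j : Fin 3) (v : E3) :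
    fderiv ℝ (conv K u) v (EuclideanSpace.single j 1) = conv K (D j u) v := by
  have h := conv_hasFDerivAt hK (u.isSch.isRapid 0) v
  change fderiv ℝ (fun v => ∫ w, K w • u 0 (v - w)) v (EuclideanSpace.single j 1) = _
  rw [h.fderiv, ContinuousLinearMap.integral_apply (conv_integrable hK (u.isSch.isRapid 0).fderiv v)]
  refine integral_congr_ae (Filter.Eventually.of_forall fun w => ?_)
  simp only [_root_.smul_apply, smul_eq_mul]
  rw [← pd_eq, pd_eq_fderiv ((u.isSch.isRapid 0).smooth.differentiable (by simp) _)]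

end Sch

theorem polyGrowth_a {γ : ℝ} (hγ : 0 ≤ γ) (j k : Fin 3) : PolyGrowth (a γ j k) := by
  have hc : ∀ i : Fin 3, Continuous fun z : E3 => z i := fun i =>
    (EuclideanSpace.proj i : E3 →L[ℝ] ℝ).continuous
  refine ⟨?_, 2, 2 + ⌈γ⌉₊, fun z => ?_⟩
  · exact ((continuous_const.mul (continuous_norm.pow 2)).sub ((hc j).mul (hc k))).mul
      (continuous_norm.rpow_const fun _ => Or.inr hγ)
  · have hj := PiLp.norm_apply_le z j
    have hk := PiLp.norm_apply_le z k
    have h1 : |(if j = k then 1 else 0) * ‖z‖ ^ 2 - z j * z k| ≤ 2 * (1 + ‖z‖) ^ 2 := by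
      have h2 : |(if j = k then 1 else 0) * ‖z‖ ^ 2| ≤ ‖z‖ ^ 2 := by
        split_ifs <;> simp
      have h3 : |z j * z k| ≤ ‖z‖ ^ 2 := by
        rw [abs_mul, sq]
        exact mul_le_mul hj hk (abs_nonneg _) (norm_nonneg _)
      have := abs_sub ((if j = k then 1 else 0) * ‖z‖ ^ 2) (z j * z k)
      nlinarith [norm_nonneg z]
    have h4 : ‖z‖ ^ γ ≤ (1 + ‖z‖) ^ ⌈γ⌉₊ := by
      calc ‖z‖ ^ γ ≤ (1 + ‖z‖) ^ γ :=
            Real.rpow_le_rpow (norm_nonneg z) (by linarith) hγ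
        _ ≤ (1 + ‖z‖) ^ (⌈γ⌉₊ : ℝ) :=
            Real.rpow_le_rpow_of_exponent_le (by linarith [norm_nonneg z]) (Nat.le_ceil γ)
        _ = _ := Real.rpow_natCast _ _
    rw [a, abs_mul, abs_of_nonneg (Real.rpow_nonneg (norm_nonneg z) γ), pow_add, ← mul_assoc]
    exact mul_le_mul h1 h4 (by positivity) (by positivity)

namespace Sch

/-- `∂_1^q ā_{jk}`. -/
def abarD (γ : ℝ) (j k : Fin 3) (q : ℕ) : E3 → ℝ := conv (a γ j k) (muD q)

theorem abarD_temp {γ : ℝ} (hγ : 0 ≤ γ) (j k : Fin 3) (q : ℕ) :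
    (abarD γ j k q).HasTemperateGrowth := conv_temp (polyGrowth_a hγ j k) _

theorem fderiv_abarD {γ : ℝ} (hγ : 0 ≤ γ) (j k : Fin 3) (q : ℕ) (v : E3) :
    fderiv ℝ (abarD γ j k q) v (EuclideanSpace.single 0 1) = abarD γ j k (q + 1) v := by
  rw [abarD, fderiv_conv (polyGrowth_a hγ j k), D_muD, abarD]

theorem muD_zero_app (x v : E3) : muD 0 x v = mu v := by
  simp [muD, sqrtMu_mul_self]

theorem abarD_zero (γ : ℝ) (j k : Fin 3) : abarD γ j k 0 = abar γ j k := by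
  funext v
  rw [abarD, conv_eq, abar]
  simp only [muD_zero_app]

/-- `v_k μ` as a function independent of `x`. -/
def vmu (k : Fin 3) : Sch := -D k (muD 0)

theorem Ap_gs_app (k : Fin 3) (x v : E3) : Ap k gs x v = v k * sqrtMu v := by
  simp only [Ap, LinearMap.sub_apply, D_gs]
  simp [V]
  ring

theorem vmu_app (k : Fin 3) (x v : E3) : vmu k x v = v k * mu v := by
  have : D k (muD 0) = -mul gs (Ap k gs) := by
    rw [← D_gs_mul]; simp [muD]
  rw [vmu, this]
  rw [neg_neg, mul_app, Ap_gs_app, gs_app, ← sqrtMu_mul_self]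
  ring

end Sch

/-- The matrix `a` is a multiple of the projection onto the plane orthogonal to `z`. -/
theorem sum_a_mul_coord (γ : ℝ) (j : Fin 3) (z : E3) : ∑ k, a γ j k z * z k = 0 := by
  simp only [a, EuclideanSpace.norm_sq_eq, Real.norm_eq_abs, sq_abs]
  fin_cases j <;> simp [Fin.sum_univ_three] <;> ring

theorem a_symm (γ : ℝ) (j k : Fin 3) (z : E3) : a γ j k z = a γ k j z := by
  simp only [a, mul_comm (z j), eq_comm (a := j)]

namespace Sch

/-- `∫ a_{jk}(v - w) w_k μ(w) dw`. -/
def bco (γ : ℝ) (j k : Fin 3) : E3 → ℝ := conv (a γ j k) (vmu k)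

theorem bco_temp {γ : ℝ} (hγ : 0 ≤ γ) (j k : Fin 3) : (bco γ j k).HasTemperateGrowth :=
  conv_temp (polyGrowth_a hγ j k) _

/-- Since a(v-w)(v-w) = 0, the factor w under the integral may be exchanged for v. -/
theorem sum_bco {γ : ℝ} (hγ : 0 ≤ γ) (j : Fin 3) (v : E3) :
    ∑ k, bco γ j k v = ∑ k, abarD γ j k 0 v * v k := by
  have h1 : ∀ k, bco γ j k v = ∫ w, a γ j k (v - w) * vmu k 0 w := fun k => conv_eq _ _ _
  have h2 : ∀ k, abarD γ j k 0 v * v k = ∫ w, a γ j k (v - w) * muD 0 0 w * v k := fun k => by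
    rw [integral_mul_const, abarD, conv_eq]
  simp only [h1, h2]
  rw [← integral_finsetSum _ fun k _ => integrable_conv (polyGrowth_a hγ j k) _ v,
    ← integral_finsetSum _ fun k _ => (integrable_conv (polyGrowth_a hγ j k) _ v).mul_const _]
  congr 1
  funext w
  have h := sum_a_mul_coord γ j (v - w)
  simp only [PiLp.sub_apply, mul_sub, Finset.sum_sub_distrib, sub_eq_zero] at h
  simp only [vmu_app, muD_zero_app]
  calc ∑ k, a γ j k (v - w) * (w k * mu w) = (∑ k, a γ j k (v - w) * w k) * mu w := by
        rw [Finset.sum_mul]; exact Finset.sum_congr rfl fun k _ => by ring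
    _ = (∑ k, a γ j k (v - w) * v k) * mu w := by rw [h]
    _ = _ := by rw [Finset.sum_mul]; exact Finset.sum_congr rfl fun k _ => by ring

/-- The linearized operator `𝓛₁ = ∑ A_{+,j} ā_{jk} A_{-,k}`. -/
def Lop (γ : ℝ) (hγ : 0 ≤ γ) : Module.End ℝ Sch :=
  ∑ j, ∑ k, Ap j * (wt (abarD γ j k 0) (abarD_temp hγ j k 0) * Am k)

theorem Lop_apply {γ : ℝ} (hγ : 0 ≤ γ) (u : Sch) : Lop γ hγ u =
    ∑ j, ∑ k, Ap j (wt (abarD γ j k 0) (abarD_temp hγ j k 0) (Am k u)) := by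
  simp [Lop]

/-- After `sum_bco` the inner bracket, summed over k, is ā applied to ∂_k(√μ u) + v_k √μ u = √μ
A_{-,k} u; the outer derivative of √μ times a function then yields A_{+,j}. -/
theorem Lop_eq_sum {γ : ℝ} (hγ : 0 ≤ γ) (u : Sch) :
    ∑ j, ∑ k, D j (wt (abarD γ j k 0) (abarD_temp hγ j k 0) (D k (mul gs u)) +
      wt (bco γ j k) (bco_temp hγ j k) (mul gs u)) = -mul gs (Lop γ hγ u) := by
  rw [Lop_apply, map_sum, ← Finset.sum_neg_distrib]
  refine Finset.sum_congr rfl fun j _ => ?_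
  have : ∑ k, (wt (abarD γ j k 0) (abarD_temp hγ j k 0) (D k (mul gs u)) +
      wt (bco γ j k) (bco_temp hγ j k) (mul gs u)) =
      ∑ k, mul gs (wt (abarD γ j k 0) (abarD_temp hγ j k 0) (Am k u)) := by
    ext x v
    have h := sum_bco hγ j v
    simp only [sum_app, add_app, wt_app, Finset.sum_add_distrib, ← Finset.sum_mul, h,
      D_gs_mul, neg_app, mul_app]
    rw [Finset.sum_mul, ← Finset.sum_add_distrib]
    refine Finset.sum_congr rfl fun k _ => ?_
    simp [Ap, Am, V]
    ring
  rw [← map_sum, this, map_sum, map_sum]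
  simp only [D_gs_mul]
  rw [Finset.sum_neg_distrib]

theorem Q_integral {γ : ℝ} (hγ : 0 ≤ γ) (j k : Fin 3) (u : Sch) (x : E3) :
    (fun y => ∫ w : E3, a γ j k (y - w) * (sqrtMu w * sqrtMu w * pd k (mul gs u x) y -
      pd k (fun w => sqrtMu w * sqrtMu w) w * mul gs u x y)) =
    (wt (abarD γ j k 0) (abarD_temp hγ j k 0) (D k (mul gs u)) +
      wt (bco γ j k) (bco_temp hγ j k) (mul gs u) : Sch) x := by
  funext y
  have hG : (fun w => sqrtMu w * sqrtMu w) = muD 0 0 := by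
    funext w; rw [muD_zero_app, sqrtMu_mul_self]
  rw [hG]
  simp only [pd_eq, add_app, wt_app, sqrtMu_mul_self]
  have h1 : ∀ w, D k (muD 0) 0 w = -vmu k 0 w := fun w => by simp [vmu]
  simp only [abarD, bco]
  rw [conv_eq, conv_eq, ← integral_mul_const, ← integral_mul_const, ← integral_add
    ((integrable_conv (polyGrowth_a hγ j k) _ y).mul_const _)
    ((integrable_conv (polyGrowth_a hγ j k) _ y).mul_const _)]
  congr 1
  funext w
  rw [h1, muD_zero_app]
  ring

theorem L1_eq {γ : ℝ} (hγ : 0 ≤ γ) (u : Sch) : L1 γ u = Lop γ hγ u := by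
  funext x v
  have h := congrArg (fun z : Sch => z x v) (Lop_eq_sum hγ u)
  simp only [neg_app, mul_app, gs_app, sum_app] at h
  have hQ : Q γ (fun w => sqrtMu w * sqrtMu w) (mul gs u x) v = -(sqrtMu v * Lop γ hγ u x v) := by
    rw [← h, Q]
    refine Finset.sum_congr rfl fun j _ => Finset.sum_congr rfl fun k _ => ?_
    rw [← pd_eq, ← Q_integral hγ]
  have hF : (fun w => sqrtMu w * u x w) = mul gs u x := rfl
  rw [L1, L1v, Gam, hF, hQ]
  have := (sqrtMu_pos v).ne'
  field_simp

end Sch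

/-! ### Upper bounds for the derivatives of ā -/

/-- `|ξ|²`. -/
def nsq (ξ : Fin 3 → ℝ) : ℝ := ξ 0 ^ 2 + ξ 1 ^ 2 + ξ 2 ^ 2

/-- `|z × ξ|²`. -/
def cr (z : E3) (ξ : Fin 3 → ℝ) : ℝ := (z 1 * ξ 2 - z 2 * ξ 1) ^ 2 + (z 2 * ξ 0 - z 0 * ξ 2) ^ 2 +
  (z 0 * ξ 1 - z 1 * ξ 0) ^ 2

/-- The bilinear form of a matrix. -/
def bil (A : Fin 3 → Fin 3 → ℝ) (ξ η : Fin 3 → ℝ) : ℝ := ∑ j, ∑ k, A j k * ξ j * η k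

/-- `1 + |v|²`. -/
def W (v : E3) : ℝ := 1 + ‖v‖ ^ 2

theorem W_pos (v : E3) : 0 < W v := by unfold W; positivity
theorem one_le_W (v : E3) : 1 ≤ W v := by unfold W; nlinarith [sq_nonneg ‖v‖]
theorem nsq_nonneg (ξ : Fin 3 → ℝ) : 0 ≤ nsq ξ := by unfold nsq; positivity
theorem cr_nonneg (z : E3) (ξ : Fin 3 → ℝ) : 0 ≤ cr z ξ := by unfold cr; positivity

theorem norm_sq_eq_coord (z : E3) : ‖z‖ ^ 2 = z 0 ^ 2 + z 1 ^ 2 + z 2 ^ 2 := by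
  rw [EuclideanSpace.norm_sq_eq, Fin.sum_univ_three]
  simp

theorem W_rpow_temp (r : ℝ) : (fun v : E3 => W v ^ r).HasTemperateGrowth :=
  Function.hasTemperateGrowth_one_add_norm_sq_rpow E3 r

/-- Lagrange's identity: |z|² ξ·η - (z·ξ)(z·η) = (z × ξ)·(z × η). -/
theorem bil_a (γ : ℝ) (z : E3) (ξ η : Fin 3 → ℝ) : bil (fun j k => a γ j k z) ξ η =
    ‖z‖ ^ γ * ((z 1 * ξ 2 - z 2 * ξ 1) * (z 1 * η 2 - z 2 * η 1) +
      (z 2 * ξ 0 - z 0 * ξ 2) * (z 2 * η 0 - z 0 * η 2) +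
      (z 0 * ξ 1 - z 1 * ξ 0) * (z 0 * η 1 - z 1 * η 0)) := by
  simp only [bil, a, norm_sq_eq_coord]
  simp [Fin.sum_univ_three]
  ring

theorem bil_a_self (γ : ℝ) (z : E3) (ξ : Fin 3 → ℝ) :
    bil (fun j k => a γ j k z) ξ ξ = ‖z‖ ^ γ * cr z ξ := by
  rw [bil_a, cr]
  ring

theorem abs_mul_le_young {l : ℝ} (hl : 0 < l) (x y : ℝ) :
    |x * y| ≤ (l * x ^ 2 + l⁻¹ * y ^ 2) / 2 := by
  have h : 0 ≤ (l * |x| - |y|) ^ 2 * l⁻¹ := by positivity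
  have h2 : (l * |x| - |y|) ^ 2 * l⁻¹ = l * x ^ 2 + l⁻¹ * y ^ 2 - 2 * (|x| * |y|) := by
    rw [← sq_abs x, ← sq_abs y]
    field_simp
    ring
  rw [abs_mul]
  linarith

theorem abs_bil_a_le (γ : ℝ) (z : E3) (ξ η : Fin 3 → ℝ) {l : ℝ} (hl : 0 < l) :
    |bil (fun j k => a γ j k z) ξ η| ≤ (l * bil (fun j k => a γ j k z) ξ ξ +
      l⁻¹ * bil (fun j k => a γ j k z) η η) / 2 := by
  rw [bil_a_self, bil_a_self, bil_a, abs_mul, abs_of_nonneg (by positivity : 0 ≤ ‖z‖ ^ γ), cr, cr]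
  have h1 := abs_mul_le_young hl (z 1 * ξ 2 - z 2 * ξ 1) (z 1 * η 2 - z 2 * η 1)
  have h2 := abs_mul_le_young hl (z 2 * ξ 0 - z 0 * ξ 2) (z 2 * η 0 - z 0 * η 2)
  have h3 := abs_mul_le_young hl (z 0 * ξ 1 - z 1 * ξ 0) (z 0 * η 1 - z 1 * η 0)
  have h4 := abs_add_three ((z 1 * ξ 2 - z 2 * ξ 1) * (z 1 * η 2 - z 2 * η 1))
    ((z 2 * ξ 0 - z 0 * ξ 2) * (z 2 * η 0 - z 0 * η 2))
    ((z 0 * ξ 1 - z 1 * ξ 0) * (z 0 * η 1 - z 1 * η 0))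
  have h5 : 0 ≤ ‖z‖ ^ γ := by positivity
  refine (mul_le_mul_of_nonneg_left (h4.trans (add_le_add (add_le_add h1 h2) h3)) h5).trans
    (le_of_eq (by ring))

theorem cr_le (w : E3) (ξ : Fin 3 → ℝ) : cr w ξ ≤ ‖w‖ ^ 2 * nsq ξ := by
  rw [norm_sq_eq_coord, cr, nsq]
  nlinarith [sq_nonneg (w 0 * ξ 0 + w 1 * ξ 1 + w 2 * ξ 2)]

theorem cr_sub_le (v w : E3) (ξ : Fin 3 → ℝ) : cr (v - w) ξ ≤ 2 * (nsq ξ + cr v ξ) * W w := by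
  have h1 : cr (v - w) ξ ≤ 2 * cr v ξ + 2 * cr w ξ := by
    simp only [cr, PiLp.sub_apply]
    nlinarith [sq_nonneg ((v 1 * ξ 2 - v 2 * ξ 1) + (w 1 * ξ 2 - w 2 * ξ 1)),
      sq_nonneg ((v 2 * ξ 0 - v 0 * ξ 2) + (w 2 * ξ 0 - w 0 * ξ 2)),
      sq_nonneg ((v 0 * ξ 1 - v 1 * ξ 0) + (w 0 * ξ 1 - w 1 * ξ 0))]
  have h2 := cr_le w ξ
  have h3 := mul_nonneg (cr_nonneg v ξ) (sq_nonneg ‖w‖)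
  unfold W
  nlinarith [nsq_nonneg ξ]

theorem norm_sub_sq_le (v w : E3) : ‖v - w‖ ^ 2 ≤ 2 * ‖v‖ ^ 2 + 2 * ‖w‖ ^ 2 := by
  have := parallelogram_law_with_norm ℝ v w
  nlinarith [mul_self_nonneg ‖v + w‖]

theorem norm_sub_sq_le_W (v w : E3) : ‖v - w‖ ^ 2 ≤ 2 * (W v * W w) := by
  have h := norm_sub_sq_le v w
  unfold W
  nlinarith [mul_nonneg (sq_nonneg ‖v‖) (sq_nonneg ‖w‖)]

theorem norm_rpow_eq (z : E3) (γ : ℝ) : ‖z‖ ^ γ = (‖z‖ ^ 2) ^ (γ / 2) := by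
  rw [← Real.rpow_natCast, ← Real.rpow_mul (norm_nonneg z)]
  congr 1
  push_cast
  ring

theorem norm_sub_rpow_le {γ : ℝ} (hγ : 0 ≤ γ) (v w : E3) :
    ‖v - w‖ ^ γ ≤ 2 ^ (γ / 2) * W v ^ (γ / 2) * W w ^ (γ / 2) := by
  have hv := W_pos v
  have hw := W_pos w
  rw [norm_rpow_eq, mul_assoc, ← Real.mul_rpow hv.le hw.le, ← Real.mul_rpow (by norm_num)
    (by positivity)]
  exact Real.rpow_le_rpow (by positivity) (norm_sub_sq_le_W v w) (by positivity)

/-- The weighted form `⟨v⟩^γ (|ξ|² + |v × ξ|²)`, comparable to `ā ξ · ξ`. -/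
def En (γ : ℝ) (v : E3) (ξ : Fin 3 → ℝ) : ℝ := W v ^ (γ / 2) * (nsq ξ + cr v ξ)

theorem En_nonneg (γ : ℝ) (v : E3) (ξ : Fin 3 → ℝ) : 0 ≤ En γ v ξ :=
  mul_nonneg (Real.rpow_nonneg (W_pos v).le _) (add_nonneg (nsq_nonneg ξ) (cr_nonneg v ξ))

theorem bil_a_sub_le {γ : ℝ} (hγ : 0 ≤ γ) (v w : E3) (ξ : Fin 3 → ℝ) :
    bil (fun j k => a γ j k (v - w)) ξ ξ ≤
      2 * 2 ^ (γ / 2) * En γ v ξ * W w ^ (γ / 2 + 1) := by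
  rw [bil_a_self]
  have h1 := norm_sub_rpow_le hγ v w
  have h2 := cr_sub_le v w ξ
  have hv := W_pos v
  have hw := W_pos w
  calc _ ≤ (2 ^ (γ / 2) * W v ^ (γ / 2) * W w ^ (γ / 2)) * (2 * (nsq ξ + cr v ξ) * W w) :=
        mul_le_mul h1 h2 (cr_nonneg _ _) (by positivity)
    _ = _ := by rw [Real.rpow_add hw, Real.rpow_one, En]; ring

namespace Sch

/-- Integral over the velocity at `x = 0`. -/
def intv : Sch →ₗ[ℝ] ℝ where
  toFun u := ∫ v, u 0 v
  map_add' u w := integral_add (u.integrable_v 0) (w.integrable_v 0)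
  map_smul' c _ := integral_const_mul c _

theorem intv_app (u : Sch) : intv u = ∫ v, u 0 v := rfl

theorem intv_D (j : Fin 3) (u : Sch) : intv (D j u) = 0 := int_v_D j u 0

theorem intv_Ap_mul (j : Fin 3) (u w : Sch) : intv (mul (Ap j u) w) = intv (mul u (Am j w)) := by
  have h := intv_D j (mul u w)
  have h2 : mul (V j u) w = mul u (V j w) := by
    rw [V, wt_mul, mul_wt]
  rw [D_mul, map_add] at h
  simp only [Ap, Am, LinearMap.sub_apply, LinearMap.add_apply, map_sub, map_add, h2]
  linarith

/-- The mass of `μ`. -/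
def mass : ℝ := intv (mul gs gs)

theorem mass_pos : 0 < mass := by
  have hi := (mul gs gs).integrable_v 0
  refine (integral_pos_iff_support_of_nonneg (f := (mul gs gs) 0)
    (fun v => mul_self_nonneg (sqrtMu v)) hi).2 ?_
  have : Function.support ((mul gs gs) 0) = Set.univ := by
    ext v
    simp [(sqrtMu_pos v).ne']
  rw [this]
  simp

theorem Am_Ap_pow (q : ℕ) : Am 0 ((Ap 0 ^ q) gs) = (q : ℝ) • (Ap 0 ^ (q - 1)) gs := by
  induction q with
  | zero => simp [Am_gs]
  | succ q ih =>
    have h := LinearMap.congr_fun (Am_Ap 0 0) ((Ap 0 ^ q) gs)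
    simp only [Module.End.mul_apply, if_true, LinearMap.add_apply, Module.End.one_apply, ih,
      map_smul] at h
    rw [pow_succ', Module.End.mul_apply, h, Nat.add_sub_cancel]
    rcases q with _ | q
    · simp
    · rw [Nat.add_sub_cancel, ← Module.End.mul_apply, ← pow_succ']
      push_cast
      module

/-- The functions A_+^q √μ are unnormalised Hermite functions; moving one creation operator across
and applying the ladder relation produces the factor q + 1. -/
theorem intv_Ap_pow_sq (q : ℕ) :
    intv (mul ((Ap 0 ^ q) gs) ((Ap 0 ^ q) gs)) = q.factorial * mass := by
  induction q with
  | zero => simp [mass]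
  | succ q ih =>
    nth_rewrite 1 [pow_succ']
    rw [Module.End.mul_apply, intv_Ap_mul, Am_Ap_pow, Nat.add_sub_cancel, map_smul, map_smul, ih,
      Nat.factorial_succ]
    push_cast
    simp only [smul_eq_mul]
    ring

/-- A density dominating `2⟨w⟩^{γ+2} |∂_1^q μ|`. -/
def dom (γ s : ℝ) (q : ℕ) : Sch := s • wt _ (W_rpow_temp (γ + 2)) (mul gs gs) +
  s⁻¹ • mul ((Ap 0 ^ q) gs) ((Ap 0 ^ q) gs)

/-- Young's inequality with all the polynomial weight placed on √μ, so that the Hermite factor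
enters only through its unweighted norm, which is known exactly. -/
theorem W_mul_abs_muD_le (γ : ℝ) {s : ℝ} (hs : 0 < s) (q : ℕ) (w : E3) :
    W w ^ (γ / 2 + 1) * |muD q 0 w| ≤ dom γ s q 0 w / 2 := by
  have hw := W_pos w
  have h := abs_mul_le_young hs (W w ^ (γ / 2 + 1) * sqrtMu w) (((Ap 0 ^ q) gs) 0 w)
  have h1 : |muD q 0 w| = sqrtMu w * |((Ap 0 ^ q) gs) 0 w| := by
    simp [muD, abs_mul, abs_of_pos (sqrtMu_pos w)]
  have h2 : (W w ^ (γ / 2 + 1)) ^ 2 = W w ^ (γ + 2) := by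
    rw [← Real.rpow_natCast, ← Real.rpow_mul hw.le]
    congr 1
    push_cast
    ring
  rw [abs_mul, abs_mul, abs_of_pos (sqrtMu_pos w), abs_of_pos (Real.rpow_pos_of_pos hw _), mul_pow,
    h2] at h
  rw [h1]
  simp only [dom, add_app, smul_app, wt_app, mul_app, gs_app]
  linarith

/-- The choice s = √(q!) balances the two parts, of sizes s and q!/s. -/
theorem intv_dom (γ : ℝ) (q : ℕ) : intv (dom γ (Real.sqrt q.factorial) q) =
    Real.sqrt q.factorial * (intv (wt _ (W_rpow_temp (γ + 2)) (mul gs gs)) + mass) := by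
  rw [dom, map_add, map_smul, map_smul, intv_Ap_pow_sq, smul_eq_mul, smul_eq_mul, mul_add,
    ← mul_assoc (Real.sqrt _)⁻¹]
  congr 2
  have h : Real.sqrt (q.factorial : ℝ) * Real.sqrt q.factorial = q.factorial :=
    Real.mul_self_sqrt (by positivity)
  have h0 : Real.sqrt (q.factorial : ℝ) ≠ 0 := by positivity
  field_simp
  rw [sq, h]

theorem bil_abarD {γ : ℝ} (hγ : 0 ≤ γ) (q : ℕ) (v : E3) (ξ η : Fin 3 → ℝ) :
    bil (fun j k => abarD γ j k q v) ξ η =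
      ∫ w, bil (fun j k => a γ j k (v - w)) ξ η * muD q 0 w := by
  have hi : ∀ j k, Integrable (fun w => a γ j k (v - w) * muD q 0 w * (ξ j * η k)) := fun j k =>
    (integrable_conv (polyGrowth_a hγ j k) _ v).mul_const _
  have h : ∀ w, bil (fun j k => a γ j k (v - w)) ξ η * muD q 0 w =
      ∑ j, ∑ k, a γ j k (v - w) * muD q 0 w * (ξ j * η k) := fun w => by
    simp only [bil, Finset.sum_mul]
    exact Finset.sum_congr rfl fun j _ => Finset.sum_congr rfl fun k _ => by ring
  simp only [h]
  rw [integral_finsetSum _ fun j _ => integrable_finsetSum _ fun k _ => hi j k]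
  refine Finset.sum_congr rfl fun j _ => ?_
  rw [integral_finsetSum _ fun k _ => hi j k]
  refine Finset.sum_congr rfl fun k _ => ?_
  simp only [abarD]
  rw [integral_mul_const, conv_eq, mul_assoc]

/-- Upper bound for the derivatives of `ā` by the weighted form. -/
theorem abs_bil_abarD_le {γ : ℝ} (hγ : 0 ≤ γ) : ∃ C : ℝ, 0 < C ∧ ∀ (q : ℕ) (v : E3)
    (ξ η : Fin 3 → ℝ) (l : ℝ), 0 < l → |bil (fun j k => abarD γ j k q v) ξ η| ≤
      C * Real.sqrt q.factorial * (l * En γ v ξ + l⁻¹ * En γ v η) := by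
  set M := intv (wt _ (W_rpow_temp (γ + 2)) (mul gs gs)) + mass with hM
  have hM0 : 0 < M := by
    refine add_pos_of_nonneg_of_pos ?_ mass_pos
    refine integral_nonneg fun v => ?_
    exact mul_nonneg (Real.rpow_nonneg (W_pos v).le _) (mul_self_nonneg _)
  refine ⟨2 ^ (γ / 2) / 2 * M, by positivity, fun q v ξ η l hl => ?_⟩
  have hs : 0 < Real.sqrt (q.factorial : ℝ) := by positivity
  rw [bil_abarD hγ]
  have hb : ∀ w, ‖bil (fun j k => a γ j k (v - w)) ξ η * muD q 0 w‖ ≤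
      (2 ^ (γ / 2) / 2 * (l * En γ v ξ + l⁻¹ * En γ v η)) *
        dom γ (Real.sqrt q.factorial) q 0 w := by
    intro w
    rw [norm_mul, Real.norm_eq_abs, Real.norm_eq_abs]
    have h1 := abs_bil_a_le γ (v - w) ξ η hl
    have h2 := mul_le_mul_of_nonneg_left (bil_a_sub_le hγ v w ξ) hl.le
    have h3 := mul_le_mul_of_nonneg_left (bil_a_sub_le hγ v w η) (inv_pos.2 hl).le
    have h4 := W_mul_abs_muD_le γ hs q w
    have h5 := add_nonneg (mul_nonneg hl.le (En_nonneg γ v ξ))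
      (mul_nonneg (inv_pos.2 hl).le (En_nonneg γ v η))
    have h6 : |bil (fun j k => a γ j k (v - w)) ξ η| ≤
        2 ^ (γ / 2) * (l * En γ v ξ + l⁻¹ * En γ v η) * W w ^ (γ / 2 + 1) := by linarith
    calc _ ≤ 2 ^ (γ / 2) * (l * En γ v ξ + l⁻¹ * En γ v η) * W w ^ (γ / 2 + 1) * |muD q 0 w| := by
          gcongr
      _ = 2 ^ (γ / 2) * (l * En γ v ξ + l⁻¹ * En γ v η) * (W w ^ (γ / 2 + 1) * |muD q 0 w|) := by
          ring
      _ ≤ 2 ^ (γ / 2) * (l * En γ v ξ + l⁻¹ * En γ v η) *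
          (dom γ (Real.sqrt q.factorial) q 0 w / 2) := by gcongr
      _ = _ := by ring
  have := norm_integral_le_of_norm_le (((dom γ (Real.sqrt q.factorial) q).integrable_v 0).const_mul _)
    (Filter.Eventually.of_forall hb)
  rw [integral_const_mul, ← intv_app, intv_dom, ← hM] at this
  exact this.trans (le_of_eq (by ring))

end Sch

/-! ### Lower bound for ā -/

namespace Sch

theorem intv_gs_Ap (k : Fin 3) : intv (mul gs (Ap k gs)) = 0 := by
  have h : mul gs (Ap k gs) = mul (Ap k gs) gs := by ext x v; simp [mul_comm]
  rw [h, intv_Ap_mul, Am_gs, map_zero, map_zero]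

theorem intv_Ap_gs (k : Fin 3) : intv (mul (Ap k gs) gs) = 0 := by
  rw [intv_Ap_mul, Am_gs, map_zero, map_zero]

theorem intv_Ap_Ap (j k : Fin 3) :
    intv (mul (Ap j gs) (Ap k gs)) = if j = k then mass else 0 := by
  have h := LinearMap.congr_fun (Am_Ap j k) gs
  rw [Module.End.mul_apply, LinearMap.add_apply, Module.End.mul_apply, Am_gs, map_zero,
    zero_add] at h
  rw [intv_Ap_mul, h]
  by_cases hjk : j = k <;> simp [hjk, mass]

/-- `√μ` times an affine form in two of the coordinates. -/
def aff (α β δ : ℝ) (j k : Fin 3) : Sch := α • gs - β • Ap j gs + δ • Ap k gs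

theorem aff_app (α β δ : ℝ) (j k : Fin 3) (x v : E3) :
    aff α β δ j k x v = (α - β * v j + δ * v k) * sqrtMu v := by
  simp only [aff, add_app, sub_app, smul_app, Ap_gs_app, gs_app]
  ring

/-- The functions √μ and v_j √μ are orthogonal with equal norms, so the integral is a sum of
squares. It supplies the Gaussian second moments in `intv_crMu`. -/
theorem intv_aff (α β δ : ℝ) {j k : Fin 3} (hjk : j ≠ k) :
    intv (mul (aff α β δ j k) (aff α β δ j k)) = (α ^ 2 + β ^ 2 + δ ^ 2) * mass := by
  have h0 : intv (mul gs gs) = mass := rfl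
  simp only [aff, map_add, map_sub, map_smul, LinearMap.add_apply, LinearMap.sub_apply,
    LinearMap.smul_apply, intv_gs_Ap, intv_Ap_gs, intv_Ap_Ap, h0, smul_eq_mul, if_true,
    hjk, hjk.symm, if_false]
  ring

/-- `|(v - w) × ξ|² μ(w)` as a function of `w`. -/
def crMu (v : E3) (ξ : Fin 3 → ℝ) : Sch :=
  mul (aff (v 1 * ξ 2 - v 2 * ξ 1) (ξ 2) (ξ 1) 1 2) (aff (v 1 * ξ 2 - v 2 * ξ 1) (ξ 2) (ξ 1) 1 2) +
  mul (aff (v 2 * ξ 0 - v 0 * ξ 2) (ξ 0) (ξ 2) 2 0) (aff (v 2 * ξ 0 - v 0 * ξ 2) (ξ 0) (ξ 2) 2 0) +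
  mul (aff (v 0 * ξ 1 - v 1 * ξ 0) (ξ 1) (ξ 0) 0 1) (aff (v 0 * ξ 1 - v 1 * ξ 0) (ξ 1) (ξ 0) 0 1)

theorem crMu_app (v w : E3) (ξ : Fin 3 → ℝ) : crMu v ξ 0 w = cr (v - w) ξ * mu w := by
  simp only [crMu, add_app, mul_app, aff_app, cr, PiLp.sub_apply, ← sqrtMu_mul_self]
  ring

theorem intv_crMu (v : E3) (ξ : Fin 3 → ℝ) :
    intv (crMu v ξ) = (cr v ξ + 2 * nsq ξ) * mass := by
  rw [crMu, map_add, map_add, intv_aff _ _ _ (by decide), intv_aff _ _ _ (by decide),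
    intv_aff _ _ _ (by decide), cr, nsq]
  ring

/-- The factor `W w` comes from `cr_sub_le`; the other three powers of ⟨w⟩ offset the volume of a
ball of radius proportional to ⟨v⟩. -/
theorem W_mul_sqrt_mul_mu_le : ∃ C : ℝ, 0 < C ∧ ∀ w, W w * Real.sqrt (W w) ^ 3 * mu w ≤ C := by
  obtain ⟨C, hC⟩ := (wt _ (W_rpow_temp (5 / 2)) (muD 0)).isSch.decay 0 0
  refine ⟨|C| + 1, by positivity, fun w => ?_⟩
  have h := hC 0 w
  rw [norm_iteratedFDeriv_zero, pow_zero, one_mul] at h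
  have h1 : W w * Real.sqrt (W w) ^ 3 = W w ^ (5 / 2 : ℝ) := by
    rw [Real.sqrt_eq_rpow, ← Real.rpow_natCast, ← Real.rpow_mul (W_pos w).le]
    nth_rewrite 1 [← Real.rpow_one (W w)]
    rw [← Real.rpow_add (W_pos w)]
    norm_num
  have h2 : uncurry (wt _ (W_rpow_temp (5 / 2)) (muD 0)).fn (0, w) = W w ^ (5 / 2 : ℝ) * mu w := by
    simp [uncurry, muD_zero_app]
  rw [h2] at h
  rw [h1]
  exact (le_abs_self _).trans (h.trans ((le_abs_self C).trans (by linarith)))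

theorem mu_pos (v : E3) : 0 < mu v := by
  rw [← sqrtMu_mul_self]
  exact mul_pos (sqrtMu_pos v) (sqrtMu_pos v)

theorem W_le_four_mul {v w : E3} (h : ‖v - w‖ ≤ Real.sqrt (W v) / 2) : W v ≤ 4 * W w := by
  have h1 : ‖v - w‖ ^ 2 ≤ W v / 4 := by
    calc ‖v - w‖ ^ 2 ≤ (Real.sqrt (W v) / 2) ^ 2 := by gcongr
      _ = W v / 4 := by rw [div_pow, Real.sq_sqrt (W_pos v).le]; norm_num
  have h2 := norm_sub_sq_le (v - w) (-w)
  rw [sub_neg_eq_add, sub_add_cancel, norm_neg] at h2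
  unfold W at *
  linarith

/-- Lower bound for `ā` by the weighted form. -/
theorem En_le_bil_abarD {γ : ℝ} (hγ : 0 ≤ γ) : ∃ c : ℝ, 0 < c ∧ ∀ (v : E3) (ξ : Fin 3 → ℝ),
    c * En γ v ξ ≤ bil (fun j k => abarD γ j k 0 v) ξ ξ := by
  obtain ⟨C, hC0, hC⟩ := W_mul_sqrt_mul_mu_le
  set om : ℝ := volume.real (Metric.ball (0 : E3) 1) with hom
  have hom0 : 0 ≤ om := measureReal_nonneg
  -- A ball of radius θ⟨v⟩ around v is removed, outside of which |v-w|^γ is bounded below. The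
  -- radius is small enough for the removal to cost at most half the mass, and θ ≤ 1/2 keeps ⟨w⟩
  -- comparable to ⟨v⟩ in the ball.
  set θ : ℝ := min (1 / 2) (mass / (32 * C * om + 1)) with hθ
  have hm := mass_pos
  have hθ0 : 0 < θ := lt_min (by norm_num) (by positivity)
  have hθ1 : θ ≤ 1 / 2 := min_le_left _ _
  have hθ2 : 16 * C * om * θ ^ 3 ≤ mass / 2 := by
    have h1 : θ * (32 * C * om + 1) ≤ mass := by
      rw [← le_div_iff₀ (by positivity)]
      exact min_le_right _ _
    have h2 : θ ^ 3 ≤ θ := pow_le_of_le_one hθ0.le (by linarith) (by norm_num)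
    have h3 : 16 * C * om * θ ^ 3 ≤ 16 * C * om * θ := by gcongr
    linarith
  refine ⟨θ ^ γ * (mass / 2), by positivity, fun v ξ => ?_⟩
  have hWv := W_pos v
  set r := Real.sqrt (W v) with hr
  have hr0 : 0 < r := Real.sqrt_pos.2 hWv
  set S := nsq ξ + cr v ξ with hS
  have hS0 : 0 ≤ S := add_nonneg (nsq_nonneg ξ) (cr_nonneg v ξ)
  set B := Metric.ball v (θ * r) with hB
  -- A bound for |(v-w) × ξ|² μ(w) on the ball; the factor r⁻³ cancels the volume.
  set Dd := 16 * S * C * (r ^ 3)⁻¹ with hDd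
  have hDd0 : 0 ≤ Dd := by positivity
  have hvol : volume.real B = θ ^ 3 * r ^ 3 * om := by
    rw [hB, Measure.real, Measure.addHaar_ball_of_pos volume v (mul_pos hθ0 hr0)]
    rw [ENNReal.toReal_mul, ENNReal.toReal_ofReal (by positivity)]
    simp only [finrank_euclideanSpace, Fintype.card_fin]
    rw [mul_pow, hom, Measure.real]
  have hBfin : volume B ≠ ⊤ := measure_ball_lt_top.ne
  -- Outside the ball this is |v-w| ≥ θr. Inside, the left side is nonpositive by the choice of `Dd`
  -- and the right side is nonnegative.
  have hpt : ∀ w, (θ * r) ^ γ * (crMu v ξ 0 w - B.indicator (fun _ => Dd) w) ≤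
      bil (fun j k => a γ j k (v - w)) ξ ξ * muD 0 0 w := by
    intro w
    rw [bil_a_self, crMu_app, muD_zero_app]
    have hcr := cr_nonneg (v - w) ξ
    have hmu := mu_pos w
    by_cases hw : w ∈ B
    · rw [Set.indicator_of_mem hw]
      have hw' : ‖v - w‖ < θ * r := by
        rwa [hB, Metric.mem_ball, dist_comm, dist_eq_norm] at hw
      have h4 : W v ≤ 4 * W w := W_le_four_mul (hw'.le.trans (by
        rw [← hr]; nlinarith))
      have h5 : r ≤ 2 * Real.sqrt (W w) := by
        rw [hr, show (2 : ℝ) = Real.sqrt 4 by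
          rw [show (4 : ℝ) = 2 ^ 2 by norm_num, Real.sqrt_sq (by norm_num)],
          ← Real.sqrt_mul (by norm_num)]
        exact Real.sqrt_le_sqrt h4
      have h6 : r ^ 3 ≤ 8 * Real.sqrt (W w) ^ 3 := by
        calc r ^ 3 ≤ (2 * Real.sqrt (W w)) ^ 3 := by gcongr
          _ = _ := by ring
      have h7 : W w * mu w ≤ 8 * C * (r ^ 3)⁻¹ := by
        rw [← div_eq_mul_inv, le_div_iff₀ (by positivity)]
        have := hC w
        have hp : 0 ≤ W w * mu w := (mul_pos (W_pos w) hmu).le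
        nlinarith [mul_le_mul_of_nonneg_left h6 hp]
      have h8 : cr (v - w) ξ * mu w ≤ Dd := by
        calc cr (v - w) ξ * mu w ≤ 2 * S * W w * mu w := by gcongr; exact cr_sub_le v w ξ
          _ = 2 * S * (W w * mu w) := by ring
          _ ≤ 2 * S * (8 * C * (r ^ 3)⁻¹) := by gcongr
          _ = Dd := by rw [hDd]; ring
      have h9 : (θ * r) ^ γ * (cr (v - w) ξ * mu w - Dd) ≤ 0 :=
        mul_nonpos_of_nonneg_of_nonpos (by positivity) (by linarith)
      exact h9.trans (by positivity)
    · rw [Set.indicator_of_notMem hw, sub_zero]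
      have hw' : θ * r ≤ ‖v - w‖ := by
        rwa [hB, Metric.mem_ball, dist_comm, dist_eq_norm, not_lt] at hw
      rw [← mul_assoc]
      gcongr
  have hi1 : Integrable (fun w => crMu v ξ 0 w) := (crMu v ξ).integrable_v 0
  have hi2 : Integrable (B.indicator (fun _ => Dd)) :=
    (integrableOn_const hBfin).integrable_indicator measurableSet_ball
  have hi3 : Integrable (fun w => bil (fun j k => a γ j k (v - w)) ξ ξ * muD 0 0 w) := by
    simp only [bil, Finset.sum_mul]
    refine integrable_finsetSum _ fun j _ => integrable_finsetSum _ fun k _ => ?_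
    refine ((integrable_conv (polyGrowth_a hγ j k) (muD 0) v).mul_const (ξ j * ξ k)).congr
      (Filter.Eventually.of_forall fun w => ?_)
    simp only
    ring
  have hint := integral_mono ((hi1.sub hi2).const_mul ((θ * r) ^ γ)) hi3 hpt
  have he : ∫ w, (θ * r) ^ γ * (crMu v ξ 0 w - B.indicator (fun _ => Dd) w) =
      (θ * r) ^ γ * ((cr v ξ + 2 * nsq ξ) * mass - θ ^ 3 * r ^ 3 * om * Dd) := by
    rw [integral_const_mul, integral_sub hi1 hi2, ← intv_app, intv_crMu,
      integral_indicator measurableSet_ball, setIntegral_const, hvol, smul_eq_mul]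
  have he' : θ ^ 3 * r ^ 3 * om * Dd = 16 * C * om * θ ^ 3 * S := by
    rw [hDd]
    field_simp
  rw [bil_abarD hγ]
  refine le_trans ?_ (he ▸ hint)
  have hrg : (θ * r) ^ γ = θ ^ γ * W v ^ (γ / 2) := by
    rw [Real.mul_rpow hθ0.le hr0.le, hr, Real.sqrt_eq_rpow, ← Real.rpow_mul hWv.le]
    congr 2
    ring
  rw [he', hrg, En, ← hS]
  have h10 : mass / 2 * S ≤ (cr v ξ + 2 * nsq ξ) * mass - 16 * C * om * θ ^ 3 * S := by
    have h11 := mul_le_mul_of_nonneg_right hθ2 hS0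
    have h12 := mul_nonneg (nsq_nonneg ξ) hm.le
    have h13 : S * mass = nsq ξ * mass + cr v ξ * mass := by rw [hS]; ring
    nlinarith
  have h14 : 0 ≤ θ ^ γ * W v ^ (γ / 2) := by positivity
  calc _ = θ ^ γ * W v ^ (γ / 2) * (mass / 2 * S) := by ring
    _ ≤ _ := mul_le_mul_of_nonneg_left h10 h14

end Sch

/-! ### Growth of the derivatives of the drift coefficient -/

theorem rpow_sub_rpow_le {p r s : ℝ} (hp : 1 ≤ p) (hr : 0 ≤ r) (hrs : r ≤ s) :
    s ^ p - r ^ p ≤ p * s ^ (p - 1) * (s - r) := by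
  rcases hr.eq_or_lt with rfl | hr
  · rcases hrs.eq_or_lt with rfl | hs
    · simp
    · rw [Real.zero_rpow (by linarith), sub_zero, sub_zero, mul_assoc, ← Real.rpow_add_one hs.ne',
        sub_add_cancel]
      exact le_mul_of_one_le_left (by positivity) hp
  have hs : 0 < s := hr.trans_le hrs
  have h := one_add_mul_self_le_rpow_one_add (s := r / s - 1)
    (by have : 0 ≤ r / s := by positivity
        linarith) hp
  rw [add_sub_cancel, Real.div_rpow hr.le hs.le, le_div_iff₀ (by positivity)] at h
  have h2 : s ^ p = s ^ (p - 1) * s := by rw [← Real.rpow_add_one hs.ne', sub_add_cancel]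
  have h3 : (1 + p * (r / s - 1)) * s ^ p = s ^ p + p * s ^ (p - 1) * (r - s) := by
    rw [add_mul, one_mul]
    congr 1
    rw [h2]
    field_simp
  linarith

/-- A kernel homogeneous of degree γ + 2 should have Lipschitz constants of degree γ + 1; finite
differences avoid differentiating |z|^γ at the origin. -/
theorem abs_a_sub_le_of_le {γ : ℝ} (hγ : 0 ≤ γ) (j k : Fin 3) {z y : E3} (h : ‖z‖ ≤ ‖y‖) :
    |a γ j k z - a γ j k y| ≤ (2 * (γ + 2) + 4) * ‖y‖ ^ (γ + 1) * ‖z - y‖ := by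
  set p : E3 → ℝ := fun z => (if j = k then 1 else 0) * ‖z‖ ^ 2 - z j * z k with hp
  have hzj := PiLp.norm_apply_le z j
  have hzk := PiLp.norm_apply_le z k
  have hyk := PiLp.norm_apply_le y k
  have hdj := PiLp.norm_apply_le (z - y) j
  have hdk := PiLp.norm_apply_le (z - y) k
  rw [Real.norm_eq_abs] at hzj hzk hyk hdj hdk
  rw [PiLp.sub_apply] at hdj hdk
  have hn : ‖y‖ - ‖z‖ ≤ ‖z - y‖ := by
    rw [norm_sub_rev]; exact norm_sub_norm_le y z
  have hz0 := norm_nonneg z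
  have hy0 := norm_nonneg y
  have hd0 := norm_nonneg (z - y)
  have h1 : |p z| ≤ 2 * ‖z‖ ^ 2 := by
    have e1 : |(if j = k then 1 else 0) * ‖z‖ ^ 2| ≤ ‖z‖ ^ 2 := by split_ifs <;> simp
    have e2 : |z j * z k| ≤ ‖z‖ ^ 2 := by
      rw [abs_mul, sq]; exact mul_le_mul hzj hzk (abs_nonneg _) hz0
    have := abs_sub ((if j = k then 1 else 0) * ‖z‖ ^ 2) (z j * z k)
    simp only [hp]
    linarith
  have h2 : |p z - p y| ≤ 4 * ‖y‖ * ‖z - y‖ := by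
    have e1 : |(if j = k then 1 else 0) * (‖z‖ ^ 2 - ‖y‖ ^ 2)| ≤ 2 * ‖y‖ * ‖z - y‖ := by
      have e3 : |‖z‖ ^ 2 - ‖y‖ ^ 2| ≤ 2 * ‖y‖ * ‖z - y‖ := by
        rw [abs_of_nonpos (by nlinarith)]
        nlinarith
      split_ifs
      · simpa using e3
      · simp; positivity
    have e2 : |(z j - y j) * z k + y k * 0 + y j * (z k - y k)| ≤ 2 * ‖y‖ * ‖z - y‖ := by
      have hyj := PiLp.norm_apply_le y j
      rw [Real.norm_eq_abs] at hyj
      rw [mul_zero, add_zero]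
      refine (abs_add_le _ _).trans ?_
      rw [abs_mul, abs_mul]
      have e4 : |z j - y j| * |z k| ≤ ‖z - y‖ * ‖y‖ :=
        mul_le_mul hdj (hzk.trans h) (abs_nonneg _) hd0
      have e5 : |y j| * |z k - y k| ≤ ‖y‖ * ‖z - y‖ := mul_le_mul hyj hdk (abs_nonneg _) hy0
      linarith
    have e6 : p z - p y = (if j = k then 1 else 0) * (‖z‖ ^ 2 - ‖y‖ ^ 2) -
        ((z j - y j) * z k + y k * 0 + y j * (z k - y k)) := by
      simp only [hp]; ring
    rw [e6]
    have := abs_sub ((if j = k then 1 else 0) * (‖z‖ ^ 2 - ‖y‖ ^ 2))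
      ((z j - y j) * z k + y k * 0 + y j * (z k - y k))
    linarith
  have h3 : ‖z‖ ^ γ ≤ ‖y‖ ^ γ := Real.rpow_le_rpow hz0 h hγ
  -- For γ < 1 the power |z|^γ alone is not Lipschitz near 0. The factor |z|² raises the exponent to
  -- γ + 2 ≥ 1, where the mean value bound applies.
  have h4 : ‖z‖ ^ 2 * (‖y‖ ^ γ - ‖z‖ ^ γ) ≤ (γ + 2) * ‖y‖ ^ (γ + 1) * ‖z - y‖ := by
    have e1 := rpow_sub_rpow_le (p := γ + 2) (by linarith) hz0 h
    have e2 : ∀ x : ℝ, 0 ≤ x → x ^ (γ + 2) = x ^ γ * x ^ 2 := fun x hx => by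
      rw [Real.rpow_add' hx (by linarith)]; norm_cast
    rw [e2 _ hy0, e2 _ hz0, show γ + 2 - 1 = γ + 1 by ring] at e1
    have e3 : ‖z‖ ^ 2 * ‖y‖ ^ γ ≤ ‖y‖ ^ 2 * ‖y‖ ^ γ := by gcongr
    have e4 : (γ + 2) * ‖y‖ ^ (γ + 1) * (‖y‖ - ‖z‖) ≤ (γ + 2) * ‖y‖ ^ (γ + 1) * ‖z - y‖ := by
      gcongr
    linarith
  have h5 : ‖y‖ * ‖y‖ ^ γ = ‖y‖ ^ (γ + 1) := by
    rw [Real.rpow_add' hy0 (by linarith), Real.rpow_one, mul_comm]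
  have h6 : a γ j k z - a γ j k y = p z * (‖z‖ ^ γ - ‖y‖ ^ γ) + (p z - p y) * ‖y‖ ^ γ := by
    simp only [a, hp]; ring
  rw [h6]
  calc _ ≤ |p z * (‖z‖ ^ γ - ‖y‖ ^ γ)| + |(p z - p y) * ‖y‖ ^ γ| := abs_add_le _ _
    _ = |p z| * (‖y‖ ^ γ - ‖z‖ ^ γ) + |p z - p y| * ‖y‖ ^ γ := by
      rw [abs_mul, abs_mul, abs_of_nonpos (sub_nonpos.2 h3), neg_sub,
        abs_of_nonneg (by positivity : 0 ≤ ‖y‖ ^ γ)]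
    _ ≤ 2 * ‖z‖ ^ 2 * (‖y‖ ^ γ - ‖z‖ ^ γ) + 4 * ‖y‖ * ‖z - y‖ * ‖y‖ ^ γ := by
      have := sub_nonneg.2 h3
      gcongr
    _ = 2 * (‖z‖ ^ 2 * (‖y‖ ^ γ - ‖z‖ ^ γ)) + 4 * (‖y‖ * ‖y‖ ^ γ) * ‖z - y‖ := by ring
    _ ≤ _ := by rw [h5]; linarith

theorem abs_a_sub_le {γ : ℝ} (hγ : 0 ≤ γ) (j k : Fin 3) (z y : E3) :
    |a γ j k z - a γ j k y| ≤ (2 * (γ + 2) + 4) * (‖z‖ + ‖y‖) ^ (γ + 1) * ‖z - y‖ := by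
  rcases le_total ‖z‖ ‖y‖ with h | h
  · refine (abs_a_sub_le_of_le hγ j k h).trans ?_
    gcongr
    linarith [norm_nonneg z]
  · rw [abs_sub_comm, norm_sub_rev]
    refine (abs_a_sub_le_of_le hγ j k h).trans ?_
    gcongr
    linarith [norm_nonneg y]

theorem rpow_norm_add_norm_le {s : ℝ} (hs : 0 ≤ s) {x v : E3} (w : E3) (h : ‖x - v‖ ≤ 1) :
    (‖x - w‖ + ‖v - w‖) ^ s ≤ 12 ^ (s / 2) * W v ^ (s / 2) * W w ^ (s / 2) := by
  have h1 : ‖x - w‖ ≤ ‖v - w‖ + 1 := by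
    have := norm_add_le (x - v) (v - w)
    rw [sub_add_sub_cancel] at this
    linarith
  have h2 := norm_sub_le v w
  have h3 : ‖x - w‖ + ‖v - w‖ ≤ 2 * ‖v‖ + 2 * ‖w‖ + 1 := by linarith
  have h4 : (‖x - w‖ + ‖v - w‖) ^ 2 ≤ 12 * (W v * W w) := by
    calc _ ≤ (2 * ‖v‖ + 2 * ‖w‖ + 1) ^ 2 := by gcongr
      _ ≤ _ := by
        unfold W
        nlinarith [sq_nonneg (2 * ‖v‖ - 2 * ‖w‖), sq_nonneg (2 * ‖v‖ - 1),
          sq_nonneg (2 * ‖w‖ - 1), mul_nonneg (sq_nonneg ‖v‖) (sq_nonneg ‖w‖)]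
  have hv := W_pos v
  have hw := W_pos w
  have h5 : (‖x - w‖ + ‖v - w‖) ^ s = ((‖x - w‖ + ‖v - w‖) ^ 2) ^ (s / 2) := by
    rw [← Real.rpow_natCast, ← Real.rpow_mul (by positivity)]
    congr 1
    push_cast
    ring
  rw [h5, mul_assoc, ← Real.mul_rpow hv.le hw.le, ← Real.mul_rpow (by norm_num) (by positivity)]
  exact Real.rpow_le_rpow (by positivity) h4 (by positivity)

namespace Sch

/-- The derivatives of the drift coefficient grow one order slower than the coefficient. -/
theorem abs_fderiv_bco_le {γ : ℝ} (hγ : 0 ≤ γ) : ∃ C : ℝ, 0 < C ∧ ∀ (j k i : Fin 3) (v : E3),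
    |fderiv ℝ (bco γ j k) v (EuclideanSpace.single i 1)| ≤ C * W v ^ ((γ + 1) / 2) := by
  set N := intv (wt _ (W_rpow_temp ((γ + 1) / 2 + 1)) (muD 0)) with hN
  have hN0 : 0 ≤ N := integral_nonneg fun v => by
    rw [wt_app, muD_zero_app]
    exact mul_nonneg (Real.rpow_nonneg (W_pos v).le _) (mu_pos v).le
  set A : ℝ := (2 * (γ + 2) + 4) * 12 ^ ((γ + 1) / 2) with hA
  have hA0 : 0 < A := by positivity
  refine ⟨A * N + 1, by positivity, fun j k i v => ?_⟩
  have hd := ((bco_temp hγ j k).1.differentiable (by simp) v).hasFDerivAt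
  have hWv := W_pos v
  -- Differencing the kernel gains one power of ⟨v⟩; a derivative placed on v_k μ would retain the
  -- full growth ⟨v⟩^{γ+2} of `a`.
  have hlip : ∀ᶠ x in nhds v, ‖bco γ j k x - bco γ j k v‖ ≤
      (A * N * W v ^ ((γ + 1) / 2)) * ‖x - v‖ := by
    filter_upwards [Metric.closedBall_mem_nhds v one_pos] with x hx
    rw [mem_closedBall_iff_norm] at hx
    simp only [bco]
    rw [conv_eq, conv_eq, ← integral_sub (integrable_conv (polyGrowth_a hγ j k) _ x)
      (integrable_conv (polyGrowth_a hγ j k) _ v)]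
    have hb : ∀ w, ‖a γ j k (x - w) * vmu k 0 w - a γ j k (v - w) * vmu k 0 w‖ ≤
        (A * W v ^ ((γ + 1) / 2) * ‖x - v‖) *
          wt _ (W_rpow_temp ((γ + 1) / 2 + 1)) (muD 0) 0 w := by
      intro w
      have h1 := abs_a_sub_le hγ j k (x - w) (v - w)
      rw [sub_sub_sub_cancel_right] at h1
      have h2 := rpow_norm_add_norm_le (s := γ + 1) (by linarith) w hx
      have h3 : |w k| ≤ W w := by
        have := PiLp.norm_apply_le w k
        rw [Real.norm_eq_abs] at this
        unfold W
        nlinarith [sq_nonneg (‖w‖ - 1), norm_nonneg w]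
      rw [← sub_mul, norm_mul, vmu_app, wt_app, muD_zero_app, Real.norm_eq_abs, Real.norm_eq_abs,
        abs_mul, abs_of_pos (mu_pos w), Real.rpow_add (W_pos w), Real.rpow_one]
      have hWw := W_pos w
      have hm := mu_pos w
      have h4 : |a γ j k (x - w) - a γ j k (v - w)| ≤
          A * W v ^ ((γ + 1) / 2) * W w ^ ((γ + 1) / 2) * ‖x - v‖ := by
        refine h1.trans ?_
        calc _ ≤ (2 * (γ + 2) + 4) * (12 ^ ((γ + 1) / 2) * W v ^ ((γ + 1) / 2) *
              W w ^ ((γ + 1) / 2)) * ‖x - v‖ := by gcongr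
          _ = _ := by rw [hA]; ring
      calc _ ≤ (A * W v ^ ((γ + 1) / 2) * W w ^ ((γ + 1) / 2) * ‖x - v‖) * (W w * mu w) := by
            gcongr
        _ = _ := by ring
    have := norm_integral_le_of_norm_le
      (((wt _ (W_rpow_temp ((γ + 1) / 2 + 1)) (muD 0)).integrable_v 0).const_mul _)
      (Filter.Eventually.of_forall hb)
    rw [integral_const_mul, ← intv_app, ← hN] at this
    exact this.trans (le_of_eq (by ring))
  have h1 := hd.le_of_lip' (by positivity) hlip
  have h2 := (fderiv ℝ (bco γ j k) v).le_opNorm (EuclideanSpace.single i 1)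
  rw [Real.norm_eq_abs] at h2
  have h3 : ‖(EuclideanSpace.single i (1 : ℝ) : E3)‖ = 1 := by simp
  rw [h3, mul_one] at h2
  refine h2.trans (h1.trans ?_)
  gcongr
  linarith

end Sch

/-! ### Coercivity of the σ norm and the main term -/

theorem bil_add_sub (A : Fin 3 → Fin 3 → ℝ) (ξ η : Fin 3 → ℝ) :
    bil A (fun j => ξ j + η j) (fun j => ξ j + η j) +
      bil A (fun j => ξ j - η j) (fun j => ξ j - η j) = 2 * bil A ξ ξ + 2 * bil A η η := by
  simp only [bil, Fin.sum_univ_three]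
  ring

namespace Sch

variable {γ : ℝ} (hγ : 0 ≤ γ)

/-- The density of `|||u|||_σ²`. -/
def sig (u : Sch) : Sch := ∑ j, ∑ k, wt (abarD γ j k 0) (abarD_temp hγ j k 0)
  (mul (D j u) (D k u) + mul (V j u) (V k u))

theorem sig_app (u : Sch) (x v : E3) : sig hγ u x v =
    bil (fun j k => abarD γ j k 0 v) (fun j => D j u x v) (fun j => D j u x v) +
    bil (fun j k => abarD γ j k 0 v) (fun j => V j u x v) (fun j => V j u x v) := by
  simp only [sig, bil, sum_app, wt_app, add_app, mul_app, ← Finset.sum_add_distrib]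
  exact Finset.sum_congr rfl fun j _ => Finset.sum_congr rfl fun k _ => by ring

theorem sigmaSq_eq (u : Sch) (x : E3) : sigmaSq γ (u x) = ∫ v, sig hγ u x v := by
  simp only [sig, sum_app]
  rw [sigmaSq, integral_finsetSum _ fun j _ => integrable_finsetSum _ fun k _ =>
    (wt (abarD γ j k 0) (abarD_temp hγ j k 0)
      (mul (D j u) (D k u) + mul (V j u) (V k u))).integrable_v x]
  refine Finset.sum_congr rfl fun j _ => ?_
  rw [integral_finsetSum _ fun k _ => (wt (abarD γ j k 0) (abarD_temp hγ j k 0)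
      (mul (D j u) (D k u) + mul (V j u) (V k u))).integrable_v x]
  refine Finset.sum_congr rfl fun k _ => ?_
  congr 1
  funext v
  simp only [pd_eq, wt_app, add_app, mul_app, V, abarD_zero]
  ring

theorem abarD_symm (j k : Fin 3) (q : ℕ) (v : E3) : abarD γ j k q v = abarD γ k j q v := by
  have : a γ j k = a γ k j := funext fun z => a_symm γ j k z
  rw [abarD, this, abarD]

theorem bil_abarD_nonneg {γ : ℝ} (hγ : 0 ≤ γ) (v : E3) (ξ : Fin 3 → ℝ) :
    0 ≤ bil (fun j k => abarD γ j k 0 v) ξ ξ := by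
  obtain ⟨c, hc, h⟩ := En_le_bil_abarD hγ
  exact (mul_nonneg hc.le (En_nonneg γ v ξ)).trans (h v ξ)

theorem sig_nonneg (u : Sch) (x v : E3) : 0 ≤ sig hγ u x v := by
  rw [sig_app]
  exact add_nonneg (bil_abarD_nonneg hγ _ _) (bil_abarD_nonneg hγ _ _)

theorem bil_Am_le (u : Sch) (x v : E3) : bil (fun j k => abarD γ j k 0 v)
    (fun j => Am j u x v) (fun j => Am j u x v) ≤ 2 * sig hγ u x v := by
  have h := bil_add_sub (fun j k => abarD γ j k 0 v) (fun j => V j u x v) (fun j => D j u x v)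
  have h2 := bil_abarD_nonneg hγ v (fun j => V j u x v - D j u x v)
  rw [sig_app]
  change bil _ (fun j => V j u x v + D j u x v) (fun j => V j u x v + D j u x v) ≤ _
  linarith

theorem mul_comm' (u w : Sch) : mul u w = mul w u := by
  ext x v; simp [mul_comm]

theorem int_mul_Ap (L : ℝ) (j : Fin 3) (u w : Sch) :
    int L (mul (Ap j u) w) = int L (mul u (Am j w)) := by
  have h := int_D L j (mul u w)
  have h2 : mul (V j u) w = mul u (V j w) := by
    rw [V, wt_mul, mul_wt]
  rw [D_mul, map_add] at h
  simp only [Ap, Am, LinearMap.sub_apply, LinearMap.add_apply, map_sub, map_add, h2]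
  linarith

/-- An uncertainty principle: ‖A_+ u‖² = ‖A_- u‖² + ‖u‖² by the commutation relation, while ‖A_+ u‖²
+ ‖A_- u‖² is twice the right-hand integral. It controls u near v = 0, where the weight |v|²
vanishes. -/
theorem int_sq_le (L : ℝ) (u : Sch) :
    int L (mul u u) ≤ 2 * int L (mul (D 0 u) (D 0 u) + mul (V 0 u) (V 0 u)) := by
  have h1 : int L (mul (Ap 0 u) (Ap 0 u)) = int L (mul (Am 0 u) (Am 0 u)) + int L (mul u u) := by
    have h := LinearMap.congr_fun (Am_Ap 0 0) u
    simp only [Module.End.mul_apply, if_true, LinearMap.add_apply, Module.End.one_apply] at h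
    rw [int_mul_Ap, h, map_add, map_add, mul_comm' u (Ap 0 _), int_mul_Ap]
  have h2 : (2 : ℝ) • (mul (D 0 u) (D 0 u) + mul (V 0 u) (V 0 u)) =
      mul (Ap 0 u) (Ap 0 u) + mul (Am 0 u) (Am 0 u) := by
    ext x v
    simp only [Ap, Am, smul_app, add_app, mul_app, sub_app, LinearMap.sub_apply,
      LinearMap.add_apply]
    ring
  have h3 : 0 ≤ int L (mul (Am 0 u) (Am 0 u)) := by
    have := int_mono L (u := 0) (w := mul (Am 0 u) (Am 0 u)) fun x v => by
      simpa using mul_self_nonneg _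
    simpa using this
  have h4 := congrArg (int L) h2
  rw [map_smul, map_add _ (mul (Ap 0 u) (Ap 0 u)), h1, smul_eq_mul] at h4
  linarith

/-- For |v| ≤ 1 the weight is bounded and `int_sq_le` suffices; for |v| ≥ 1 it is comparable to |v|²
⟨v⟩^γ, which is visible in the σ norm. -/
theorem W_rpow_succ_le {γ : ℝ} (hγ : 0 ≤ γ) (v : E3) :
    W v ^ (γ / 2 + 1) ≤ 2 ^ (γ / 2) + 2 * (‖v‖ ^ 2 * W v ^ (γ / 2)) := by
  have hW := W_pos v
  have h1 : W v ^ (γ / 2) ≤ 2 ^ (γ / 2) + ‖v‖ ^ 2 * W v ^ (γ / 2) := by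
    rcases le_total (‖v‖ ^ 2) 1 with h | h
    · have : W v ^ (γ / 2) ≤ 2 ^ (γ / 2) := by
        apply Real.rpow_le_rpow hW.le _ (by positivity)
        unfold W
        linarith
      have : 0 ≤ ‖v‖ ^ 2 * W v ^ (γ / 2) := by positivity
      linarith
    · have h2 : W v ^ (γ / 2) ≤ ‖v‖ ^ 2 * W v ^ (γ / 2) := le_mul_of_one_le_left (by positivity) h
      have : (0 : ℝ) ≤ 2 ^ (γ / 2) := by positivity
      linarith
  rw [Real.rpow_add hW, Real.rpow_one]
  have : W v ^ (γ / 2) * W v = W v ^ (γ / 2) + ‖v‖ ^ 2 * W v ^ (γ / 2) := by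
    nth_rewrite 2 [W]; ring
  linarith

theorem nsq_add_le_sig : ∃ C : ℝ, 0 < C ∧ ∀ (u : Sch) (x v : E3),
    D 0 u x v ^ 2 + V 0 u x v ^ 2 ≤ C * sig hγ u x v ∧
    ‖v‖ ^ 2 * W v ^ (γ / 2) * u x v ^ 2 ≤ C * sig hγ u x v := by
  obtain ⟨c, hc, h⟩ := En_le_bil_abarD hγ
  have key : ∀ (u : Sch) (x v : E3), nsq (fun j => D j u x v) +
      W v ^ (γ / 2) * nsq (fun j => V j u x v) ≤ c⁻¹ * sig hγ u x v := by
    intro u x v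
    have hW := one_le_W v
    have hWg : 1 ≤ W v ^ (γ / 2) := Real.one_le_rpow hW (by positivity)
    have e1 := h v (fun j => D j u x v)
    have e2 := h v (fun j => V j u x v)
    rw [inv_mul_eq_div, le_div_iff₀ hc, sig_app]
    have e3 : nsq (fun j => D j u x v) ≤ En γ v (fun j => D j u x v) := by
      unfold En
      nlinarith [nsq_nonneg (fun j => D j u x v), cr_nonneg v (fun j => D j u x v)]
    have e4 : W v ^ (γ / 2) * nsq (fun j => V j u x v) ≤ En γ v (fun j => V j u x v) := by
      unfold En
      have := cr_nonneg v (fun j => V j u x v)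
      gcongr
      linarith
    nlinarith
  -- The factor 4 undoes the square of the 1/2 in v_j / 2.
  refine ⟨4 * c⁻¹, by positivity, fun u x v => ?_⟩
  have hk := key u x v
  have hW := one_le_W v
  have hWg : 1 ≤ W v ^ (γ / 2) := Real.one_le_rpow hW (by positivity)
  have e1 : nsq (fun j => V j u x v) = ‖v‖ ^ 2 * u x v ^ 2 / 4 := by
    rw [norm_sq_eq_coord]
    simp only [nsq, V, wt_app]
    ring
  have e2 := nsq_nonneg (fun j => D j u x v)
  have e3 := nsq_nonneg (fun j => V j u x v)
  have e4 : 0 ≤ c⁻¹ * sig hγ u x v := mul_nonneg (inv_pos.2 hc).le (sig_nonneg hγ u x v)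
  have e5 : nsq (fun j => V j u x v) ≤ W v ^ (γ / 2) * nsq (fun j => V j u x v) :=
    le_mul_of_one_le_left e3 hWg
  constructor
  · have e6 : D 0 u x v ^ 2 ≤ nsq (fun j => D j u x v) := by
      unfold nsq; nlinarith [sq_nonneg (D 1 u x v), sq_nonneg (D 2 u x v)]
    have e7 : V 0 u x v ^ 2 ≤ nsq (fun j => V j u x v) := by
      unfold nsq; nlinarith [sq_nonneg (V 1 u x v), sq_nonneg (V 2 u x v)]
    linarith
  · rw [e1] at hk
    nlinarith

/-- The `σ` norm controls `⟨v⟩^{γ/2+1} u` in `L²`. -/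
theorem coercive : ∃ C : ℝ, 0 < C ∧ ∀ (L : ℝ) (u : Sch),
    int L (wt _ (W_rpow_temp (γ / 2 + 1)) (mul u u)) ≤ C * int L (sig hγ u) := by
  obtain ⟨C, hC, h⟩ := nsq_add_le_sig hγ
  refine ⟨2 ^ (γ / 2) * (2 * C) + 2 * C, by positivity, fun L u => ?_⟩
  have h1 : int L (wt _ (W_rpow_temp (γ / 2 + 1)) (mul u u)) ≤
      int L ((2 : ℝ) ^ (γ / 2) • mul u u + (2 * C) • sig hγ u) := by
    refine int_mono L fun x v => ?_
    simp only [wt_app, mul_app, add_app, smul_app]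
    have e1 := mul_le_mul_of_nonneg_right (W_rpow_succ_le hγ v) (mul_self_nonneg (u x v))
    have e2 := (h u x v).2
    nlinarith
  have h2 := int_sq_le L u
  have h3 : int L (mul (D 0 u) (D 0 u) + mul (V 0 u) (V 0 u)) ≤ int L (C • sig hγ u) := by
    refine int_mono L fun x v => ?_
    simp only [mul_app, add_app, smul_app, ← sq]
    exact (h u x v).1
  rw [map_add, map_smul, map_smul, smul_eq_mul, smul_eq_mul] at h1
  rw [map_smul, smul_eq_mul] at h3
  have h4 : (2 : ℝ) ^ (γ / 2) * int L (mul u u) ≤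
      2 ^ (γ / 2) * (2 * (C * int L (sig hγ u))) := by
    gcongr
    linarith
  linarith

/-- Integration by parts after writing u ∂_j u = ∂_j(u²)/2. -/
theorem int_bco (L : ℝ) (j k : Fin 3) (u : Sch) :
    ∃ (hb : Function.HasTemperateGrowth
      fun v => fderiv ℝ (bco γ j k) v (EuclideanSpace.single j 1)),
      int L (wt _ (bco_temp hγ j k) (mul u (D j u))) = -(1 / 2) * int L (wt _ hb (mul u u)) := by
  have hb : Function.HasTemperateGrowth
      fun v => fderiv ℝ (bco γ j k) v (EuclideanSpace.single j 1) := by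
    have : (fun v => fderiv ℝ (bco γ j k) v (EuclideanSpace.single j 1)) =
        conv (a γ j k) (D j (vmu k)) :=
      funext fun v => fderiv_conv (polyGrowth_a hγ j k) _ _ _
    rw [this]
    exact conv_temp (polyGrowth_a hγ j k) _
  refine ⟨hb, ?_⟩
  have h := int_D L j (wt _ (bco_temp hγ j k) (mul u u))
  have h2 := LinearMap.congr_fun (D_wt j (bco_temp hγ j k) hb fun v => rfl) (mul u u)
  rw [Module.End.mul_apply, LinearMap.add_apply, Module.End.mul_apply, D_mul,
    mul_comm' (D j u) u, map_add] at h2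
  rw [h2, map_add, map_add] at h
  linarith

/-- Expanding the square, the symmetry of ā merges the two cross terms into Σ ā_{jk} v_k u ∂_j u,
and `sum_bco` trades ā v for the drift coefficient. -/
theorem bil_Am_eq (u : Sch) (x v : E3) : bil (fun j k => abarD γ j k 0 v)
    (fun j => Am j u x v) (fun j => Am j u x v) = sig hγ u x v +
      ∑ j, ∑ k, bco γ j k v * (u x v * D j u x v) := by
  have h1 : ∑ j, ∑ k, bco γ j k v * (u x v * D j u x v) =
      ∑ j, (∑ k, abarD γ j k 0 v * v k) * (u x v * D j u x v) := by
    refine Finset.sum_congr rfl fun j _ => ?_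
    rw [← sum_bco hγ, Finset.sum_mul]
  rw [h1, sig_app]
  simp only [bil, Am, LinearMap.add_apply, add_app, V, wt_app, Fin.sum_univ_three]
  rw [abarD_symm 1 0, abarD_symm 2 0, abarD_symm 2 1]
  ring

theorem W_young {e : ℝ} (he : 0 < e) (v : E3) : W v ^ ((γ + 1) / 2) ≤
    e * W v ^ (γ / 2 + 1) + e⁻¹ * W v ^ (γ / 2) := by
  have hW := W_pos v
  have h1 : W v ^ ((γ + 1) / 2) = W v ^ (γ / 2) * W v ^ (1 / 2 : ℝ) := by
    rw [← Real.rpow_add hW]; congr 1; ring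
  have h2 : W v ^ (1 / 2 : ℝ) ≤ e * W v + e⁻¹ := by
    have h := abs_mul_le_young he (W v ^ (1 / 2 : ℝ)) 1
    have h3 : (W v ^ (1 / 2 : ℝ)) ^ 2 = W v := by
      rw [← Real.rpow_natCast, ← Real.rpow_mul hW.le]; norm_num
    rw [mul_one, h3, abs_of_nonneg (by positivity)] at h
    have : 0 < e⁻¹ := inv_pos.2 he
    have : 0 < e * W v := by positivity
    linarith
  rw [h1, Real.rpow_add hW, Real.rpow_one]
  have := mul_le_mul_of_nonneg_left h2 (by positivity : 0 ≤ W v ^ (γ / 2))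
  linarith

/-- Coercivity of the main term. -/
theorem main_term : ∃ C : ℝ, 0 < C ∧ ∀ (L : ℝ) (u : Sch),
    3 / 4 * int L (sig hγ u) - C * int L (wt _ (W_rpow_temp (γ / 2)) (mul u u)) ≤
      ∑ j, ∑ k, int L (wt _ (abarD_temp hγ j k 0) (mul (Am k u) (Am j u))) := by
  obtain ⟨C₁, hC₁, h₁⟩ := abs_fderiv_bco_le hγ
  obtain ⟨C₂, hC₂, h₂⟩ := coercive hγ
  -- Nine index pairs, each with the 1/2 from integration by parts, give 9/2; this `e` makes the
  -- absorbed part exactly a quarter of the σ norm.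
  set e : ℝ := (1 / 4) / (9 / 2 * C₁ * C₂) with he
  have he0 : 0 < e := by positivity
  refine ⟨9 / 2 * C₁ * e⁻¹, by positivity, fun L u => ?_⟩
  set Y := int L (wt _ (W_rpow_temp ((γ + 1) / 2)) (mul u u)) with hY
  have hterm : ∀ j k, -(1 / 2 * C₁ * Y) ≤ int L (wt _ (bco_temp hγ j k) (mul u (D j u))) := by
    intro j k
    obtain ⟨hb, h⟩ := int_bco hγ L j k u
    rw [h]
    have : int L (wt _ hb (mul u u)) ≤
        int L (C₁ • wt _ (W_rpow_temp ((γ + 1) / 2)) (mul u u)) := by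
      refine int_mono L fun x v => ?_
      simp only [wt_app, mul_app, smul_app]
      rw [← mul_assoc C₁]
      exact mul_le_mul_of_nonneg_right ((le_abs_self _).trans (h₁ j k j v)) (mul_self_nonneg _)
    rw [map_smul, smul_eq_mul, ← hY] at this
    linarith
  have heq : ∑ j, ∑ k, int L (wt _ (abarD_temp hγ j k 0) (mul (Am k u) (Am j u))) =
      int L (sig hγ u) + ∑ j, ∑ k, int L (wt _ (bco_temp hγ j k) (mul u (D j u))) := by
    simp only [← map_sum]
    rw [← map_add]
    congr 1
    ext x v
    have h := bil_Am_eq hγ u x v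
    simp only [sum_app, add_app, wt_app, mul_app]
    rw [← h, bil]
    exact Finset.sum_congr rfl fun j _ => Finset.sum_congr rfl fun k _ => by ring
  have hsum : -(9 / 2 * C₁ * Y) ≤
      ∑ j, ∑ k, int L (wt _ (bco_temp hγ j k) (mul u (D j u))) := by
    calc -(9 / 2 * C₁ * Y) = ∑ _j : Fin 3, ∑ _k : Fin 3, -(1 / 2 * C₁ * Y) := by
          simp only [Finset.sum_const, Finset.card_univ, Fintype.card_fin, nsmul_eq_mul]
          push_cast
          ring
      _ ≤ _ := Finset.sum_le_sum fun j _ => Finset.sum_le_sum fun k _ => hterm j k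
  have hYle : Y ≤ e * int L (wt _ (W_rpow_temp (γ / 2 + 1)) (mul u u)) +
      e⁻¹ * int L (wt _ (W_rpow_temp (γ / 2)) (mul u u)) := by
    have h := int_mono L (u := wt _ (W_rpow_temp ((γ + 1) / 2)) (mul u u))
      (w := e • wt _ (W_rpow_temp (γ / 2 + 1)) (mul u u) +
        e⁻¹ • wt _ (W_rpow_temp (γ / 2)) (mul u u)) fun x v => by
      simp only [wt_app, mul_app, smul_app, add_app]
      have := mul_le_mul_of_nonneg_right (W_young (γ := γ) he0 v) (mul_self_nonneg (u x v))
      linarith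
    rwa [map_add, map_smul, map_smul] at h
  have h3 := h₂ L u
  have h4 : 9 / 2 * C₁ * (e * int L (wt _ (W_rpow_temp (γ / 2 + 1)) (mul u u))) ≤
      1 / 4 * int L (sig hγ u) := by
    calc _ ≤ 9 / 2 * C₁ * (e * (C₂ * int L (sig hγ u))) := by gcongr
      _ = _ := by
        rw [he]
        field_simp
  have h5 : 9 / 2 * C₁ * Y ≤ 9 / 2 * C₁ * (e * int L (wt _ (W_rpow_temp (γ / 2 + 1)) (mul u u)) +
      e⁻¹ * int L (wt _ (W_rpow_temp (γ / 2)) (mul u u))) := by gcongr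
  rw [heq]
  linarith

/-! ### Bounds for the pairings with differentiated coefficients -/

theorem En_Am_le : ∃ C : ℝ, 0 < C ∧ ∀ (u : Sch) (x v : E3),
    En γ v (fun j => Am j u x v) ≤ C * sig hγ u x v := by
  obtain ⟨c, hc, h⟩ := En_le_bil_abarD hγ
  refine ⟨2 * c⁻¹, by positivity, fun u x v => ?_⟩
  have h1 := h v (fun j => Am j u x v)
  have h2 := bil_Am_le hγ u x v
  have h3 : En γ v (fun j => Am j u x v) ≤ c⁻¹ * (2 * sig hγ u x v) := by
    rw [inv_mul_eq_div, le_div_iff₀ hc]; linarith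
  linarith

/-- Bound of the terms with two annihilation operators. -/
theorem cross_term : ∃ C : ℝ, 0 < C ∧ ∀ (L : ℝ) (q : ℕ) (G F : Sch) (l : ℝ), 0 < l →
    -(C * Real.sqrt q.factorial * (l * int L (sig hγ G) + l⁻¹ * int L (sig hγ F))) ≤
      ∑ j, ∑ k, int L (wt _ (abarD_temp hγ j k q) (mul (Am k G) (Am j F))) := by
  obtain ⟨C, hC, h⟩ := abs_bil_abarD_le hγ
  obtain ⟨c, hc, hle⟩ := En_Am_le hγ
  refine ⟨C * c, by positivity, fun L q G F l hl => ?_⟩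
  simp only [← map_sum]
  rw [← smul_eq_mul l, ← smul_eq_mul l⁻¹, ← map_smul, ← map_smul, ← map_add, ← smul_eq_mul,
    ← map_smul, ← map_neg]
  refine int_mono L fun x v => ?_
  -- The inverse parameter appears because `F` occupies the first slot of the form.
  have h1 := h q v (fun j => Am j F x v) (fun j => Am j G x v) l⁻¹ (inv_pos.2 hl)
  rw [inv_inv] at h1
  have h2 : (∑ j, ∑ k, wt _ (abarD_temp hγ j k q) (mul (Am k G) (Am j F)) : Sch) x v =
      bil (fun j k => abarD γ j k q v) (fun j => Am j F x v) (fun j => Am j G x v) := by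
    simp only [sum_app, wt_app, mul_app, bil]
    exact Finset.sum_congr rfl fun j _ => Finset.sum_congr rfl fun k _ => by ring
  have h3 := mul_le_mul_of_nonneg_left (hle G x v) hl.le
  have h4 := mul_le_mul_of_nonneg_left (hle F x v) (inv_pos.2 hl).le
  have h5 : C * Real.sqrt q.factorial * (l⁻¹ * En γ v (fun j => Am j F x v) +
      l * En γ v (fun j => Am j G x v)) ≤ C * Real.sqrt q.factorial *
        (c * (l * sig hγ G x v + l⁻¹ * sig hγ F x v)) := by
    gcongr
    linarith
  rw [h2]
  simp only [neg_app, smul_app, add_app]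
  have h6 := (abs_le.1 (h1.trans h5)).1
  linarith

/-- Bound of the terms with one annihilation operator. -/
theorem cross_term_zero : ∃ C : ℝ, 0 < C ∧ ∀ (L : ℝ) (q : ℕ) (G F : Sch) (l : ℝ), 0 < l →
    -(C * Real.sqrt q.factorial * (l * int L (sig hγ G) + l⁻¹ * int L (sig hγ F))) ≤
      ∑ j, int L (wt _ (abarD_temp hγ j 0 q) (mul G (Am j F))) := by
  obtain ⟨C, hC, h⟩ := abs_bil_abarD_le hγ
  obtain ⟨c, hc, hle⟩ := En_Am_le hγ
  obtain ⟨C₂, hC₂, h₂⟩ := coercive hγ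
  refine ⟨C * (c + C₂), by positivity, fun L q G F l hl => ?_⟩
  set T := wt _ (W_rpow_temp (γ / 2 + 1)) (mul G G) with hT
  -- The lost annihilation operator leaves the vector (G, 0, 0). Since |v × ξ|² ≤ |v|² |ξ|², its
  -- weighted form is at most ⟨v⟩^{γ+2} G², to which `coercive` applies.
  have hG : ∀ x v : E3, En γ v (fun j => if j = 0 then G x v else 0) ≤ T x v := by
    intro x v
    have hW := W_pos v
    have e1 : nsq (fun j => if j = 0 then G x v else 0) = G x v ^ 2 := by
      simp [nsq]
    have e2 := cr_le v (fun j => if j = 0 then G x v else 0)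
    rw [e1] at e2
    rw [En, e1, hT, wt_app, mul_app, Real.rpow_add hW, Real.rpow_one, ← sq, mul_assoc]
    gcongr
    unfold W
    linarith
  have hmain : -(C * Real.sqrt q.factorial * (l * int L T + l⁻¹ * (c * int L (sig hγ F)))) ≤
      ∑ j, int L (wt _ (abarD_temp hγ j 0 q) (mul G (Am j F))) := by
    have he : -(C * Real.sqrt q.factorial * (l * int L T + l⁻¹ * (c * int L (sig hγ F)))) =
        int L (-((C * Real.sqrt q.factorial) • (l • T + l⁻¹ • c • sig hγ F))) := by
      rw [map_neg, map_smul, map_add, map_smul, map_smul, map_smul]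
      rfl
    rw [he, ← map_sum]
    refine int_mono L fun x v => ?_
    have h1 := h q v (fun j => Am j F x v) (fun j => if j = 0 then G x v else 0) l⁻¹ (inv_pos.2 hl)
    rw [inv_inv] at h1
    have h2 : (∑ j, wt _ (abarD_temp hγ j 0 q) (mul G (Am j F)) : Sch) x v =
        bil (fun j k => abarD γ j k q v) (fun j => Am j F x v)
          (fun j => if j = 0 then G x v else 0) := by
      simp only [sum_app, wt_app, mul_app, bil]
      refine Finset.sum_congr rfl fun j _ => ?_
      simp
      ring
    have h3 := mul_le_mul_of_nonneg_left (hG x v) hl.le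
    have h4 := mul_le_mul_of_nonneg_left (hle F x v) (inv_pos.2 hl).le
    have h5 : C * Real.sqrt q.factorial * (l⁻¹ * En γ v (fun j => Am j F x v) +
        l * En γ v (fun j => if j = 0 then G x v else 0)) ≤ C * Real.sqrt q.factorial *
          (l * T x v + l⁻¹ * (c * sig hγ F x v)) := by
      exact mul_le_mul_of_nonneg_left (by linarith) (by positivity)
    rw [h2]
    simp only [neg_app, smul_app, add_app]
    exact (abs_le.1 (h1.trans h5)).1
  refine le_trans (neg_le_neg ?_) hmain
  have hnn : ∀ u : Sch, 0 ≤ int L (sig hγ u) := fun u => by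
    have := int_mono L (u := 0) (w := sig hγ u) fun x v => by simpa using sig_nonneg hγ u x v
    simpa using this
  have e1 : l * int L T ≤ l * (C₂ * int L (sig hγ G)) := by
    gcongr
    exact h₂ L G
  have e2 : 0 ≤ l * (c * int L (sig hγ G)) := by
    have := hnn G
    positivity
  have e3 : 0 ≤ l⁻¹ * (C₂ * int L (sig hγ F)) := by
    have := hnn F
    positivity
  calc _ ≤ C * Real.sqrt q.factorial *
        ((c + C₂) * (l * int L (sig hγ G) + l⁻¹ * int L (sig hγ F))) := by
        gcongr
        linarith
    _ = _ := by ring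

end Sch

/-! ### Optimisation of the parameter and summation identities -/

theorem neg_sqrt_mul_sqrt_le {K a b X : ℝ} (hK : 0 ≤ K) (ha : 0 ≤ a) (hb : 0 ≤ b)
    (h : ∀ l : ℝ, 0 < l → -(K * (l * a + l⁻¹ * b)) ≤ X) :
    -(2 * K * Real.sqrt a * Real.sqrt b) ≤ X := by
  set p := Real.sqrt a with hp
  set r := Real.sqrt b with hr
  have hp0 : 0 ≤ p := Real.sqrt_nonneg a
  have hr0 : 0 ≤ r := Real.sqrt_nonneg b
  have hpa : a = p * p := (Real.mul_self_sqrt ha).symm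
  have hrb : b = r * r := (Real.mul_self_sqrt hb).symm
  have key : ∀ e : ℝ, 0 < e → -(K * (2 * (p * r) + e * (p + r))) ≤ X := by
    intro e he
    -- The optimal parameter is r/p; shifting both by `e` keeps it positive and finite when a norm
    -- vanishes, and `e` then tends to 0.
    refine le_trans ?_ (h ((r + e) / (p + e)) (by positivity))
    have h1 : (r + e) / (p + e) * a ≤ (r + e) * p := by
      rw [hpa, div_mul_eq_mul_div, div_le_iff₀ (by positivity), mul_assoc]
      have : 0 ≤ (r + e) * p * e := by positivity
      nlinarith
    have h2 : ((r + e) / (p + e))⁻¹ * b ≤ (p + e) * r := by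
      rw [inv_div, hrb, div_mul_eq_mul_div, div_le_iff₀ (by positivity), mul_assoc]
      have : 0 ≤ (p + e) * r * e := by positivity
      nlinarith
    refine neg_le_neg (mul_le_mul_of_nonneg_left ?_ hK)
    linarith
  refine le_of_forall_pos_le_add fun d hd => ?_
  have hk := key (d / (K * (p + r) + 1)) (by positivity)
  have h3 : K * (d / (K * (p + r) + 1) * (p + r)) ≤ d := by
    rw [div_mul_eq_mul_div, mul_div_assoc', div_le_iff₀ (by positivity)]
    nlinarith
  linarith

/-- The identity (n-p) C(n,p) = (p+1) C(n,p+1) followed by a shift of index; the unmatched terms p =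
n on the left and p = 0 on the right both vanish. -/
theorem sum_range_choose_mul_sub (n : ℕ) (s : ℝ) (g : ℕ → ℝ) :
    ∑ p ∈ Finset.range (n + 1), (n.choose p : ℝ) * s ^ p * (((n - p : ℕ) : ℝ) * s * g (p + 1)) =
      ∑ p ∈ Finset.range (n + 1), (n.choose p : ℝ) * s ^ p * (p * g p) := by
  rw [Finset.sum_range_succ, Finset.sum_range_succ']
  simp only [Nat.sub_self, Nat.cast_zero, zero_mul, mul_zero, add_zero]
  refine Finset.sum_congr rfl fun p _ => ?_
  have h : (n.choose (p + 1) : ℝ) * ((p + 1 : ℕ) : ℝ) = n.choose p * ((n - p : ℕ) : ℝ) := by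
    exact_mod_cast Nat.choose_succ_right_eq n p
  rw [pow_succ]
  linear_combination (-(s ^ p * s * g (p + 1))) * h

theorem sum_range_succ_eq_Icc (n : ℕ) (f : ℕ → ℝ) :
    ∑ p ∈ Finset.range (n + 1), f p = f 0 + ∑ p ∈ Finset.Icc 1 n, f p := by
  rw [Finset.range_eq_Ico, Finset.sum_eq_sum_Ico_succ_bot (Nat.succ_pos n)]
  congr 1

theorem sumLeTwo_mono {F G : (Fin 3 → ℕ) → ℝ} (h : ∀ α, F α ≤ G α) : sumLeTwo F ≤ sumLeTwo G :=
  Finset.sum_le_sum fun _ _ => Finset.sum_le_sum fun α _ => h α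

theorem sumLeTwo_add (F G : (Fin 3 → ℕ) → ℝ) :
    sumLeTwo (fun α => F α + G α) = sumLeTwo F + sumLeTwo G := by
  simp only [sumLeTwo, Finset.sum_add_distrib]

theorem sumLeTwo_mul (c : ℝ) (F : (Fin 3 → ℕ) → ℝ) :
    sumLeTwo (fun α => c * F α) = c * sumLeTwo F := by
  simp only [sumLeTwo, Finset.mul_sum]

theorem sumLeTwo_sum {ι : Type*} (s : Finset ι) (F : ι → (Fin 3 → ℕ) → ℝ) :
    sumLeTwo (fun α => ∑ i ∈ s, F i α) = ∑ i ∈ s, sumLeTwo (F i) := by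
  induction s using Finset.cons_induction with
  | empty => simp [sumLeTwo]
  | cons a s ha ih => simp only [Finset.sum_cons, sumLeTwo_add, ih]

/-! ### Norms as sums over multi-indices and expansion of the scalar product -/

namespace Sch

variable {γ : ℝ} (hγ : 0 ≤ γ)

theorem innerH2_eq (L : ℝ) (u w : Sch) :
    innerH2 L u w = sumLeTwo fun α => int L (mul (Xα α u) (Xα α w)) := by
  simp only [innerH2, dxα_eq]
  rfl

/-- `|||u|||²_{H²_x, σ}`. -/
def sigH (L : ℝ) (u : Sch) : ℝ := sumLeTwo fun α => int L (sig hγ (Xα α u))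

theorem int_nonneg (L : ℝ) {u : Sch} (h : ∀ x v, 0 ≤ u x v) : 0 ≤ int L u := by
  have := int_mono L (u := 0) (w := u) fun x v => by simpa using h x v
  simpa using this

theorem sumLeTwo_nonneg {F : (Fin 3 → ℕ) → ℝ} (h : ∀ α, 0 ≤ F α) : 0 ≤ sumLeTwo F :=
  Finset.sum_nonneg fun _ _ => Finset.sum_nonneg fun α _ => h α

theorem sigH_nonneg (L : ℝ) (u : Sch) : 0 ≤ sigH hγ L u :=
  sumLeTwo_nonneg fun _ => int_nonneg L fun x v => sig_nonneg hγ _ x v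

theorem normSigma_eq (L : ℝ) (u : Sch) : normSigma L γ u = Real.sqrt (sigH hγ L u) := by
  simp only [normSigma, dxα_eq, sigmaSq_eq hγ]
  rfl

theorem jap_eq (v : E3) : jap v ^ (γ / 2) = W v ^ (γ / 4) := by
  rw [jap, Real.sqrt_eq_rpow, W, ← Real.rpow_mul (by positivity)]
  congr 1
  ring

theorem normH2_sq_eq (L : ℝ) (u : Sch) : normH2 L (fun x v => jap v ^ (γ / 2) * u x v) ^ 2 =
    sumLeTwo fun α => int L (wt _ (W_rpow_temp (γ / 2)) (mul (Xα α u) (Xα α u))) := by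
  have h1 : (fun x v => jap v ^ (γ / 2) * u x v) = (wt _ (W_rpow_temp (γ / 4)) u : Sch) := by
    funext x v
    rw [jap_eq, wt_app]
  have h2 : innerH2 L (wt _ (W_rpow_temp (γ / 4)) u : Sch) (wt _ (W_rpow_temp (γ / 4)) u : Sch) =
      sumLeTwo fun α => int L (wt _ (W_rpow_temp (γ / 2)) (mul (Xα α u) (Xα α u))) := by
    rw [innerH2_eq]
    congr 1
    funext α
    have h3 := Xα_comm_app (fun j => X_wt_comm j _ (W_rpow_temp (γ / 4))) α u
    rw [h3]
    congr 1
    ext x v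
    have h4 : W v ^ (γ / 2) = W v ^ (γ / 4) * W v ^ (γ / 4) := by
      rw [← Real.rpow_add (W_pos v)]; congr 1; ring
    simp only [mul_app, wt_app, h4]
    ring
  rw [normH2, h1, Real.sq_sqrt, h2]
  rw [h2]
  refine sumLeTwo_nonneg fun α => int_nonneg L fun x v => ?_
  exact mul_nonneg (Real.rpow_nonneg (W_pos v).le _) (mul_self_nonneg _)

/-- The pairing `∑ ∫ (∂_1^q ā_{jk}) A_{-,k} G A_{-,j} F`. -/
def pair (L : ℝ) (q : ℕ) (G F : Sch) : ℝ :=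
  ∑ j, ∑ k, int L (wt _ (abarD_temp hγ j k q) (mul (Am k G) (Am j F)))

/-- The pairing `∑ ∫ (∂_1^q ā_{j1}) G A_{-,j} F`. -/
def pairZero (L : ℝ) (q : ℕ) (G F : Sch) : ℝ :=
  ∑ j, int L (wt _ (abarD_temp hγ j 0 q) (mul G (Am j F)))

theorem X_Lop_comm (i : Fin 3) : Commute (X i) (Lop γ hγ) := by
  refine Commute.sum_right _ _ _ fun j _ => Commute.sum_right _ _ _ fun k _ => ?_
  exact (X_Ap_comm i j).mul_right ((X_wt_comm i _ _).mul_right (X_Am_comm i k))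

variable (c₁ s₁ c₂ s₂ : ℝ)

/-- The outer creation operator commutes with both fields, so only the coefficient is differentiated
here; the annihilation operator is commuted later. -/
theorem HP_Lop (m n : ℕ) (g : Sch) : HP c₁ s₁ c₂ s₂ m n (Lop γ hγ g) =
    ∑ l ∈ Finset.range (m + 1), ∑ p ∈ Finset.range (n + 1),
      ((m.choose l : ℝ) * s₁ ^ l * ((n.choose p : ℝ) * s₂ ^ p)) • ∑ j, ∑ k,
        Ap j (wt _ (abarD_temp hγ j k (l + p)) (HP c₁ s₁ c₂ s₂ (m - l) (n - p) (Am k g))) := by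
  have h : ∀ j k, HP c₁ s₁ c₂ s₂ m n (Ap j (wt _ (abarD_temp hγ j k 0) (Am k g))) =
      ∑ l ∈ Finset.range (m + 1), ∑ p ∈ Finset.range (n + 1),
        ((m.choose l : ℝ) * s₁ ^ l * ((n.choose p : ℝ) * s₂ ^ p)) •
          Ap j (wt _ (abarD_temp hγ j k (l + p)) (HP c₁ s₁ c₂ s₂ (m - l) (n - p) (Am k g))) := by
    intro j k
    have h1 := LinearMap.congr_fun (HP_Ap c₁ s₁ c₂ s₂ m n j)
      (wt _ (abarD_temp hγ j k 0) (Am k g))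
    have h2 := LinearMap.congr_fun (HP_wt c₁ s₁ c₂ s₂ (abarD_temp hγ j k)
      (fderiv_abarD hγ j k) m n) (Am k g)
    rw [Module.End.mul_apply, Module.End.mul_apply] at h1
    rw [Module.End.mul_apply] at h2
    rw [h1, h2]
    simp only [LinearMap.sum_apply, LinearMap.smul_apply, map_sum, map_smul, Module.End.mul_apply]
  rw [Lop_apply]
  simp only [map_sum, h, Finset.smul_sum]
  have h2 : ∀ (T : Fin 3 → ℕ → ℕ → Sch), ∑ k, ∑ l ∈ Finset.range (m + 1),
      ∑ p ∈ Finset.range (n + 1), T k l p =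
      ∑ l ∈ Finset.range (m + 1), ∑ p ∈ Finset.range (n + 1), ∑ k, T k l p := fun T => by
    rw [Finset.sum_comm]
    exact Finset.sum_congr rfl fun l _ => Finset.sum_comm
  simp only [h2]

/-- The creation operator moves to the second factor as A_{-,j}, and `HP_Am` brings A_{-,k} out. Its
scalar commutators survive only for the first index, hence the single sum in `pairZero`. -/
theorem int_HP_Lop (L : ℝ) (m n : ℕ) (g : Sch) :
    int L (mul (HP c₁ s₁ c₂ s₂ m n (Lop γ hγ g)) (HP c₁ s₁ c₂ s₂ m n g)) =
    ∑ l ∈ Finset.range (m + 1), ∑ p ∈ Finset.range (n + 1),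
      ((m.choose l : ℝ) * s₁ ^ l * ((n.choose p : ℝ) * s₂ ^ p)) *
        (pair hγ L (l + p) (HP c₁ s₁ c₂ s₂ (m - l) (n - p) g) (HP c₁ s₁ c₂ s₂ m n g) +
          (((n - p : ℕ) : ℝ) * s₂ * pairZero hγ L (l + p) (HP c₁ s₁ c₂ s₂ (m - l) (n - p - 1) g)
            (HP c₁ s₁ c₂ s₂ m n g) +
          ((m - l : ℕ) : ℝ) * s₁ * pairZero hγ L (l + p) (HP c₁ s₁ c₂ s₂ (m - l - 1) (n - p) g)
            (HP c₁ s₁ c₂ s₂ m n g))) := by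
  rw [HP_Lop]
  simp only [map_sum, map_smul, LinearMap.sum_apply, LinearMap.smul_apply, smul_eq_mul]
  refine Finset.sum_congr rfl fun l _ => Finset.sum_congr rfl fun p _ => ?_
  congr 1
  set F := HP c₁ s₁ c₂ s₂ m n g
  have h : ∀ j k, int L (mul (Ap j (wt _ (abarD_temp hγ j k (l + p))
      (HP c₁ s₁ c₂ s₂ (m - l) (n - p) (Am k g)))) F) =
      int L (wt _ (abarD_temp hγ j k (l + p))
        (mul (Am k (HP c₁ s₁ c₂ s₂ (m - l) (n - p) g)) (Am j F))) +
      if k = 0 then ((n - p : ℕ) : ℝ) * s₂ * int L (wt _ (abarD_temp hγ j k (l + p))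
          (mul (HP c₁ s₁ c₂ s₂ (m - l) (n - p - 1) g) (Am j F))) +
        ((m - l : ℕ) : ℝ) * s₁ * int L (wt _ (abarD_temp hγ j k (l + p))
          (mul (HP c₁ s₁ c₂ s₂ (m - l - 1) (n - p) g) (Am j F))) else 0 := by
    intro j k
    have h1 := LinearMap.congr_fun (HP_Am c₁ s₁ c₂ s₂ (m - l) (n - p) k) g
    rw [Module.End.mul_apply, LinearMap.add_apply, Module.End.mul_apply] at h1
    rw [int_mul_Ap, wt_mul, h1]
    by_cases hk : k = 0
    · simp only [hk, if_true, LinearMap.add_apply, LinearMap.smul_apply, map_add, map_smul,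
        smul_eq_mul]
    · simp [hk]
  simp only [h, Finset.sum_add_distrib, Finset.sum_ite_eq', Finset.mem_univ, if_true, pair,
    pairZero, Finset.mul_sum]

end Sch

/-! ### Bookkeeping of the binomial sums -/

theorem nat_le_rpow {e : ℝ} (he : 1 ≤ e) (q : ℕ) : (q : ℝ) ≤ (q : ℝ) ^ e := by
  rcases Nat.eq_zero_or_pos q with rfl | hq
  · simp [Real.zero_rpow (by linarith : e ≠ 0)]
  · exact Real.self_le_rpow_of_one_le (by exact_mod_cast hq) he

theorem sqrt_factorial_mono {p q : ℕ} (h : p ≤ q) :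
    Real.sqrt (p.factorial : ℝ) ≤ Real.sqrt (q.factorial : ℝ) :=
  Real.sqrt_le_sqrt (by exact_mod_cast Nat.factorial_le h)

/-- The bookkeeping of the binomial expansion of `(H₁^m H₂^n 𝓛 f, H₁^m H₂^n f)`. -/
theorem binomial_sum_lower_bound {K s₁ s₂ e N₀ M : ℝ} (hK : 0 ≤ K) (hs₁ : 0 ≤ s₁) (hs₂ : 0 ≤ s₂)
    (he : 1 ≤ e) (hN₀ : 0 ≤ N₀) (m n : ℕ) (N A B₁ B₂ : ℕ → ℕ → ℝ) (hN : ∀ i j, 0 ≤ N i j)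
    (hM : M ≤ A 0 0)
    (hA : ∀ l p, -(K * Real.sqrt ((l + p).factorial : ℝ) * N (m - l) (n - p) * N₀) ≤ A l p)
    (hB₂ : ∀ l p, -(K * Real.sqrt ((l + p).factorial : ℝ) * N (m - l) (n - p - 1) * N₀) ≤ B₂ l p)
    (hB₁ : ∀ l p, -(K * Real.sqrt ((l + p).factorial : ℝ) * N (m - l - 1) (n - p) * N₀) ≤ B₁ l p) :
    M - ∑ l ∈ Finset.range (m + 1), ∑ p ∈ Finset.range (n + 1),
        ((m.choose l : ℝ) * s₁ ^ l * ((n.choose p : ℝ) * s₂ ^ p)) *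
          (2 * K * (((l + p : ℕ) : ℝ) ^ e * Real.sqrt ((l + p).factorial : ℝ)
            * N (m - l) (n - p) * N₀)) ≤
      ∑ l ∈ Finset.range (m + 1), ∑ p ∈ Finset.range (n + 1),
        ((m.choose l : ℝ) * s₁ ^ l * ((n.choose p : ℝ) * s₂ ^ p)) *
          (A l p + (((n - p : ℕ) : ℝ) * s₂ * B₂ l p + ((m - l : ℕ) : ℝ) * s₁ * B₁ l p)) := by
  set w : ℕ → ℕ → ℝ := fun l p => (m.choose l : ℝ) * s₁ ^ l * ((n.choose p : ℝ) * s₂ ^ p) with hw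
  have hw0 : ∀ l p, 0 ≤ w l p := fun l p => by positivity
  -- The bound for a pairing with a lost operator after the shift of index, whence (l + p - 1)!. At
  -- l = p = 0 the truncated subtraction is harmless, since `R` is always multiplied by `l` or `p`.
  set R : ℕ → ℕ → ℝ := fun l p =>
    K * Real.sqrt ((l + p - 1).factorial : ℝ) * N (m - l) (n - p) * N₀ with hR
  have hR0 : ∀ l p, 0 ≤ R l p := fun l p =>
    mul_nonneg (mul_nonneg (mul_nonneg hK (Real.sqrt_nonneg _)) (hN _ _)) hN₀
  have h2 : -∑ l ∈ Finset.range (m + 1), ∑ p ∈ Finset.range (n + 1), w l p * (p * R l p) ≤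
      ∑ l ∈ Finset.range (m + 1), ∑ p ∈ Finset.range (n + 1),
        w l p * (((n - p : ℕ) : ℝ) * s₂ * B₂ l p) := by
    rw [← Finset.sum_neg_distrib]
    refine Finset.sum_le_sum fun l _ => ?_
    have h := sum_range_choose_mul_sub n s₂ (R l)
    have h' : ∑ p ∈ Finset.range (n + 1), w l p * (p * R l p) =
        ∑ p ∈ Finset.range (n + 1), w l p * (((n - p : ℕ) : ℝ) * s₂ * R l (p + 1)) := by
      simp only [hw, mul_assoc ((m.choose l : ℝ) * s₁ ^ l), ← Finset.mul_sum, h]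
    rw [h', ← Finset.sum_neg_distrib]
    refine Finset.sum_le_sum fun p _ => ?_
    have h3 := mul_le_mul_of_nonneg_left (hB₂ l p)
      (mul_nonneg (hw0 l p) (mul_nonneg (Nat.cast_nonneg (α := ℝ) (n - p)) hs₂))
    have h4 : R l (p + 1) = K * Real.sqrt ((l + p).factorial : ℝ) * N (m - l) (n - p - 1) * N₀ :=
      rfl
    rw [h4]
    linarith
  have h1 : -∑ l ∈ Finset.range (m + 1), ∑ p ∈ Finset.range (n + 1), w l p * (l * R l p) ≤
      ∑ l ∈ Finset.range (m + 1), ∑ p ∈ Finset.range (n + 1),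
        w l p * (((m - l : ℕ) : ℝ) * s₁ * B₁ l p) := by
    rw [Finset.sum_comm, ← Finset.sum_neg_distrib, Finset.sum_comm (s := Finset.range (m + 1))]
    refine Finset.sum_le_sum fun p _ => ?_
    have h := sum_range_choose_mul_sub m s₁ fun l => R l p
    have hc : ∀ l, w l p = ((n.choose p : ℝ) * s₂ ^ p) * ((m.choose l : ℝ) * s₁ ^ l) :=
      fun l => mul_comm _ _
    have h' : ∑ l ∈ Finset.range (m + 1), w l p * (l * R l p) =
        ∑ l ∈ Finset.range (m + 1), w l p * (((m - l : ℕ) : ℝ) * s₁ * R (l + 1) p) := by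
      simp only [hc, mul_assoc ((n.choose p : ℝ) * s₂ ^ p), ← Finset.mul_sum, h]
    rw [h', ← Finset.sum_neg_distrib]
    refine Finset.sum_le_sum fun l _ => ?_
    have h3 := mul_le_mul_of_nonneg_left (hB₁ l p)
      (mul_nonneg (hw0 l p) (mul_nonneg (Nat.cast_nonneg (α := ℝ) (m - l)) hs₁))
    have h4 : R (l + 1) p = K * Real.sqrt ((l + p).factorial : ℝ) * N (m - l - 1) (n - p) * N₀ := by
      simp only [hR]
      rw [show l + 1 + p - 1 = l + p by omega, Nat.sub_sub]
    rw [h4]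
    linarith
  have h0 : M - ∑ l ∈ Finset.range (m + 1), ∑ p ∈ Finset.range (n + 1), w l p *
      (2 * K * (((l + p : ℕ) : ℝ) ^ e * Real.sqrt ((l + p).factorial : ℝ)
        * N (m - l) (n - p) * N₀)) ≤
      ∑ l ∈ Finset.range (m + 1), ∑ p ∈ Finset.range (n + 1),
        (w l p * A l p - w l p * (p * R l p) - w l p * (l * R l p)) := by
    have hMs : M = ∑ l ∈ Finset.range (m + 1), ∑ p ∈ Finset.range (n + 1),
        if l = 0 ∧ p = 0 then M else 0 := by
      simp [ite_and]
    rw [hMs, ← Finset.sum_sub_distrib]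
    refine Finset.sum_le_sum fun l _ => ?_
    rw [← Finset.sum_sub_distrib]
    refine Finset.sum_le_sum fun p _ => ?_
    by_cases h : l = 0 ∧ p = 0
    -- Here the subtracted term vanishes because 0^e = 0, and only the main term remains.
    · obtain ⟨rfl, rfl⟩ := h
      simp [hw, Real.zero_rpow (by linarith : e ≠ 0), hM]
    · rw [if_neg h]
      have hq : 1 ≤ l + p := by omega
      set Z := K * Real.sqrt ((l + p).factorial : ℝ) * N (m - l) (n - p) * N₀ with hZ
      have hZ0 : 0 ≤ Z := mul_nonneg (mul_nonneg (mul_nonneg hK (Real.sqrt_nonneg _)) (hN _ _)) hN₀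
      have hRZ : R l p ≤ Z := by
        refine mul_le_mul_of_nonneg_right (mul_le_mul_of_nonneg_right
          (mul_le_mul_of_nonneg_left (sqrt_factorial_mono (by omega)) hK) (hN _ _)) hN₀
      have h5 : (1 : ℝ) ≤ ((l + p : ℕ) : ℝ) := by exact_mod_cast hq
      have h6 := nat_le_rpow he (l + p)
      -- One copy of q^e Z pays for the pairing itself and one for the two lost-operator terms,
      -- whose coefficients l and p add up to q.
      have h7 : Z + ((l + p : ℕ) : ℝ) * R l p ≤ 2 * (((l + p : ℕ) : ℝ) ^ e * Z) := by
        have h8 : ((l + p : ℕ) : ℝ) * R l p ≤ ((l + p : ℕ) : ℝ) ^ e * Z :=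
          mul_le_mul h6 hRZ (hR0 l p) (by positivity)
        have h9 : 1 * Z ≤ ((l + p : ℕ) : ℝ) ^ e * Z :=
          mul_le_mul_of_nonneg_right (h5.trans h6) hZ0
        linarith
      have h10 : -(2 * (((l + p : ℕ) : ℝ) ^ e * Z)) ≤ A l p - p * R l p - l * R l p := by
        have := hA l p
        push_cast at h7 ⊢
        linarith
      have h11 := mul_le_mul_of_nonneg_left h10 (hw0 l p)
      rw [hZ] at h11
      linarith
  simp only [Finset.sum_sub_distrib] at h0
  simp only [mul_add, Finset.sum_add_distrib]
  linarith

theorem sum_range_sum_range_eq (m n : ℕ) (G : ℕ → ℕ → ℝ) (h : G 0 0 = 0) :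
    ∑ l ∈ Finset.range (m + 1), ∑ p ∈ Finset.range (n + 1), G l p =
      ∑ l ∈ Finset.Icc 1 m, G l 0 + ∑ p ∈ Finset.Icc 1 n, G 0 p +
        ∑ l ∈ Finset.Icc 1 m, ∑ p ∈ Finset.Icc 1 n, G l p := by
  simp only [sum_range_succ_eq_Icc, Finset.sum_add_distrib, h]
  ring

/-! ### Estimates in H² and conclusion -/

namespace Sch

variable {γ : ℝ} (hγ : 0 ≤ γ)

theorem pair_lower_bound : ∃ K : ℝ, 0 < K ∧ ∀ (L : ℝ) (q : ℕ) (G F : Sch),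
    -(K * Real.sqrt (q.factorial : ℝ) * Real.sqrt (sigH hγ L G) * Real.sqrt (sigH hγ L F)) ≤
        sumLeTwo (fun α => pair hγ L q (Xα α G) (Xα α F)) ∧
    -(K * Real.sqrt (q.factorial : ℝ) * Real.sqrt (sigH hγ L G) * Real.sqrt (sigH hγ L F)) ≤
        sumLeTwo (fun α => pairZero hγ L q (Xα α G) (Xα α F)) := by
  have key : ∀ (C : ℝ) (_ : 0 ≤ C) (L : ℝ) (q : ℕ) (G F : Sch) (P : Sch → Sch → ℝ),
      (∀ G F : Sch, ∀ l : ℝ, 0 < l → -(C * Real.sqrt (q.factorial : ℝ) *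
        (l * int L (sig hγ G) + l⁻¹ * int L (sig hγ F))) ≤ P G F) →
      -(2 * C * Real.sqrt (q.factorial : ℝ) * Real.sqrt (sigH hγ L G) *
        Real.sqrt (sigH hγ L F)) ≤ sumLeTwo (fun α => P (Xα α G) (Xα α F)) := by
    intro C hC L q G F P h
    -- The parameter is optimised only after summation over α, so the product of the full H² norms
    -- results.
    have h1 := neg_sqrt_mul_sqrt_le (K := C * Real.sqrt (q.factorial : ℝ)) (by positivity)
      (sigH_nonneg hγ L G) (sigH_nonneg hγ L F)
      (X := sumLeTwo (fun α => P (Xα α G) (Xα α F))) fun l hl => by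
        refine le_trans (le_of_eq ?_) (sumLeTwo_mono fun α => h (Xα α G) (Xα α F) l hl)
        simp only [← neg_mul, sumLeTwo_mul, sumLeTwo_add, sigH]
    linarith
  obtain ⟨C, hC, h⟩ := cross_term hγ
  obtain ⟨C', hC', h'⟩ := cross_term_zero hγ
  refine ⟨2 * max C C', by positivity, fun L q G F => ⟨?_, ?_⟩⟩
  · refine le_trans ?_ (key C hC.le L q G F (pair hγ L q) fun G F l hl => h L q G F l hl)
    have : C ≤ max C C' := le_max_left _ _
    gcongr
  · refine le_trans ?_ (key C' hC'.le L q G F (pairZero hγ L q) fun G F l hl => h' L q G F l hl)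
    have : C' ≤ max C C' := le_max_right _ _
    gcongr

theorem pair_zero_lower_bound : ∃ C : ℝ, 0 < C ∧ ∀ (L : ℝ) (u : Sch),
    3 / 4 * normSigma L γ u ^ 2 - C * normH2 L (fun x v => jap v ^ (γ / 2) * u x v) ^ 2 ≤
      sumLeTwo (fun α => pair hγ L 0 (Xα α u) (Xα α u)) := by
  obtain ⟨C, hC, h⟩ := main_term hγ
  refine ⟨C, hC, fun L u => ?_⟩
  rw [normSigma_eq hγ, Real.sq_sqrt (sigH_nonneg hγ L u), normH2_sq_eq]
  refine le_trans (le_of_eq ?_) (sumLeTwo_mono fun α => h L (Xα α u))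
  simp only [sub_eq_add_neg, ← neg_mul, sumLeTwo_mul, sumLeTwo_add, sigH]

theorem Xα_HP (c₁ s₁ c₂ s₂ : ℝ) (m n : ℕ) (α : Fin 3 → ℕ) (u : Sch) :
    Xα α (HP c₁ s₁ c₂ s₂ m n u) = HP c₁ s₁ c₂ s₂ m n (Xα α u) :=
  Xα_comm_app (fun j => X_HP_comm c₁ s₁ c₂ s₂ j m n) α u

theorem innerH2_HP_Lop (c₁ s₁ c₂ s₂ L : ℝ) (m n : ℕ) (u : Sch) :
    innerH2 L (HP c₁ s₁ c₂ s₂ m n (Lop γ hγ u)) (HP c₁ s₁ c₂ s₂ m n u) =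
    ∑ l ∈ Finset.range (m + 1), ∑ p ∈ Finset.range (n + 1),
      ((m.choose l : ℝ) * s₁ ^ l * ((n.choose p : ℝ) * s₂ ^ p)) *
        (sumLeTwo (fun α => pair hγ L (l + p) (Xα α (HP c₁ s₁ c₂ s₂ (m - l) (n - p) u))
            (Xα α (HP c₁ s₁ c₂ s₂ m n u))) +
          (((n - p : ℕ) : ℝ) * s₂ * sumLeTwo (fun α => pairZero hγ L (l + p)
            (Xα α (HP c₁ s₁ c₂ s₂ (m - l) (n - p - 1) u)) (Xα α (HP c₁ s₁ c₂ s₂ m n u))) +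
          ((m - l : ℕ) : ℝ) * s₁ * sumLeTwo (fun α => pairZero hγ L (l + p)
            (Xα α (HP c₁ s₁ c₂ s₂ (m - l - 1) (n - p) u)) (Xα α (HP c₁ s₁ c₂ s₂ m n u))))) := by
  rw [innerH2_eq]
  simp only [Xα_HP, Xα_comm_app (fun j => X_Lop_comm hγ j), int_HP_Lop, sumLeTwo_sum,
    sumLeTwo_mul, sumLeTwo_add]

end Sch

end LandauHard

end

theorem proposition3p4 (γ : ℝ) (hγ : 0 ≤ γ) :
    ∃ C₄ : ℝ, 0 < C₄ ∧
      ∀ (L : ℝ), 0 < L →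
      ∀ (m n : ℕ), 1 ≤ m → 1 ≤ n →
      ∀ (f : E3 → E3 → ℝ), MemHInftySchwartz L f →
      ∀ (δ₁ δ₂ : ℝ), 3 / 2 < δ₁ → 3 / 2 < δ₂ →
      ∀ (t : ℝ), 0 ≤ t →
        innerH2 L (HH t δ₁ δ₂ m n (L1 γ f)) (HH t δ₁ δ₂ m n f) ≥
          3 / 4 * normSigma L γ (HH t δ₁ δ₂ m n f) ^ 2
          - C₄ * normH2 L (fun x v => jap v ^ (γ / 2) * HH t δ₁ δ₂ m n f x v) ^ 2
          - C₄ * ∑ l ∈ Finset.Icc 1 m,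
              (m.choose l : ℝ) * (l : ℝ) ^ ((⌊γ⌋ : ℝ) / 2 + 2) * Real.sqrt (l.factorial : ℝ)
                * t ^ (δ₁ * (l : ℝ))
                * normSigma L γ (HH t δ₁ δ₂ (m - l) n f) * normSigma L γ (HH t δ₁ δ₂ m n f)
          - C₄ * ∑ l ∈ Finset.Icc 0 m,
              (m.choose l : ℝ) * (l : ℝ) ^ ((⌊γ⌋ : ℝ) / 2 + 1) * Real.sqrt (l.factorial : ℝ)
                * (n : ℝ) * t ^ (δ₁ * (l : ℝ)) * t ^ δ₂
                * normSigma L γ (HH t δ₁ δ₂ (m - l) (n - 1) f)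
                * normSigma L γ (HH t δ₁ δ₂ m n f)
          - C₄ * ∑ p ∈ Finset.Icc 1 n,
              (n.choose p : ℝ) * (p : ℝ) ^ ((⌊γ⌋ : ℝ) / 2 + 2) * Real.sqrt (p.factorial : ℝ)
                * t ^ (δ₂ * (p : ℝ))
                * normSigma L γ (HH t δ₁ δ₂ m (n - p) f) * normSigma L γ (HH t δ₁ δ₂ m n f)
          - C₄ * ∑ p ∈ Finset.Icc 0 n,
              (n.choose p : ℝ) * (p : ℝ) ^ ((⌊γ⌋ : ℝ) / 2 + 1) * Real.sqrt (p.factorial : ℝ)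
                * (m : ℝ) * t ^ δ₁ * t ^ (δ₂ * (p : ℝ))
                * normSigma L γ (HH t δ₁ δ₂ (m - 1) (n - p) f)
                * normSigma L γ (HH t δ₁ δ₂ m n f)
          - C₄ * ∑ l ∈ Finset.Icc 1 m, ∑ p ∈ Finset.Icc 1 n,
              (n.choose p : ℝ) * (m.choose l : ℝ)
                * ((p : ℝ) + (l : ℝ)) ^ ((⌊γ⌋ : ℝ) / 2 + 2)
                * Real.sqrt ((p + l).factorial : ℝ)
                * t ^ (δ₁ * (l : ℝ)) * t ^ (δ₂ * (p : ℝ))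
                * normSigma L γ (HH t δ₁ δ₂ (m - l) (n - p) f)
                * normSigma L γ (HH t δ₁ δ₂ m n f) := by
  obtain ⟨C, hC, hmain⟩ := Sch.pair_zero_lower_bound hγ
  obtain ⟨K, hK, hpair⟩ := Sch.pair_lower_bound hγ
  -- `C` serves the lower-order norm in the main term and `2 * K` the sums; their sum serves both.
  refine ⟨C + 2 * K, by positivity, ?_⟩
  intro L _ m n _ _ f hf δ₁ δ₂ _ _ t ht
  obtain ⟨u, rfl⟩ : ∃ u : Sch, f = u := ⟨Sch.of f hf.isSch, rfl⟩
  rw [Sch.L1_eq hγ]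
  have he : (1 : ℝ) ≤ (⌊γ⌋ : ℝ) / 2 + 2 := by
    have : (0 : ℝ) ≤ (⌊γ⌋ : ℝ) := by exact_mod_cast Int.floor_nonneg.mpr hγ
    linarith
  have hpow : ∀ (δ : ℝ) (l : ℕ), t ^ (δ * (l : ℝ)) = (t ^ δ) ^ l := fun δ l =>
    Real.rpow_mul_natCast ht δ l
  have hs₁ : 0 ≤ t ^ δ₁ := Real.rpow_nonneg ht _
  have hs₂ : 0 ≤ t ^ δ₂ := Real.rpow_nonneg ht _
  set c₁ := 1 / (δ₁ + 1) * t ^ (δ₁ + 1)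
  set c₂ := 1 / (δ₂ + 1) * t ^ (δ₂ + 1)
  set e := (⌊γ⌋ : ℝ) / 2 + 2
  set N : ℕ → ℕ → ℝ := fun i j => normSigma L γ (HH t δ₁ δ₂ i j u) with hN_def
  have hN : ∀ i j, 0 ≤ N i j := fun i j => Real.sqrt_nonneg _
  have hNeq : ∀ i j, N i j = Real.sqrt (Sch.sigH hγ L (Sch.HP c₁ (t ^ δ₁) c₂ (t ^ δ₂) i j u)) := fun i j => by
    rw [hN_def]; simp only [Sch.HH_eq, Sch.normSigma_eq hγ]; rfl
  have hHH : ∀ i j w, HH t δ₁ δ₂ i j (w : Sch) = Sch.HP c₁ (t ^ δ₁) c₂ (t ^ δ₂) i j w :=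
    fun i j w => Sch.HH_eq t δ₁ δ₂ i j w
  have hD : 0 ≤ normH2 L (fun x v => jap v ^ (γ / 2) * HH t δ₁ δ₂ m n u x v) ^ 2 := sq_nonneg _
  have key := binomial_sum_lower_bound (M := 3 / 4 * N m n ^ 2
      - C * normH2 L (fun x v => jap v ^ (γ / 2) * HH t δ₁ δ₂ m n u x v) ^ 2) hK.le hs₁ hs₂ he (hN m n) m n N
    (fun l p => sumLeTwo fun α => Sch.pair hγ L (l + p)
      (Sch.Xα α (Sch.HP c₁ (t ^ δ₁) c₂ (t ^ δ₂) (m - l) (n - p) u))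
      (Sch.Xα α (Sch.HP c₁ (t ^ δ₁) c₂ (t ^ δ₂) m n u)))
    (fun l p => sumLeTwo fun α => Sch.pairZero hγ L (l + p)
      (Sch.Xα α (Sch.HP c₁ (t ^ δ₁) c₂ (t ^ δ₂) (m - l - 1) (n - p) u))
      (Sch.Xα α (Sch.HP c₁ (t ^ δ₁) c₂ (t ^ δ₂) m n u)))
    (fun l p => sumLeTwo fun α => Sch.pairZero hγ L (l + p)
      (Sch.Xα α (Sch.HP c₁ (t ^ δ₁) c₂ (t ^ δ₂) (m - l) (n - p - 1) u))
      (Sch.Xα α (Sch.HP c₁ (t ^ δ₁) c₂ (t ^ δ₂) m n u)))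
    hN (by simp only [hN_def, hHH]; exact hmain L _) (fun l p => by rw [hNeq, hNeq]; exact (hpair L _ _ _).1)
    (fun l p => by rw [hNeq, hNeq]; exact (hpair L _ _ _).2)
    (fun l p => by rw [hNeq, hNeq]; exact (hpair L _ _ _).2)
  rw [← Sch.innerH2_HP_Lop, ← hHH, ← hHH, sum_range_sum_range_eq _ _ _ (by
    simp [Real.zero_rpow (by linarith : e ≠ 0)])] at key
  refine ge_iff_le.mpr (le_trans ?_ key)
  simp only [hpow]
  have hE : ∀ (S T : ℝ), 0 ≤ S → T = 2 * K * S → T ≤ (C + 2 * K) * S := fun S T hS hT => by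
    rw [hT]; exact mul_le_mul_of_nonneg_right (by linarith) hS
  have b1 : ∑ l ∈ Finset.Icc 1 m, ((m.choose l : ℝ) * (t ^ δ₁) ^ l *
      ((n.choose 0 : ℝ) * (t ^ δ₂) ^ 0)) * (2 * K * (((l + 0 : ℕ) : ℝ) ^ e *
        Real.sqrt ((l + 0).factorial : ℝ) * N (m - l) (n - 0) * N m n)) ≤ (C + 2 * K) *
      ∑ l ∈ Finset.Icc 1 m, (m.choose l : ℝ) * (l : ℝ) ^ e * Real.sqrt (l.factorial : ℝ)
        * (t ^ δ₁) ^ l * N (m - l) n * N m n := by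
    rw [Finset.mul_sum]
    refine Finset.sum_le_sum fun l _ => hE _ _ ?_ ?_
    · have := hN (m - l) n; have := hN m n; positivity
    · simp only [add_zero, Nat.choose_zero_right, pow_zero, Nat.sub_zero]; push_cast; ring
  have b2 : ∑ p ∈ Finset.Icc 1 n, ((m.choose 0 : ℝ) * (t ^ δ₁) ^ 0 *
      ((n.choose p : ℝ) * (t ^ δ₂) ^ p)) * (2 * K * (((0 + p : ℕ) : ℝ) ^ e *
        Real.sqrt ((0 + p).factorial : ℝ) * N (m - 0) (n - p) * N m n)) ≤ (C + 2 * K) *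
      ∑ p ∈ Finset.Icc 1 n, (n.choose p : ℝ) * (p : ℝ) ^ e * Real.sqrt (p.factorial : ℝ)
        * (t ^ δ₂) ^ p * N m (n - p) * N m n := by
    rw [Finset.mul_sum]
    refine Finset.sum_le_sum fun p _ => hE _ _ ?_ ?_
    · have := hN m (n - p); have := hN m n; positivity
    · simp only [zero_add, Nat.choose_zero_right, pow_zero, Nat.sub_zero]; push_cast; ring
  have b3 : ∑ l ∈ Finset.Icc 1 m, ∑ p ∈ Finset.Icc 1 n, ((m.choose l : ℝ) * (t ^ δ₁) ^ l *
      ((n.choose p : ℝ) * (t ^ δ₂) ^ p)) * (2 * K * (((l + p : ℕ) : ℝ) ^ e *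
        Real.sqrt ((l + p).factorial : ℝ) * N (m - l) (n - p) * N m n)) ≤ (C + 2 * K) *
      ∑ l ∈ Finset.Icc 1 m, ∑ p ∈ Finset.Icc 1 n, (n.choose p : ℝ) * (m.choose l : ℝ)
        * ((p : ℝ) + (l : ℝ)) ^ e * Real.sqrt ((p + l).factorial : ℝ)
        * (t ^ δ₁) ^ l * (t ^ δ₂) ^ p * N (m - l) (n - p) * N m n := by
    simp only [Finset.mul_sum]
    refine Finset.sum_le_sum fun l _ => Finset.sum_le_sum fun p _ => hE _ _ ?_ ?_
    · have := hN (m - l) (n - p); have := hN m n; positivity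
    · rw [Nat.add_comm l p, Nat.cast_add]; ring
  -- The pairings with a lost operator were already absorbed by the shift of index, so this sum and
  -- the next need only be nonnegative.
  have b4 : 0 ≤ (C + 2 * K) * ∑ l ∈ Finset.Icc 0 m, (m.choose l : ℝ) *
      (l : ℝ) ^ ((⌊γ⌋ : ℝ) / 2 + 1) * Real.sqrt (l.factorial : ℝ) * (n : ℝ) * (t ^ δ₁) ^ l * t ^ δ₂
        * N (m - l) (n - 1) * N m n := by
    refine mul_nonneg (by positivity) (Finset.sum_nonneg fun l _ => ?_)
    have := hN (m - l) (n - 1); have := hN m n; positivity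
  have b5 : 0 ≤ (C + 2 * K) * ∑ p ∈ Finset.Icc 0 n, (n.choose p : ℝ) *
      (p : ℝ) ^ ((⌊γ⌋ : ℝ) / 2 + 1) * Real.sqrt (p.factorial : ℝ) * (m : ℝ) * t ^ δ₁ * (t ^ δ₂) ^ p
        * N (m - 1) (n - p) * N m n := by
    refine mul_nonneg (by positivity) (Finset.sum_nonneg fun p _ => ?_)
    have := hN (m - 1) (n - p); have := hN m n; positivity
  have b6 := mul_nonneg hK.le hD
  linarith
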